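/- **Setting.** Let $d\ge 1$, let $D\subset\mathbb R^d$ be a (bounded) Lipschitz domain, $E\supseteq D$ open, and let $\varrho\colon E\times E\to\mathbb R$ be the covariance function of a zero-mean Gaussian random field $(\mathcal Z(\boldsymbol x,\cdot))_{\boldsymbol x\in E}$. Assume that $\varrho$ is asymptotically smooth with constants $c_1,c_2>0$: it is $C^\infty$ on $\{(\boldsymbol x,\boldsymbol y)\in E\times E:\boldsymbol x\ne\boldsymbol y\}$ and there $|\partial_{\boldsymbol x}^\alpha\partial_{\boldsymbol y}^\beta\varrho(\boldsymbol x,\boldsymbol y)|\le c_1(c_2|\boldsymbol x-\boldsymbol y|)^{-|\alpha|_1-|\beta|_1}\,(|\alpha|_1+|\beta|_1)!$ for all multi-indices with $|\alpha|_1+|\beta|_1\ge 1$. Let $N\ge1$ and let $\mathcal N=\{\boldsymbol x_1,\dots,\boldsymbol x_N\}\subset D$ be quasi-uniformly distributed with constant $C_{\rm u}>0$: distinct points have distance at least $C_{\rm u}^{-1}N^{-1/d}$, and every point of $D$ has distance at most $C_{\rm u}N^{-1/d}$ from $\mathcal N$. Put $\boldsymbol C=(\varrho(\boldsymbol x_i,\boldsymbol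 x_j))_{i,j}\in\mathbb R^{N\times N}$. **The $H^2$-matrix $\boldsymbol C_p$.** For $X\subseteq\mathcal N$ let $B_X$ be the smallest axis-parallel box containing $X$. The cluster tree has root $\mathcal N$; a cluster $X$ with $|X|>C_{\rm leaf}$ (where $C_{\rm leaf}\ge2$) has two sons, the points of $X$ in the closed lower half of $B_X$, halved along a longest edge, and the remaining points; clusters with $|X|\le C_{\rm leaf}$ are leaves. A pair $(X,Y)$ is admissible if $\max\{\operatorname{diam}B_X,\operatorname{diam}B_Y\}\le\eta\,\operatorname{dist}(B_X,B_Y)$. The block tree has root $(\mathcal N,\mathcal N)$; a pair that is admissible or consists of two leaves is not split, and otherwise the components that are not leaves are replaced by their sons. The admissible leaves of the block tree are the far-field blocks, the other leaves the near-field blocks; assume $B_X,B_Y\subseteq E$ for each far-field block $(X,Y)$. Let $p\ge1$, let $q^X_n$ $(1\le n\le p^d)$ be the tensor-product Chebyshev nodes ($p$ per direction) transformed to $B_X$ and $L^X_n$ their Lagrange basis functions (in a direction in which $B_X$ has length zero the interpolation is taken to be exact). Then $(\boldsymbol C_p)_{ij}=\sum_{n,m}L^X_n(\boldsymbol x_i)\,\varrho(q^X_n,q^Y_m)\,L^Y_m(\boldsymbol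 x_j)$ if $(\boldsymbol x_i,\boldsymbol x_j)$ lies in the far-field block $(X,Y)$, and $(\boldsymbol C_p)_{ij}=\boldsymbol C_{ij}$ if it lies in a near-field block. A product $\boldsymbol C_p\boldsymbol v$ is computed by the usual $H^2$-multiplication (forward transformation, coupling, backward transformation, near field) from the stored leaf, transfer, coupling and near-field matrices. **The algorithm.** Input: $\boldsymbol M=\boldsymbol C_p$, $\boldsymbol z\in\mathbb R^N$, $k\in\mathbb N_0$, $s>0$, and temporary vectors $\boldsymbol z^1,\dots,\boldsymbol z^k\in\mathbb R^N$ with arbitrary contents. Output: $\boldsymbol y=s^{-1/2}\,\mathtt{PartA}(s\boldsymbol M,\boldsymbol z,k)$. Here $\mathtt{PartA}(\cdot,\boldsymbol z,0)$ returns $s\boldsymbol M\boldsymbol z$ and $\mathtt{PartB}(\cdot,\boldsymbol z,0)$ returns $\boldsymbol z$; for $k\ge1$, $\mathtt{PartA}(\cdot,\boldsymbol z,k)$ computes $\boldsymbol z^k:=\mathtt{PartA}(\cdot,\boldsymbol z,k-1)$, $\boldsymbol z^k:=\mathtt{PartB}(\cdot,\boldsymbol z^k,k-1)$, $\boldsymbol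 z:=3\boldsymbol z-\boldsymbol z^k$ and returns $\frac12\mathtt{PartA}(\cdot,\boldsymbol z,k-1)$, and $\mathtt{PartB}$ is the same with $\mathtt{PartA}$ and $\mathtt{PartB}$ exchanged. A call overwrites the vector that holds its argument by its result, and $\boldsymbol z^k:=\mathtt{PartA}(\cdot,\boldsymbol z,k-1)$ (likewise with $\mathtt{PartB}$) first copies $\boldsymbol z$ to $\boldsymbol z^k$. **Notation.** $\lambda_{\max}(\boldsymbol M)=\sup_{\boldsymbol v\ne0}|\boldsymbol M\boldsymbol v|/|\boldsymbol v|$, $\lambda_{\min}(\boldsymbol M)=\inf_{\boldsymbol v\ne0}(\boldsymbol M\boldsymbol v)^T\boldsymbol v/|\boldsymbol v|^2$, and $\epsilon_p:=C_{\rm H}N(\log(p)+1)^{2d-1}\big(\tfrac{\eta}{4c_2}\big)^p$. **Theorem.** There is a constant $C_{\rm H}>0$, depending only on $d$ and $c_1$, and a constant $C_{\rm op}>0$, depending only on $d,c_1,D,C_{\rm leaf},C_{\rm u},\eta$, such that the following holds in the above setting whenever $0<\eta<4c_2$. First, $\|\boldsymbol C-\boldsymbol C_p\|_F\le\epsilon_p$,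 and $\epsilon_p<\lambda_{\min}(\boldsymbol C)$ implies that $\boldsymbol C_p$ is positive definite. Now suppose that $\boldsymbol C_p$ is positive definite and $0<s<2\|\boldsymbol C_p\|_2^{-1}$. Then $$\kappa:=\max\{|1-s\lambda_{\max}(\boldsymbol C_p)|,\ |1-s\lambda_{\min}(\boldsymbol C_p)|\}<1,$$ and for all $k\in\mathbb N_0$ and $\boldsymbol z\in\mathbb R^N$ the output $\boldsymbol y$ of the algorithm has the following properties. 1. $\boldsymbol y=s^{-1/2}\boldsymbol A_k\boldsymbol z$, where $\boldsymbol A_0=s\boldsymbol C_p$, $\boldsymbol B_0=\boldsymbol I$, $\boldsymbol A_{j+1}=\frac12\boldsymbol A_j(3\boldsymbol I-\boldsymbol B_j\boldsymbol A_j)$, $\boldsymbol B_{j+1}=\frac12\boldsymbol B_j(3\boldsymbol I-\boldsymbol A_j\boldsymbol B_j)$; moreover $\begin{pmatrix}0&\boldsymbol A_k\\ \boldsymbol B_k&0\end{pmatrix}$ is the $k$-th iterate of the Schulz iteration $\boldsymbol M_{j+1}=\frac12\boldsymbol M_j(3\boldsymbol I-\boldsymbol M_j^2)$ for the matrix sign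 function, started at $\boldsymbol M_0=\begin{pmatrix}0&s\boldsymbol C_p\\ \boldsymbol I&0\end{pmatrix}$. 2. $$|\boldsymbol C^{1/2}\boldsymbol z-\boldsymbol y|\le\Big(s^{-1/2}\kappa^{2^k}+\frac{2\,\epsilon_p}{\max\{\lambda_{\min}(\boldsymbol C),\lambda_{\min}(\boldsymbol C_p)\}^{1/2}}\Big)|\boldsymbol z|.$$ 3. The algorithm performs at most $C_{\rm op}\,3^k\,p^{2d}N$ arithmetic operations (including those of the $H^2$-multiplications). 4. Apart from the vector that holds the input and then the output, the algorithm uses at most $k$ vectors of length $N$, that is, at most $kN$ units of extra storage; the matrix data and the working memory inside a single $H^2$-multiplication are not counted. -/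

import Mathlib

open scoped MatrixOrder

noncomputable section

/-- Points of `ℝ^d` with the Euclidean norm. -/
abbrev Pt (d : ℕ) : Type := EuclideanSpace ℝ (Fin d)

/-! ### The domain, the points and the covariance function -/

/-- A Lipschitz domain: bounded, open, connected, nonempty, and near each boundary point it is,
after a choice of the vertical direction `e`, the strict epigraph of a Lipschitz function of
the component orthogonal to `e`. -/
def IsLipschitzDomain {d : ℕ} (D : Set (Pt d)) : Prop :=
  IsOpen D ∧ IsConnected D ∧ Bornology.IsBounded D ∧
    ∀ x₀ ∈ frontier D, ∃ (e : Pt d) (g : Pt d → ℝ) (K : NNReal) (r : ℝ),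
      ‖e‖ = 1 ∧ LipschitzWith K g ∧ 0 < r ∧
        ∀ y ∈ Metric.ball x₀ r, (y ∈ D ↔ g (y - inner ℝ e y • e) < inner ℝ e y)

/-- The `N` points `x 0, …, x (N-1)` lie in `D` and are quasi-uniformly distributed in `D` with
constant `Cu`: distinct points have distance at least `Cu⁻¹ N^{-1/d}`, and every point of `D` has
distance at most `Cu N^{-1/d}` from some `x i`. -/
def IsQuasiUniform {d N : ℕ} (D : Set (Pt d)) (x : Fin N → Pt d) (Cu : ℝ) : Prop :=
  (∀ i, x i ∈ D) ∧
  (∀ i j, i ≠ j → Cu⁻¹ * (N : ℝ) ^ (-(1 : ℝ) / (d : ℝ)) ≤ dist (x i) (x j)) ∧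
  (∀ y ∈ D, ∃ i, dist y (x i) ≤ Cu * (N : ℝ) ^ (-(1 : ℝ) / (d : ℝ)))

/-- Derivative of `f` in the fixed direction `v`. -/
def dirDeriv {V : Type*} [NormedAddCommGroup V] [NormedSpace ℝ V] (v : V) (f : V → ℝ) : V → ℝ :=
  fun q => fderiv ℝ f q v

/-- The mixed partial derivative `∂_x^α ∂_y^β ρ` as a function of the pair `(x, y)`. -/
def mixedPartial {d : ℕ} (α β : Fin d → ℕ) (ρ : Pt d → Pt d → ℝ) : Pt d × Pt d → ℝ :=
  (List.finRange d).foldr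
    (fun i f => (dirDeriv ((EuclideanSpace.single i (1 : ℝ), 0) : Pt d × Pt d))^[α i] f)
    ((List.finRange d).foldr
      (fun i f => (dirDeriv ((0, EuclideanSpace.single i (1 : ℝ)) : Pt d × Pt d))^[β i] f)
      (fun q => ρ q.1 q.2))

/-- `ρ` is asymptotically smooth on `E` with constants `c₁, c₂`: smooth off the diagonal of
`E × E`, with
`|∂_x^α ∂_y^β ρ(x,y)| ≤ c₁ (c₂ |x-y|)^{-|α|-|β|} (|α|+|β|)!` whenever `|α| + |β| ≥ 1`. -/
def IsAsymptoticallySmooth {d : ℕ} (E : Set (Pt d)) (ρ : Pt d → Pt d → ℝ) (c₁ c₂ : ℝ) : Prop :=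
  ContDiffOn ℝ (⊤ : ℕ∞) (fun q : Pt d × Pt d => ρ q.1 q.2)
    {q | q.1 ∈ E ∧ q.2 ∈ E ∧ q.1 ≠ q.2} ∧
  ∀ x ∈ E, ∀ y ∈ E, x ≠ y → ∀ α β : Fin d → ℕ, 1 ≤ ∑ i, α i + ∑ i, β i →
    |mixedPartial α β ρ (x, y)| ≤
      c₁ * ((c₂ * dist x y) ^ (∑ i, α i + ∑ i, β i))⁻¹
        * (Nat.factorial (∑ i, α i + ∑ i, β i) : ℝ)

/-- `(Z y)_{y ∈ E}` is a zero-mean Gaussian random field on the probability space `(Ω, P)` with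
covariance function `ρ`. -/
def IsGaussianFieldWithCov {d : ℕ} {Ω : Type*} [MeasurableSpace Ω]
    (P : MeasureTheory.Measure Ω) (E : Set (Pt d)) (Z : Pt d → Ω → ℝ)
    (ρ : Pt d → Pt d → ℝ) : Prop :=
  ProbabilityTheory.IsGaussianProcess (fun y : E => Z y) P ∧
  (∀ y ∈ E, ∫ ω, Z y ω ∂P = 0) ∧
  (∀ y ∈ E, ∀ y' ∈ E, ∫ ω, Z y ω * Z y' ω ∂P = ρ y y')

/-! ### Matrices -/

/-- Spectral norm. -/
def specNorm {N : ℕ} (M : Matrix (Fin N) (Fin N) ℝ) : ℝ :=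
  ‖Matrix.toEuclideanCLM (𝕜 := ℝ) M‖

/-- Frobenius norm. -/
def frobNorm {N : ℕ} (M : Matrix (Fin N) (Fin N) ℝ) : ℝ :=
  Real.sqrt (∑ i, ∑ j, M i j ^ 2)

/-- Euclidean norm of a coordinate vector. -/
def eucNorm {N : ℕ} (v : Fin N → ℝ) : ℝ := ‖(WithLp.toLp 2 v : Pt N)‖

/-- `sup |M z| / |z|` over nonzero `z`. -/
def lambdaMax {N : ℕ} (M : Matrix (Fin N) (Fin N) ℝ) : ℝ :=
  ⨆ z : {z : Fin N → ℝ // z ≠ 0}, eucNorm (M.mulVec z.1) / eucNorm z.1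

/-- `inf (M z)ᵀ z / |z|²` over nonzero `z`. -/
def lambdaMin {N : ℕ} (M : Matrix (Fin N) (Fin N) ℝ) : ℝ :=
  ⨅ z : {z : Fin N → ℝ // z ≠ 0}, (M.mulVec z.1 ⬝ᵥ z.1) / eucNorm z.1 ^ 2

/-- The Schulz iteration `M_{k+1} = ½ M_k (3 I - M_k²)` for the matrix sign function. -/
def schulz {ι : Type*} [Fintype ι] [DecidableEq ι] (M : Matrix ι ι ℝ) : ℕ → Matrix ι ι ℝ
  | 0 => M
  | k + 1 => (1 / 2 : ℝ) • (schulz M k * ((3 : ℝ) • 1 - schulz M k ^ 2))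

/-- The coupled iteration `A_{k+1} = ½ A_k (3 I - B_k A_k)`, `B_{k+1} = ½ B_k (3 I - A_k B_k)`
with `A_0 = M`, `B_0 = I`, as the pair `(A_k, B_k)`. -/
def coupledSchulz {N : ℕ} (M : Matrix (Fin N) (Fin N) ℝ) :
    ℕ → Matrix (Fin N) (Fin N) ℝ × Matrix (Fin N) (Fin N) ℝ
  | 0 => (M, 1)
  | k + 1 =>
    let A := (coupledSchulz M k).1
    let B := (coupledSchulz M k).2
    ((1 / 2 : ℝ) • (A * ((3 : ℝ) • 1 - B * A)), (1 / 2 : ℝ) • (B * ((3 : ℝ) • 1 - A * B)))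

/-! ### Chebyshev interpolation on `[-1, 1]` -/

/-- The `p` Chebyshev nodes `cos((2m+1)π/(2p))`, `0 ≤ m < p`. -/
def chebNode (p : ℕ) (m : Fin p) : ℝ :=
  Real.cos ((2 * (m : ℝ) + 1) * Real.pi / (2 * (p : ℝ)))

/-- The corresponding Lagrange basis functions. -/
def chebLagrange (p : ℕ) (m : Fin p) (t : ℝ) : ℝ :=
  (Lagrange.basis Finset.univ (chebNode p) m).eval t

/-! ### Cluster trees

A cluster is a set of indices of points. -/

/-- Binary trees whose nodes carry a cluster. -/
inductive CTree (N : ℕ) : Type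
  | leaf (X : Finset (Fin N)) : CTree N
  | node (X : Finset (Fin N)) (l r : CTree N) : CTree N

/-- The cluster at the root. -/
def CTree.pts {N : ℕ} : CTree N → Finset (Fin N)
  | .leaf X => X
  | .node X _ _ => X

/-- The data that determine the `H²`-matrix. -/
structure H2Data (d N : ℕ) where
  /-- evaluation points -/
  x : Fin N → Pt d
  /-- covariance function -/
  ρ : Pt d → Pt d → ℝ
  /-- clusters with at most this many points are not split -/
  Cleaf : ℕ
  /-- admissibility parameter -/
  η : ℝ
  /-- interpolation order: number of Chebyshev nodes per coordinate direction -/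
  p : ℕ
  /-- the coordinate direction in which a cluster is split -/
  dir : Finset (Fin N) → Fin d

namespace H2Data

variable {d N : ℕ} (S : H2Data d N)

/-- Multi-indices of the `p^d` tensor-product nodes. -/
abbrev Idx (_S : H2Data d N) : Type := Fin d → Fin _S.p

/-- The exact covariance matrix. -/
def covMatrix : Matrix (Fin N) (Fin N) ℝ := Matrix.of fun i j => S.ρ (S.x i) (S.x j)

/-! #### Bounding boxes -/

/-- Lower corner of the smallest axis-parallel box containing the points of `X`. -/
def lo (X : Finset (Fin N)) (j : Fin d) : ℝ := sInf ((fun i => S.x i j) '' (X : Set (Fin N)))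

/-- Upper corner of the smallest axis-parallel box containing the points of `X`. -/
def hi (X : Finset (Fin N)) (j : Fin d) : ℝ := sSup ((fun i => S.x i j) '' (X : Set (Fin N)))

/-- The bounding box `B_X`. -/
def box (X : Finset (Fin N)) : Set (Pt d) := {y | ∀ j, S.lo X j ≤ y j ∧ y j ≤ S.hi X j}

/-- Midpoint of the bounding box. -/
def mid (X : Finset (Fin N)) (j : Fin d) : ℝ := (S.lo X j + S.hi X j) / 2

/-- Half edge lengths of the bounding box. -/
def half (X : Finset (Fin N)) (j : Fin d) : ℝ := (S.hi X j - S.lo X j) / 2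

/-- `S.dir X` is always the direction of a longest edge of `B_X` (any rule breaking ties is
allowed). -/
def SplitsLongestEdge : Prop :=
  ∀ X : Finset (Fin N), X.Nonempty → ∀ j, S.half X j ≤ S.half X (S.dir X)

/-- Euclidean distance of two bounding boxes. -/
def boxDist (X Y : Finset (Fin N)) : ℝ := ⨅ q : S.box X × S.box Y, dist (q.1 : Pt d) (q.2 : Pt d)

/-- The admissibility condition. -/
def Admissible (X Y : Finset (Fin N)) : Prop :=
  max (Metric.diam (S.box X)) (Metric.diam (S.box Y)) ≤ S.η * S.boxDist X Y

/-! #### Cluster tree and block partition -/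

open Classical in
/-- The son of `X` in the lower half of `B_X`. -/
def lowerSon (X : Finset (Fin N)) : Finset (Fin N) :=
  X.filter fun i => S.x i (S.dir X) ≤ S.mid X (S.dir X)

/-- The other son of `X`. -/
def upperSon (X : Finset (Fin N)) : Finset (Fin N) := X \ S.lowerSon X

/-- The cluster tree below `X`, of depth at most the first argument. For distinct points the
number of points strictly decreases from a cluster to its sons, so depth `N` is no
restriction. -/
def build : ℕ → Finset (Fin N) → CTree N
  | 0, X => .leaf X
  | n + 1, X =>
    if X.card ≤ S.Cleaf then .leaf X
    else .node X (build n (S.lowerSon X)) (build n (S.upperSon X))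

/-- The cluster tree. -/
def clusterTree : CTree N := S.build N Finset.univ

open Classical in
/-- The leaves of the block-cluster tree with the given root. -/
def blockLeaves : CTree N → CTree N → List (Finset (Fin N) × Finset (Fin N))
  | .leaf X, .leaf Y => [(X, Y)]
  | .leaf X, .node Y l r =>
    if S.Admissible X Y then [(X, Y)]
    else blockLeaves (.leaf X) l ++ blockLeaves (.leaf X) r
  | .node X l r, .leaf Y =>
    if S.Admissible X Y then [(X, Y)]
    else blockLeaves l (.leaf Y) ++ blockLeaves r (.leaf Y)
  | .node X l r, .node Y l' r' =>
    if S.Admissible X Y then [(X, Y)]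
    else blockLeaves l l' ++ blockLeaves l r' ++ blockLeaves r l' ++ blockLeaves r r'
termination_by T T' => sizeOf T + sizeOf T'

open Classical in
/-- Far-field blocks: the admissible leaves of the block-cluster tree. -/
def far : List (Finset (Fin N) × Finset (Fin N)) :=
  (S.blockLeaves S.clusterTree S.clusterTree).filter fun b => S.Admissible b.1 b.2

open Classical in
/-- Near-field blocks: the remaining leaves of the block-cluster tree. -/
def near : List (Finset (Fin N) × Finset (Fin N)) :=
  (S.blockLeaves S.clusterTree S.clusterTree).filter fun b => ¬ S.Admissible b.1 b.2

/-! #### The `H²`-matrix -/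

/-- The Chebyshev nodes transformed to `B_X`. -/
def chebPt (X : Finset (Fin N)) (n : S.Idx) : Pt d :=
  WithLp.toLp 2 fun j => S.mid X j + S.half X j * chebNode S.p (n j)

/-- The Lagrange basis functions of the transformed nodes. In a direction in which `B_X` has
length zero all nodes coincide; there `0 / 0 = 0` makes the factor the constant
`chebLagrange S.p (n j) 0`. These constants sum to one, so interpolation is exact in
such a direction. -/
def lagrange (X : Finset (Fin N)) (n : S.Idx) (y : Pt d) : ℝ :=
  ∏ j, chebLagrange S.p (n j) ((y j - S.mid X j) / S.half X j)

/-- The leaf matrix `V^X`. -/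
def V (X : Finset (Fin N)) (i : Fin N) (n : S.Idx) : ℝ := S.lagrange X n (S.x i)

/-- The coupling matrix `M^{XY}`. -/
def M (X Y : Finset (Fin N)) (n m : S.Idx) : ℝ := S.ρ (S.chebPt X n) (S.chebPt Y m)

/-- The transfer matrix `T^{X'X}` for a son `X'` of `X`. -/
def T (X' X : Finset (Fin N)) (m n : S.Idx) : ℝ := S.lagrange X n (S.chebPt X' m)

/-- The `H²`-matrix `C_p`: it is `V^X M^{XY} (V^Y)ᵀ` on the far-field blocks and equal to the
covariance matrix on the near-field blocks. -/
def h2Matrix : Matrix (Fin N) (Fin N) ℝ := Matrix.of fun i j =>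
  (S.far.map fun b => if i ∈ b.1 ∧ j ∈ b.2 then
    ∑ n, ∑ m, S.V b.1 i n * S.M b.1 b.2 n m * S.V b.2 j m else 0).sum +
  (S.near.map fun b => if i ∈ b.1 ∧ j ∈ b.2 then S.covMatrix i j else 0).sum

end H2Data

/-! ### Computations with a count of the arithmetic operations -/

/-- A value together with the number of real operations spent on computing it. -/
structure Counted (α : Type) where
  /-- result -/
  val : α
  /-- number of arithmetic operations -/
  ops : ℕ

namespace Counted

instance : Monad Counted where
  pure a := ⟨a, 0⟩
  bind m f := ⟨(f m.val).val, m.ops + (f m.val).ops⟩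

/-- Elementary operation of cost one. -/
def add (a b : ℝ) : Counted ℝ := ⟨a + b, 1⟩
/-- Elementary operation of cost one. -/
def sub (a b : ℝ) : Counted ℝ := ⟨a - b, 1⟩
/-- Elementary operation of cost one. -/
def mul (a b : ℝ) : Counted ℝ := ⟨a * b, 1⟩
/-- Elementary operation of cost one. -/
def div (a b : ℝ) : Counted ℝ := ⟨a / b, 1⟩
/-- Elementary operation of cost one. -/
def sqrt (a : ℝ) : Counted ℝ := ⟨Real.sqrt a, 1⟩

/-- Carry out a computation for every index. -/
def each {ι : Type} [Fintype ι] (f : ι → Counted ℝ) : Counted (ι → ℝ) :=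
  ⟨fun i => (f i).val, ∑ i, (f i).ops⟩

/-- Start from `a` and add, one after the other, the results of the computations `f i`,
`i ∈ s`. -/
def sumFrom {ι : Type} (a : ℝ) (s : Finset ι) (f : ι → Counted ℝ) : Counted ℝ :=
  s.toList.foldlM (fun acc i => do let t ← f i; add acc t) a

end Counted

/-! ### Fast matrix-vector multiplication with an `H²`-matrix

The matrices `V^X` for the leaves, the transfer matrices, the coupling matrices and the near-field
entries are stored; the routine below only multiplies and adds. -/

namespace H2Data

variable {d N : ℕ} (S : H2Data d N)

/-- Coefficient vectors of length `p^d`, one for each cluster. -/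
abbrev Coeffs (_S : H2Data d N) : Type := Finset (Fin N) → _S.Idx → ℝ

/-- Forward transformation: enters `(V^X)ᵀ v` for all clusters `X` of the tree, from the leaves to
the root, using `(V^X)ᵀ v = ∑ (T^{X'X})ᵀ (V^{X'})ᵀ v` over the sons `X'` of `X`. -/
def forward (v : Fin N → ℝ) : CTree N → S.Coeffs → Counted S.Coeffs
  | .leaf X, c => do
    let t ← Counted.each fun n => Counted.sumFrom 0 X fun i => Counted.mul (S.V X i n) (v i)
    pure (Function.update c X t)
  | .node X l r, c => do
    let c₁ ← forward v l c
    let c₂ ← forward v r c₁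
    let t ← Counted.each fun n => do
      let a ← Counted.sumFrom 0 Finset.univ fun m => Counted.mul (S.T l.pts X m n) (c₂ l.pts m)
      Counted.sumFrom a Finset.univ fun m => Counted.mul (S.T r.pts X m n) (c₂ r.pts m)
    pure (Function.update c₂ X t)

/-- Coupling: for every far-field block `(X, Y)` adds `M^{XY} a^Y` to `b^X`. -/
def couple (a : S.Coeffs) : List (Finset (Fin N) × Finset (Fin N)) → S.Coeffs →
    Counted S.Coeffs
  | [], b => pure b
  | (X, Y) :: L, b => do
    let t ← Counted.each fun n =>
      Counted.sumFrom (b X n) Finset.univ fun m => Counted.mul (S.M X Y n m) (a Y m)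
    couple a L (Function.update b X t)

open Classical in
/-- Backward transformation: hands the coefficients down from the root to the leaves and there
adds `V^X b^X` to the entries of `y` with index in `X`. -/
def backward : CTree N → S.Coeffs → (Fin N → ℝ) → Counted (Fin N → ℝ)
  | .leaf X, b, y => Counted.each fun i =>
      if i ∈ X then Counted.sumFrom (y i) Finset.univ fun n => Counted.mul (S.V X i n) (b X n)
      else pure (y i)
  | .node X l r, b, y => do
    let tl ← Counted.each fun m =>
      Counted.sumFrom (b l.pts m) Finset.univ fun n => Counted.mul (S.T l.pts X m n) (b X n)
    let tr ← Counted.each fun m =>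
      Counted.sumFrom (b r.pts m) Finset.univ fun n => Counted.mul (S.T r.pts X m n) (b X n)
    let b' := Function.update (Function.update b l.pts tl) r.pts tr
    let y' ← backward l b' y
    backward r b' y'

open Classical in
/-- Near field: for every near-field block `(X, Y)` adds `C|_{X × Y} v|_Y` to `y|_X`. -/
def nearMul (v : Fin N → ℝ) : List (Finset (Fin N) × Finset (Fin N)) → (Fin N → ℝ) →
    Counted (Fin N → ℝ)
  | [], y => pure y
  | (X, Y) :: L, y => do
    let y' ← Counted.each fun i =>
      if i ∈ X then Counted.sumFrom (y i) Y fun j => Counted.mul (S.covMatrix i j) (v j)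
      else pure (y i)
    nearMul v L y'

/-- Multiplication of the `H²`-matrix with a vector. -/
def matVec (v : Fin N → ℝ) : Counted (Fin N → ℝ) := do
  let a ← S.forward v S.clusterTree 0
  let b ← S.couple a S.far 0
  let y ← S.backward S.clusterTree b 0
  S.nearMul v S.near y

end H2Data

/-! ### The recursive algorithm

The algorithm works on vector registers `z⁰, z¹, z², …` of length `N`. Register `0` holds the input
vector and in the end the output; the registers `1, …, k` are the temporary storage vectors, with
arbitrary initial contents. -/

/-- Instructions. -/
inductive Instr : Type
  /-- `z^r := z^q` -/
  | copy (r q : ℕ) : Instr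
  /-- `z^r := s M z^r` -/
  | mult (r : ℕ) : Instr
  /-- `z^r := 3 z^r - z^q` -/
  | comb (r q : ℕ) : Instr
  /-- `z^r := ½ z^r` -/
  | halve (r : ℕ) : Instr
  /-- `z^r := z^r / √s` -/
  | unscale (r : ℕ) : Instr

/-- Registers that an instruction reads or writes. -/
def Instr.regs : Instr → Finset ℕ
  | .copy r q => {r, q}
  | .mult r => {r}
  | .comb r q => {r, q}
  | .halve r => {r}
  | .unscale r => {r}

/-- Registers that a program reads or writes. -/
def progRegs : List Instr → Finset ℕ
  | [] => ∅
  | i :: L => i.regs ∪ progRegs L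

mutual

/-- `PartA(z^r, k)`. A call overwrites the register `r` of its argument by the returned vector,
and `z^k := PartA(z)` first copies `z` to `z^k`. -/
def partA : ℕ → ℕ → List Instr
  | 0, r => [.mult r]
  | k + 1, r =>
    [.copy (k + 1) r] ++ partA k (k + 1) ++ partB k (k + 1) ++ [.comb r (k + 1)] ++
      partA k r ++ [.halve r]

/-- `PartB(z^r, k)`, with the same conventions. -/
def partB : ℕ → ℕ → List Instr
  | 0, _ => []
  | k + 1, r =>
    [.copy (k + 1) r] ++ partB k (k + 1) ++ partA k (k + 1) ++ [.comb r (k + 1)] ++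
      partB k r ++ [.halve r]

end

/-- The main program. -/
def recursiveSqrt (k : ℕ) : List Instr := partA k 0 ++ [.unscale 0]

/-- Execution of an instruction; `mv` is the multiplication routine for the matrix `M`. -/
def Instr.exec {N : ℕ} (mv : (Fin N → ℝ) → Counted (Fin N → ℝ)) (s : ℝ) :
    Instr → (ℕ → Fin N → ℝ) → Counted (ℕ → Fin N → ℝ)
  | .copy r q, z => pure (Function.update z r (z q))
  | .mult r, z => do
    let w ← mv (z r)
    let w' ← Counted.each fun i => Counted.mul s (w i)
    pure (Function.update z r w')
  | .comb r q, z => do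
    let w ← Counted.each fun i => do
      let a ← Counted.mul 3 (z r i)
      Counted.sub a (z q i)
    pure (Function.update z r w)
  | .halve r, z => do
    let w ← Counted.each fun i => Counted.mul (1 / 2) (z r i)
    pure (Function.update z r w)
  | .unscale r, z => do
    let a ← Counted.sqrt s
    let w ← Counted.each fun i => Counted.div (z r i) a
    pure (Function.update z r w)

/-- Execution of a program. -/
def runProg {N : ℕ} (mv : (Fin N → ℝ) → Counted (Fin N → ℝ)) (s : ℝ) :
    List Instr → (ℕ → Fin N → ℝ) → Counted (ℕ → Fin N → ℝ)
  | [], z => pure z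
  | i :: L, z => do
    let z' ← i.exec mv s z
    runProg mv s L z'

end

open scoped MatrixOrder

noncomputable section

/-! ### Chebyshev nodes and polynomials -/

-- Three largely independent estimates are combined: for the interpolated kernel, for the number of
-- blocks, and for the Schulz iteration.
--
-- Interpolation. The nodal polynomial of the Chebyshev nodes is 2^(1-p) T_p. On a coordinate line
-- of half length h, at distance at least D from the other box, the factorial in the asymptotic
-- smoothness cancels the one in the interpolation error, leaving 2c₁(h/(2c₂D))^p. Admissibility
-- gives 2h ≤ ηD, hence 2c₁(η/(4c₂))^p (`abs_sub_lineInterp_le`). Interpolating in the 2d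
-- coordinates of a pair of boxes one after the other multiplies these errors by powers of the
-- Lebesgue constant, which is at most 12(log p + 1) (`sum_abs_chebLagrange_le`); the result is
-- `abs_block_error_le`. The leaves of the block tree partition the N² index pairs, so the Frobenius
-- norm is at most N times this entrywise bound.
--
-- Cost. A multiplication needs O(p^(2d)) operations per block, and O(p^(2d) N) for both
-- transformations, so the number of blocks has to be O(N). The difficulty is that clusters of one
-- level may have very different sizes. Let h be a small multiple of N^(-1/d), below the separation
-- of the points, and K = (2 edge(root)/h)^d, which is O(N). A split block is not admissible, so its
-- clusters are close relative to the larger one, B, whose longest edge is at least h. If B is a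
-- leaf, the inner partners of B, over all levels, lie in a cube comparable to B and are at most as
-- many as the points there; this is a multiple of a fattened volume of B, and these volumes add up
-- to at most that of the root (`sum_splits_leaf_le`). If B is an inner cluster of level n, its edge
-- is at most h t² with t^d = √(K/2^n), because the fattened volume halves at each split. Near a
-- given cluster there are O(t^d) such B of size at least ht by a volume argument, and O(t^d)
-- smaller ones by counting points. The 2^n clusters of the level give O(√K √(2^n)) blocks, only
-- levels with 2^n ≤ K occur, and the geometric sum is O(K) (`sum_splits_inner_le`).
--
-- Square root. The matrix √C_p and the iterates A_k are diagonal in the eigenbasis of C_p, so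
-- convergence reduces to numbers 0 < μ < 2: the residual r = 1 - ab is mapped to r²(3+r)/4, which
-- is at most r² (`scalarSchulz_invariant`), and |√μ - a| is at most |r|
-- (`abs_sqrt_sub_scalarSchulz_le`). Passing from C to C_p is a perturbation of the square root,
-- controlled by X² - Y² = X(X-Y) + (X-Y)Y (`eucNorm_sqrt_sub_sqrt_mulVec_le`). The recursive
-- program is analysed by inductions on k for values (`val_partA_partB`), costs
-- (`ops_partA_partB_le`) and registers.

/-- The angle of a Chebyshev node. -/
def chebAngle (p : ℕ) (m : Fin p) : ℝ := (2 * (m : ℝ) + 1) * Real.pi / (2 * (p : ℝ))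

theorem chebNode_eq_cos (p : ℕ) (m : Fin p) : chebNode p m = Real.cos (chebAngle p m) := rfl

theorem chebAngle_mem (p : ℕ) (m : Fin p) : chebAngle p m ∈ Set.Icc 0 Real.pi := by
  have hp : (0 : ℝ) < p := by exact_mod_cast m.pos
  have hm : (m : ℝ) + 1 ≤ p := by exact_mod_cast m.isLt
  refine ⟨by unfold chebAngle; positivity, ?_⟩
  unfold chebAngle
  rw [div_le_iff₀ (by positivity)]
  nlinarith [Real.pi_pos]

theorem chebNode_injective (p : ℕ) : Function.Injective (chebNode p) := by
  intro a b h
  have hp : (0 : ℝ) < p := by exact_mod_cast a.pos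
  have := Real.injOn_cos (chebAngle_mem p a) (chebAngle_mem p b) h
  unfold chebAngle at this
  field_simp at this
  have h2 : (a : ℝ) = b := by linarith
  exact Fin.ext (by exact_mod_cast h2)

theorem abs_chebNode_le (p : ℕ) (m : Fin p) : |chebNode p m| ≤ 1 := Real.abs_cos_le_one _

theorem eval_T_chebNode (p : ℕ) (m : Fin p) :
    (Polynomial.Chebyshev.T ℝ p).eval (chebNode p m) = 0 := by
  have hp : (0 : ℝ) < p := by exact_mod_cast m.pos
  rw [chebNode_eq_cos, Polynomial.Chebyshev.T_real_cos, Real.cos_eq_zero_iff]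
  refine ⟨m, ?_⟩
  unfold chebAngle
  push_cast
  field_simp

/-- Equal degrees and leading coefficients make the degree of the difference smaller than p, and the
difference vanishes at the p nodes. For p = 0 the truncated exponent p - 1 = 0 is the right one. -/
theorem T_eq_nodal (p : ℕ) : Polynomial.Chebyshev.T ℝ p =
    Polynomial.C (2 ^ (p - 1)) * Lagrange.nodal Finset.univ (chebNode p) := by
  have h2 : (2 ^ (p - 1) : ℝ) ≠ 0 := by positivity
  refine Polynomial.eq_of_degree_sub_lt_of_eval_index_eq Finset.univ
    ((chebNode_injective p).injOn) ?_ ?_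
  · have hd : (Polynomial.Chebyshev.T ℝ p).degree = p := by
      simp [Polynomial.Chebyshev.degree_T]
    have : ((Finset.univ : Finset (Fin p)).card : WithBot ℕ) =
        (Polynomial.Chebyshev.T ℝ p).degree := by simp [hd]
    rw [this]
    refine Polynomial.degree_sub_lt_left ?_ ?_ ?_
    · rw [Polynomial.degree_C_mul h2, Lagrange.degree_nodal]
      simp [hd]
    · intro h0
      rw [h0] at hd
      simp at hd
    · rw [Polynomial.leadingCoeff_mul, Lagrange.nodal_monic.leadingCoeff]
      simp
  · intro m _
    rw [eval_T_chebNode, Polynomial.eval_mul, Lagrange.eval_nodal_at_node (Finset.mem_univ m)]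
    simp

theorem abs_eval_nodal_le {p : ℕ} (hp : 1 ≤ p) {t : ℝ} (ht : |t| ≤ 1) :
    |(Lagrange.nodal Finset.univ (chebNode p)).eval t| ≤ 2 * (1 / 2) ^ p := by
  have h := Polynomial.Chebyshev.abs_eval_T_real_le_one p ht
  rw [T_eq_nodal, Polynomial.eval_mul, Polynomial.eval_C, abs_mul, abs_of_pos (by positivity)] at h
  obtain ⟨k, rfl⟩ : ∃ k, p = k + 1 := ⟨p - 1, by omega⟩
  rw [Nat.add_sub_cancel] at h
  have : (2 : ℝ) ^ k * (1 / 2) ^ k = 1 := by rw [← mul_pow]; norm_num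
  rw [pow_succ]
  have h3 : (0 : ℝ) < (1 / 2) ^ k := by positivity
  nlinarith [mul_le_mul_of_nonneg_right h h3.le]

theorem sum_chebLagrange {p : ℕ} (hp : 1 ≤ p) (t : ℝ) : ∑ m, chebLagrange p m t = 1 := by
  have : NeZero p := ⟨by omega⟩
  have := Lagrange.sum_basis (s := Finset.univ) ((chebNode_injective p).injOn)
    Finset.univ_nonempty
  simpa [chebLagrange, Polynomial.eval_finsetSum] using congrArg (Polynomial.eval t) this

theorem chebLagrange_poly {p : ℕ} {P : Polynomial ℝ} (hP : P.degree < p) (t : ℝ) :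
    P.eval t = ∑ m, P.eval (chebNode p m) * chebLagrange p m t := by
  have h := Lagrange.eq_interpolate (s := Finset.univ) (v := chebNode p) (f := P)
    ((chebNode_injective p).injOn) (by simpa using hP)
  conv_lhs => rw [h]
  simp [Lagrange.interpolate_apply, Polynomial.eval_finsetSum, chebLagrange]

/-- A Lagrange basis function evaluated at an affine function of `t` is reproduced by
interpolation. -/
theorem chebLagrange_affine {p : ℕ} (m : Fin p) (a b t : ℝ) :
    chebLagrange p m (a + b * t) =
      ∑ l, chebLagrange p m (a + b * chebNode p l) * chebLagrange p l t := by
  have hp : 1 ≤ p := m.pos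
  set P := (Lagrange.basis Finset.univ (chebNode p) m).comp
    (Polynomial.C a + Polynomial.C b * Polynomial.X) with hPdef
  have hP : P.degree < p := by
    refine lt_of_le_of_lt Polynomial.degree_le_natDegree ?_
    have h1 : P.natDegree ≤ (p - 1) * 1 := by
      refine Polynomial.natDegree_comp_le.trans ?_
      rw [Lagrange.natDegree_basis ((chebNode_injective p).injOn) (Finset.mem_univ m)]
      simp only [Finset.card_univ, Fintype.card_fin]
      refine Nat.mul_le_mul le_rfl ?_
      compute_degree
    exact_mod_cast (by omega : P.natDegree < p)
  have := chebLagrange_poly hP t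
  simpa [P, Polynomial.eval_comp, chebLagrange] using this

/-! ### The Lebesgue constant -/

theorem abs_sin_natMul_le (n : ℕ) (x : ℝ) : |Real.sin (n * x)| ≤ n * |Real.sin x| := by
  induction n with
  | zero => simp
  | succ k ih =>
    push_cast
    rw [add_mul, one_mul, Real.sin_add]
    calc _ ≤ |Real.sin (k * x)| * |Real.cos x| + |Real.cos (k * x)| * |Real.sin x| := by
          rw [← abs_mul, ← abs_mul]; exact abs_add_le _ _
      _ ≤ |Real.sin (k * x)| * 1 + 1 * |Real.sin x| := by
          gcongr
          · exact Real.abs_cos_le_one _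
          · exact Real.abs_cos_le_one _
      _ ≤ _ := by linarith

theorem cos_mul_chebAngle (p : ℕ) (m : Fin p) : Real.cos (p * chebAngle p m) = 0 := by
  have := eval_T_chebNode p m
  rwa [chebNode_eq_cos, Polynomial.Chebyshev.T_real_cos] at this

theorem abs_sin_mul_chebAngle (p : ℕ) (m : Fin p) : |Real.sin (p * chebAngle p m)| = 1 := by
  have h := Real.sin_sq_add_cos_sq (p * chebAngle p m)
  rw [cos_mul_chebAngle] at h
  have : Real.sin (p * chebAngle p m) ^ 2 = 1 := by linarith
  rw [← sq_abs] at this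
  exact (pow_eq_one_iff_of_nonneg (abs_nonneg _) two_ne_zero).1 this

/-- The Lagrange function with node c is T_p(x) / (T_p'(c) (x - c)). Here T_p' = p U_(p-1), and
|U_(p-1)(cos φ) sin φ| = |sin pφ| = 1 at a node. -/
theorem chebLagrange_mul (p : ℕ) (m : Fin p) (θ : ℝ) :
    |chebLagrange p m (Real.cos θ)| * (p * |Real.cos θ - chebNode p m|) =
      |Real.cos (p * θ)| * |Real.sin (chebAngle p m)| ∨ Real.cos θ = chebNode p m := by
  by_cases hx : Real.cos θ = chebNode p m
  · exact Or.inr hx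
  left
  have hp : (0 : ℝ) < p := by exact_mod_cast m.pos
  set c := chebNode p m with hc
  have hd : (Polynomial.derivative (Polynomial.Chebyshev.T ℝ p)).eval c
      = 2 ^ (p - 1) * (Polynomial.derivative (Lagrange.nodal Finset.univ (chebNode p))).eval c := by
    rw [T_eq_nodal, Polynomial.derivative_C_mul, Polynomial.eval_mul, Polynomial.eval_C]
  have hs : |(Polynomial.derivative (Polynomial.Chebyshev.T ℝ p)).eval c| * |Real.sin (chebAngle p m)|
      = p := by
    rw [Polynomial.Chebyshev.T_derivative_eq_U, Polynomial.eval_mul, abs_mul, mul_assoc, ← abs_mul,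
      hc, chebNode_eq_cos, Polynomial.Chebyshev.U_real_cos]
    have : (((p : ℤ) - 1 : ℤ) + 1 : ℝ) = p := by push_cast; ring
    rw [this, abs_sin_mul_chebAngle]
    simp
  have hb : chebLagrange p m (Real.cos θ) =
      (Lagrange.nodal Finset.univ (chebNode p)).eval (Real.cos θ) *
      (((Polynomial.derivative (Lagrange.nodal Finset.univ (chebNode p))).eval c)⁻¹ *
        (Real.cos θ - c)⁻¹) := by
    rw [chebLagrange, Lagrange.eval_basis_not_at_node (Finset.mem_univ m) hx,
      Lagrange.nodalWeight_eq_eval_derivative_nodal (Finset.mem_univ m)]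
  have hT : Real.cos (p * θ) =
      2 ^ (p - 1) * (Lagrange.nodal Finset.univ (chebNode p)).eval (Real.cos θ) := by
    have := Polynomial.Chebyshev.T_real_cos θ p
    rw [T_eq_nodal] at this
    simp only [Polynomial.eval_mul, Polynomial.eval_C] at this
    rw [this]; simp
  set W := (Polynomial.derivative (Lagrange.nodal Finset.univ (chebNode p))).eval c
  set w := (Lagrange.nodal Finset.univ (chebNode p)).eval (Real.cos θ)
  rw [hb, hT]
  rw [hd] at hs
  have hW : W ≠ 0 := by rintro h; rw [h] at hs; simp at hs; linarith
  have hne : Real.cos θ - c ≠ 0 := sub_ne_zero.2 hx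
  rw [← hs]
  simp only [abs_mul, abs_inv]
  have : |W| ≠ 0 := abs_ne_zero.2 hW
  have : |Real.cos θ - c| ≠ 0 := abs_ne_zero.2 hne
  field_simp

/-- The number pθ/π - 1/2 is the position of θ in the numbering of the nodes, so this says that a
Lagrange function decays like the inverse distance of indices. The bound 3 is the sum of |L| ≤ 2 and
|L| · (index distance) ≤ 1. -/
theorem abs_chebLagrange_mul_le (p : ℕ) (m : Fin p) {θ : ℝ} (hθ : θ ∈ Set.Icc 0 Real.pi) :
    |chebLagrange p m (Real.cos θ)| * (1 + |p * θ / Real.pi - 1 / 2 - m|) ≤ 3 := by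
  have hp : (0 : ℝ) < p := by exact_mod_cast m.pos
  have hpi := Real.pi_pos
  have hφ := chebAngle_mem p m
  have hu : p * θ / Real.pi - 1 / 2 - m = p * (θ - chebAngle p m) / Real.pi := by
    unfold chebAngle; field_simp; ring
  rcases chebLagrange_mul p m θ with h | h
  swap
  · have h0 : θ = chebAngle p m := Real.injOn_cos hθ hφ (by rw [h, chebNode_eq_cos])
    rw [hu, h, h0]
    simp only [chebLagrange, sub_self, mul_zero, zero_div, abs_zero]
    rw [Lagrange.eval_basis_self (chebNode_injective p).injOn (Finset.mem_univ m)]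
    norm_num
  rw [hu]
  by_cases h0 : θ = chebAngle p m
  · rw [h0, ← chebNode_eq_cos]
    simp only [chebLagrange, sub_self, mul_zero, zero_div, abs_zero]
    rw [Lagrange.eval_basis_self (chebNode_injective p).injOn (Finset.mem_univ m)]
    norm_num
  set φ := chebAngle p m with hφd
  set L := |chebLagrange p m (Real.cos θ)|
  have hL : 0 ≤ L := abs_nonneg _
  set a := (θ + φ) / 2 with ha
  set b := (θ - φ) / 2 with hb
  have hcos : |Real.cos θ - chebNode p m| = 2 * |Real.sin a| * |Real.sin b| := by
    rw [chebNode_eq_cos, Real.cos_sub_cos, abs_mul, abs_mul]; norm_num [a, b]; rfl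
  have hsin : |Real.sin φ| ≤ |Real.sin a| + |Real.sin b| := by
    have : φ = a - b := by rw [ha, hb]; ring
    rw [this, Real.sin_sub]
    calc _ ≤ |Real.sin a * Real.cos b| + |Real.cos a * Real.sin b| := abs_sub _ _
      _ ≤ |Real.sin a| * 1 + 1 * |Real.sin b| := by
        rw [abs_mul, abs_mul]
        gcongr
        · exact Real.abs_cos_le_one _
        · exact Real.abs_cos_le_one _
      _ = _ := by ring
  have h2p : ((2 * p : ℕ) : ℝ) = 2 * p := by push_cast; ring
  -- As φ is a zero of cos(p ·), writing pθ = 2pb + pφ turns cos(pθ) into ± sin(2pb). The same works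
  -- with a.
  have hcb : |Real.cos (p * θ)| ≤ 2 * p * |Real.sin b| := by
    have : p * θ = ((2 * p : ℕ) : ℝ) * b + p * φ := by rw [h2p, hb]; ring
    rw [this, Real.cos_add, cos_mul_chebAngle, mul_zero, zero_sub, abs_neg, abs_mul,
      abs_sin_mul_chebAngle, mul_one, ← h2p]
    exact abs_sin_natMul_le _ _
  have hca : |Real.cos (p * θ)| ≤ 2 * p * |Real.sin a| := by
    have : p * θ = ((2 * p : ℕ) : ℝ) * a - p * φ := by rw [h2p, ha]; ring
    rw [this, Real.cos_sub, cos_mul_chebAngle, mul_zero, zero_add, abs_mul,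
      abs_sin_mul_chebAngle, mul_one, ← h2p]
    exact abs_sin_natMul_le _ _
  -- Jordan's inequality bounds both |sin b| and |sin a| below by e. For a one uses that |θ - φ| is
  -- at most 2a and at most 2(π - a).
  set e := |θ - φ| / Real.pi with he
  have hbe : e ≤ |Real.sin b| := by
    have : |b| ≤ Real.pi / 2 := by
      rw [abs_le]; constructor <;> rw [hb] <;> linarith [hθ.1, hθ.2, hφ.1, hφ.2]
    refine le_trans (le_of_eq ?_) (Real.mul_abs_le_abs_sin this)
    rw [he, hb, abs_div, abs_two]; field_simp
  have hae : e ≤ |Real.sin a| := by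
    have h1 : |θ - φ| ≤ 2 * a := by
      rw [abs_le]; constructor <;> rw [ha] <;> linarith [hθ.1, hθ.2, hφ.1, hφ.2]
    have h2 : |θ - φ| ≤ 2 * (Real.pi - a) := by
      rw [abs_le]; constructor <;> rw [ha] <;> linarith [hθ.1, hθ.2, hφ.1, hφ.2]
    have h3 : 2 / Real.pi * (|θ - φ| / 2) = e := by rw [he]; field_simp
    rw [← h3]
    refine le_trans ?_ (le_abs_self _)
    rcases le_total a (Real.pi / 2) with h | h
    · refine le_trans ?_ (Real.mul_le_sin ?_ h)
      · gcongr; linarith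
      · linarith [abs_nonneg (θ - φ)]
    · rw [← Real.sin_pi_sub]
      refine le_trans ?_ (Real.mul_le_sin ?_ (by linarith))
      · gcongr; linarith
      · linarith [abs_nonneg (θ - φ)]
  have hepos : 0 < e := div_pos (abs_pos.2 (sub_ne_zero.2 h0)) hpi
  have hue : |p * (θ - φ) / Real.pi| = p * e := by
    rw [abs_div, abs_mul, abs_of_pos hp, abs_of_pos hpi, he]; ring
  rw [hue]
  set A := |Real.sin a|
  set B := |Real.sin b|
  have hA : 0 < A := hepos.trans_le hae
  have hB : 0 < B := hepos.trans_le hbe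
  set c := |Real.cos (p * θ)|
  have hc1 : c ≤ 1 := Real.abs_cos_le_one _
  have hc0 : 0 ≤ c := abs_nonneg _
  rw [hcos] at h
  have hmain : L * (2 * p * A * B) ≤ c * (A + B) := by
    calc L * (2 * p * A * B) = L * (p * (2 * A * B)) := by ring
      _ = c * |Real.sin φ| := h
      _ ≤ _ := by gcongr
  have hABp : 0 < 2 * p * A * B := by positivity
  have hl2 : L ≤ 2 := by
    refine le_of_mul_le_mul_right (hmain.trans ?_) hABp
    nlinarith [mul_le_mul_of_nonneg_right hcb hA.le, mul_le_mul_of_nonneg_right hca hB.le]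
  have hl1 : L * (p * e) ≤ 1 := by
    refine le_of_mul_le_mul_right ?_ hABp
    calc L * (p * e) * (2 * p * A * B) = (L * (2 * p * A * B)) * (p * e) := by ring
      _ ≤ (c * (A + B)) * (p * e) := by gcongr
      _ ≤ (1 * (A + B)) * (p * e) := by gcongr
      _ = p * (A * e + B * e) := by ring
      _ ≤ p * (A * B + B * A) := by gcongr
      _ = _ := by ring
  linarith

/-- The indices up to J and those beyond J each give a partial sum of the harmonic series. -/
theorem sum_range_inv_dist_le (p J : ℕ) (hJ : J < p) :
    ∑ m ∈ Finset.range p, (1 / (|(J : ℝ) - m| + 1)) ≤ 2 * (1 + Real.log p) := by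
  have hH : ∀ k, k ≤ p → ∑ m ∈ Finset.range k, (1 / ((m : ℝ) + 1)) ≤ 1 + Real.log p := by
    intro k hk
    have h := harmonic_le_one_add_log p
    refine le_trans ?_ h
    rw [harmonic]
    push_cast
    simp only [one_div]
    exact Finset.sum_le_sum_of_subset_of_nonneg (Finset.range_mono hk)
      fun _ _ _ => by positivity
  have h1 : Finset.range p = Finset.range ((J + 1) + (p - (J + 1))) := by congr 1; omega
  rw [h1, Finset.sum_range_add, two_mul]
  refine add_le_add ?_ ?_
  · rw [← Finset.sum_range_reflect]
    refine le_trans (le_of_eq (Finset.sum_congr rfl fun m hm => ?_)) (hH (J + 1) (by omega))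
    have hm' : m < J + 1 := Finset.mem_range.1 hm
    have : ((J + 1 - 1 - m : ℕ) : ℝ) = J - m := by
      rw [Nat.add_sub_cancel, Nat.cast_sub (by omega)]
    rw [this]
    simp
  · refine le_trans (Finset.sum_le_sum fun m hm => ?_) (hH (p - (J + 1)) (by omega))
    have : |(J : ℝ) - ((J + 1 + m : ℕ) : ℝ)| = m + 1 := by
      push_cast
      rw [show (J : ℝ) - (J + 1 + m) = -(m + 1) by ring, abs_neg, abs_of_nonneg (by positivity)]
    rw [this]
    gcongr
    linarith

/-- Logarithmic growth of the Lebesgue constant of Chebyshev interpolation. -/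
theorem sum_abs_chebLagrange_le {p : ℕ} (hp : 1 ≤ p) {t : ℝ} (ht : |t| ≤ 1) :
    ∑ m, |chebLagrange p m t| ≤ 12 * (Real.log p + 1) := by
  have hp0 : (0 : ℝ) < p := by exact_mod_cast hp
  have hpi := Real.pi_pos
  obtain ⟨h1, h2⟩ := abs_le.1 ht
  set θ := Real.arccos t with hθ
  have hc : Real.cos θ = t := Real.cos_arccos h1 h2
  have hθm : θ ∈ Set.Icc 0 Real.pi := ⟨Real.arccos_nonneg _, Real.arccos_le_pi _⟩
  set u := p * θ / Real.pi - 1 / 2 with hu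
  have hu0 : -(1 / 2) ≤ u := by
    have : 0 ≤ p * θ / Real.pi := div_nonneg (mul_nonneg hp0.le hθm.1) hpi.le
    linarith
  have hu1 : u ≤ p - 1 / 2 := by
    have : p * θ / Real.pi ≤ p := by
      rw [div_le_iff₀ hpi]; exact mul_le_mul_of_nonneg_left hθm.2 hp0.le
    linarith
  -- Replacing u by the integer J changes the distances to the indices by at most 1, which doubles
  -- the constant 3 to 6. For u in [-1/2, 0) the floor is 0.
  set J := ⌊u⌋₊ with hJ
  have hJp : J < p := by
    rw [hJ, Nat.floor_lt' (by omega)]; linarith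
  have hJu : |u - J| ≤ 1 := by
    rw [abs_le]
    rcases le_total 0 u with h | h
    · constructor
      · linarith [Nat.floor_le h]
      · linarith [Nat.lt_floor_add_one u]
    · have : J = 0 := Nat.floor_of_nonpos h
      rw [this]; push_cast; constructor <;> linarith
  calc ∑ m, |chebLagrange p m t| ≤ ∑ m : Fin p, 6 * (1 / (|(J : ℝ) - (m : ℕ)| + 1)) := by
        refine Finset.sum_le_sum fun m _ => ?_
        have hk := abs_chebLagrange_mul_le p m hθm
        rw [hc, ← hu] at hk
        set L := |chebLagrange p m t|
        have hL : 0 ≤ L := abs_nonneg _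
        have h3 : |(J : ℝ) - (m : ℕ)| ≤ 1 + |u - m| := by
          have : (J : ℝ) - (m : ℕ) = -(u - J) + (u - m) := by ring
          rw [this]
          refine (abs_add_le _ _).trans ?_
          rw [abs_neg]; linarith
        rw [mul_one_div, le_div_iff₀ (by positivity)]
        nlinarith [abs_nonneg (u - m)]
    _ = 6 * ∑ m ∈ Finset.range p, (1 / (|(J : ℝ) - m| + 1)) := by
        rw [Finset.mul_sum, Finset.sum_range]
    _ ≤ 6 * (2 * (1 + Real.log p)) := by
        gcongr; exact sum_range_inv_dist_le p J hJp
    _ = _ := by ring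

/-! ### The interpolation error -/

/-- Repeated use of Rolle's theorem. -/
theorem exists_zero_of_derivative_chain {a b : ℝ} (n : ℕ) (g : ℕ → ℝ → ℝ)
    (hg : ∀ k < n, ∀ t ∈ Set.Icc a b, HasDerivAt (g k) (g (k + 1) t) t)
    (z : Fin (n + 1) → ℝ) (hz : StrictMono z) (hzm : ∀ i, z i ∈ Set.Icc a b)
    (hz0 : ∀ i, g 0 (z i) = 0) : ∃ ξ ∈ Set.Icc a b, g n ξ = 0 := by
  induction n generalizing g with
  | zero => exact ⟨z 0, hzm 0, hz0 0⟩
  | succ n ih =>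
    have hex : ∀ i : Fin (n + 1), ∃ w ∈ Set.Ioo (z i.castSucc) (z i.succ), g 1 w = 0 := by
      intro i
      have hsub : Set.Icc (z i.castSucc) (z i.succ) ⊆ Set.Icc a b :=
        Set.Icc_subset_Icc (hzm _).1 (hzm _).2
      refine exists_hasDerivAt_eq_zero (f := g 0) (hz i.castSucc_lt_succ) ?_ ?_ ?_
      · intro t ht
        exact (hg 0 (by omega) t (hsub ht)).continuousAt.continuousWithinAt
      · rw [hz0, hz0]
      · intro t ht
        exact hg 0 (by omega) t (hsub (Set.Ioo_subset_Icc_self ht))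
    choose w hw hw0 using hex
    refine ih (fun k => g (k + 1)) (fun k hk t ht => hg (k + 1) (by omega) t ht) w ?_ ?_ hw0
    · rw [Fin.strictMono_iff_lt_succ]
      intro i
      have h1 := (hw i.castSucc).2
      have h2 := (hw i.succ).1
      rw [Fin.succ_castSucc] at h1
      exact h1.trans h2
    · intro i
      exact ⟨(hzm _).1.trans (hw i).1.le, (hw i).2.le.trans (hzm _).2⟩

theorem exists_zero_of_card {a b : ℝ} (n : ℕ) (g : ℕ → ℝ → ℝ)
    (hg : ∀ k < n, ∀ t ∈ Set.Icc a b, HasDerivAt (g k) (g (k + 1) t) t)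
    (s : Finset ℝ) (hs : s.card = n + 1) (hzm : ∀ x ∈ s, x ∈ Set.Icc a b)
    (hz0 : ∀ x ∈ s, g 0 x = 0) : ∃ ξ ∈ Set.Icc a b, g n ξ = 0 :=
  exists_zero_of_derivative_chain n g hg (s.orderEmbOfFin hs) (s.orderEmbOfFin hs).strictMono
    (fun i => hzm _ (s.orderEmbOfFin_mem hs i)) fun i => hz0 _ (s.orderEmbOfFin_mem hs i)

/-- Error of Chebyshev interpolation on `[-1, 1]`. -/
theorem abs_sub_interp_le {p : ℕ} (hp : 1 ≤ p) (g : ℕ → ℝ → ℝ)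
    (hg : ∀ k < p, ∀ t ∈ Set.Icc (-1 : ℝ) 1, HasDerivAt (g k) (g (k + 1) t) t) {B : ℝ}
    (hB : ∀ t ∈ Set.Icc (-1 : ℝ) 1, |g p t| ≤ B) {t : ℝ} (ht : |t| ≤ 1) :
    |g 0 t - ∑ m, g 0 (chebNode p m) * chebLagrange p m t| ≤
      2 * (1 / 2) ^ p * (B / (Nat.factorial p : ℝ)) := by
  have hB0 : 0 ≤ B := (abs_nonneg _).trans (hB 0 (by norm_num))
  set w := Lagrange.nodal Finset.univ (chebNode p) with hw
  set P := Lagrange.interpolate Finset.univ (chebNode p) fun m => g 0 (chebNode p m) with hPd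
  have hPt : ∀ x, P.eval x = ∑ m, g 0 (chebNode p m) * chebLagrange p m x := by
    intro x
    simp [hPd, Lagrange.interpolate_apply, Polynomial.eval_finsetSum, chebLagrange]
  have hinj : Set.InjOn (chebNode p) (Finset.univ : Finset (Fin p)) := (chebNode_injective p).injOn
  have hPn : ∀ m, P.eval (chebNode p m) = g 0 (chebNode p m) := fun m =>
    Lagrange.eval_interpolate_at_node _ hinj (Finset.mem_univ m)
  rw [← hPt]
  have hfac : (0 : ℝ) < (Nat.factorial p : ℝ) := by positivity
  by_cases hwt : w.eval t = 0
  · rw [hw, Lagrange.eval_nodal, Finset.prod_eq_zero_iff] at hwt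
    obtain ⟨m, -, hm⟩ := hwt
    rw [show t = chebNode p m by linarith, hPn, sub_self, abs_zero]
    positivity
  -- With this K the function g - P - K w vanishes at t in addition to the p nodes, so by Rolle its
  -- p-th derivative, g^(p) - K p!, has a zero.
  set K := (g 0 t - P.eval t) / w.eval t with hK
  set G : ℕ → ℝ → ℝ := fun k x => g k x - (Polynomial.derivative^[k] P).eval x
    - K * (Polynomial.derivative^[k] w).eval x with hG
  have hGd : ∀ k < p, ∀ x ∈ Set.Icc (-1 : ℝ) 1, HasDerivAt (G k) (G (k + 1) x) x := by
    intro k hk x hx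
    have h1 := (Polynomial.derivative^[k] P).hasDerivAt x
    have h2 := ((Polynomial.derivative^[k] w).hasDerivAt x).const_mul K
    have := ((hg k hk x hx).sub h1).sub h2
    simp only [hG, Function.iterate_succ', Function.comp]
    exact this
  have htn : t ∉ Finset.univ.image (chebNode p) := by
    intro h
    obtain ⟨m, -, hm⟩ := Finset.mem_image.1 h
    exact hwt (by rw [← hm]; exact Lagrange.eval_nodal_at_node (Finset.mem_univ m))
  obtain ⟨ξ, hξ, hξ0⟩ := exists_zero_of_card p G hGd (insert t (Finset.univ.image (chebNode p)))
    (by rw [Finset.card_insert_of_notMem htn, Finset.card_image_of_injective _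
          (chebNode_injective p)]; simp)
    (by
      intro x hx
      rcases Finset.mem_insert.1 hx with rfl | hx
      · exact abs_le.1 ht
      · obtain ⟨m, -, rfl⟩ := Finset.mem_image.1 hx
        exact abs_le.1 (abs_chebNode_le p m))
    (by
      intro x hx
      rcases Finset.mem_insert.1 hx with rfl | hx
      · simp only [hG, Function.iterate_zero, id]
        rw [hK]; field_simp; ring
      · obtain ⟨m, -, rfl⟩ := Finset.mem_image.1 hx
        simp only [hG, Function.iterate_zero, id]
        rw [hPn, Lagrange.eval_nodal_at_node (Finset.mem_univ m)]; ring)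
  have hPp : Polynomial.derivative^[p] P = 0 := by
    refine Polynomial.iterate_derivative_eq_zero_of_degree_lt ?_
    have := Lagrange.degree_interpolate_lt (fun m => g 0 (chebNode p m)) hinj
    rwa [Finset.card_univ, Fintype.card_fin] at this
  have hwp : (Polynomial.derivative^[p] w).eval ξ = Nat.factorial p := by
    have hd : w.natDegree = p := by rw [hw, Lagrange.natDegree_nodal]; simp
    have h := Polynomial.natDegree_iterate_derivative w p
    rw [hd, Nat.sub_self] at h
    rw [Polynomial.eq_C_of_natDegree_le_zero h, Polynomial.eval_C,
      Polynomial.coeff_iterate_derivative]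
    have hm : w.coeff p = 1 := by
      have := (Lagrange.nodal_monic (s := Finset.univ) (v := chebNode p)).coeff_natDegree
      rwa [← hw, hd] at this
    simp [hm, Nat.descFactorial_self]
  simp only [hG, hPp, hwp, Polynomial.eval_zero, sub_zero] at hξ0
  have hKB : |K| ≤ B / Nat.factorial p := by
    rw [le_div_iff₀ hfac]
    have := hB ξ hξ
    rw [show g p ξ = K * Nat.factorial p by linarith, abs_mul, abs_of_pos hfac] at this
    exact this
  have : g 0 t - P.eval t = w.eval t * K := by rw [hK]; field_simp
  rw [this, abs_mul]
  exact mul_le_mul (abs_eval_nodal_le hp ht) hKB (abs_nonneg _) (by positivity)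

/-! ### Tensor-product interpolation -/

theorem sum_prod_abs_chebLagrange_le {p d : ℕ} {Λ : ℝ}
    (hΛ : ∀ t : ℝ, |t| ≤ 1 → ∑ m, |chebLagrange p m t| ≤ Λ) {t : Fin d → ℝ}
    (ht : ∀ j, |t j| ≤ 1) :
    ∑ n : Fin d → Fin p, |∏ j, chebLagrange p (n j) (t j)| ≤ Λ ^ d := by
  simp only [Finset.abs_prod]
  rw [← Fintype.piFinset_univ, ← Finset.prod_univ_sum (fun _ => Finset.univ)
    fun j m => |chebLagrange p m (t j)|]
  calc ∏ j, ∑ m, |chebLagrange p m (t j)| ≤ ∏ _j : Fin d, Λ :=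
        Finset.prod_le_prod (fun _ _ => Finset.sum_nonneg fun _ _ => abs_nonneg _)
          fun j _ => hΛ _ (ht j)
    _ = Λ ^ d := by simp

/-- Induction on the dimension: interpolation in the first coordinate costs δ, and the errors in the
remaining coordinates, at each of the p frozen values of the first, are summed with weights |L_m|
and so multiplied by at most Λ. -/
theorem abs_sub_tensorInterp_le {p : ℕ} {Λ δ : ℝ} (hΛ1 : 1 ≤ Λ) (hδ : 0 ≤ δ)
    (hΛ : ∀ t : ℝ, |t| ≤ 1 → ∑ m, |chebLagrange p m t| ≤ Λ) (d : ℕ) (G : (Fin d → ℝ) → ℝ)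
    (hG : ∀ j, ∀ t : Fin d → ℝ, (∀ i, |t i| ≤ 1) →
      |G t - ∑ m, G (Function.update t j (chebNode p m)) * chebLagrange p m (t j)| ≤ δ)
    {t : Fin d → ℝ} (ht : ∀ i, |t i| ≤ 1) :
    |G t - ∑ n : Fin d → Fin p, G (fun j => chebNode p (n j)) *
      ∏ j, chebLagrange p (n j) (t j)| ≤ d * Λ ^ (d - 1) * δ := by
  induction d with
  | zero =>
    have : (fun j : Fin 0 => chebNode p ((default : Fin 0 → Fin p) j)) = t :=
      Subsingleton.elim _ _
    simp [this]
  | succ d ih =>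
    have hcons : ∀ (a : ℝ) (s : Fin d → ℝ), |a| ≤ 1 → (∀ i, |s i| ≤ 1) →
        ∀ i, |(Fin.cons a s : Fin (d + 1) → ℝ) i| ≤ 1 := by
      intro a s ha hs i
      refine Fin.cases ?_ (fun i => ?_) i
      · simpa using ha
      · simpa using hs i
    obtain ⟨t0, t', rfl⟩ : ∃ t0 t', t = Fin.cons t0 t' := ⟨t 0, Fin.tail t, by simp⟩
    have ht0 : |t0| ≤ 1 := by simpa using ht 0
    have ht' : ∀ i, |t' i| ≤ 1 := fun i => by simpa using ht i.succ
    have h1 := hG 0 (Fin.cons t0 t') ht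
    simp only [Fin.update_cons_zero, Fin.cons_zero] at h1
    have h2 : ∀ m, |G (Fin.cons (chebNode p m) t') - ∑ n : Fin d → Fin p,
        G (Fin.cons (chebNode p m) fun j => chebNode p (n j)) *
          ∏ j, chebLagrange p (n j) (t' j)| ≤ d * Λ ^ (d - 1) * δ := by
      intro m
      refine ih (fun s => G (Fin.cons (chebNode p m) s)) ?_ ht'
      intro j s hs
      have := hG j.succ (Fin.cons (chebNode p m) s) (hcons _ _ (abs_chebNode_le p m) hs)
      simpa only [← Fin.cons_update, Fin.cons_succ] using this
    have h3 : ∑ n : Fin (d + 1) → Fin p, G (fun j => chebNode p (n j)) *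
        ∏ j, chebLagrange p (n j) ((Fin.cons t0 t' : Fin (d + 1) → ℝ) j) =
        ∑ m, (∑ n : Fin d → Fin p, G (Fin.cons (chebNode p m) fun j => chebNode p (n j)) *
          ∏ j, chebLagrange p (n j) (t' j)) * chebLagrange p m t0 := by
      rw [← (Fin.consEquiv fun _ : Fin (d + 1) => Fin p).sum_comp, Fintype.sum_prod_type]
      refine Finset.sum_congr rfl fun m _ => ?_
      rw [Finset.sum_mul]
      refine Finset.sum_congr rfl fun n _ => ?_
      rw [Fin.prod_univ_succ]
      simp only [Fin.consEquiv_apply, Fin.cons_zero, Fin.cons_succ]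
      have : (fun j : Fin (d + 1) => chebNode p ((Fin.cons m n : Fin (d + 1) → Fin p) j)) =
          Fin.cons (chebNode p m) fun j => chebNode p (n j) := by
        funext j
        refine Fin.cases ?_ (fun i => ?_) j <;> simp
      rw [this]
      ring
    rw [h3]
    set R : Fin p → ℝ := fun m => ∑ n : Fin d → Fin p,
        G (Fin.cons (chebNode p m) fun j => chebNode p (n j)) *
          ∏ j, chebLagrange p (n j) (t' j)
    have h4 : |∑ m, (G (Fin.cons (chebNode p m) t') - R m) * chebLagrange p m t0| ≤
        d * Λ ^ (d - 1) * δ * Λ := by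
      have hn : 0 ≤ d * Λ ^ (d - 1) * δ := by positivity
      calc _ ≤ ∑ m, |(G (Fin.cons (chebNode p m) t') - R m) * chebLagrange p m t0| :=
            Finset.abs_sum_le_sum_abs _ _
        _ ≤ ∑ m, (d * Λ ^ (d - 1) * δ) * |chebLagrange p m t0| := by
            refine Finset.sum_le_sum fun m _ => ?_
            rw [abs_mul]
            exact mul_le_mul_of_nonneg_right (h2 m) (abs_nonneg _)
        _ = (d * Λ ^ (d - 1) * δ) * ∑ m, |chebLagrange p m t0| := by rw [Finset.mul_sum]
        _ ≤ _ := mul_le_mul_of_nonneg_left (hΛ _ ht0) hn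
    have h5 : G (Fin.cons t0 t') - ∑ m, R m * chebLagrange p m t0 =
        (G (Fin.cons t0 t') - ∑ m, G (Fin.cons (chebNode p m) t') * chebLagrange p m t0) +
        ∑ m, (G (Fin.cons (chebNode p m) t') - R m) * chebLagrange p m t0 := by
      simp only [sub_mul, Finset.sum_sub_distrib]; ring
    rw [h5]
    refine (abs_add_le _ _).trans ((add_le_add h1 h4).trans ?_)
    -- For d = 0 the truncated exponent is harmless because of the factor d.
    have h6 : d * Λ ^ (d - 1) * δ * Λ = d * Λ ^ d * δ := by
      rcases d with _ | d
      · simp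
      · simp only [Nat.add_sub_cancel, pow_succ]; ring
    rw [h6, Nat.add_sub_cancel]
    push_cast
    have : 1 ≤ Λ ^ d := one_le_pow₀ hΛ1
    nlinarith

/-- The interpolation error in s, taken with t at the nodes, passes through the tensor interpolation
in t and gains the factor Λ^d; this explains the exponent (d - 1) + d. -/
theorem abs_sub_twoSidedInterp_le {p : ℕ} {Λ δ : ℝ} (hΛ1 : 1 ≤ Λ) (hδ : 0 ≤ δ)
    (hΛ : ∀ t : ℝ, |t| ≤ 1 → ∑ m, |chebLagrange p m t| ≤ Λ) {d : ℕ} (hd : 1 ≤ d)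
    (G : (Fin d → ℝ) → (Fin d → ℝ) → ℝ)
    (hG₁ : ∀ j, ∀ t s : Fin d → ℝ, (∀ i, |t i| ≤ 1) → (∀ i, |s i| ≤ 1) →
      |G t s - ∑ m, G (Function.update t j (chebNode p m)) s * chebLagrange p m (t j)| ≤ δ)
    (hG₂ : ∀ j, ∀ t s : Fin d → ℝ, (∀ i, |t i| ≤ 1) → (∀ i, |s i| ≤ 1) →
      |G t s - ∑ m, G t (Function.update s j (chebNode p m)) * chebLagrange p m (s j)| ≤ δ)
    {t s : Fin d → ℝ} (ht : ∀ i, |t i| ≤ 1) (hs : ∀ i, |s i| ≤ 1) :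
    |G t s - ∑ n : Fin d → Fin p, ∑ m : Fin d → Fin p, (∏ j, chebLagrange p (n j) (t j)) *
      G (fun j => chebNode p (n j)) (fun j => chebNode p (m j)) *
        ∏ j, chebLagrange p (m j) (s j)| ≤ 2 * d * Λ ^ (2 * d - 1) * δ := by
  have h1 := abs_sub_tensorInterp_le hΛ1 hδ hΛ d (fun t => G t s)
    (fun j t ht => hG₁ j t s ht hs) ht
  have h2 : ∀ n : Fin d → Fin p, |G (fun j => chebNode p (n j)) s - ∑ m : Fin d → Fin p,
      G (fun j => chebNode p (n j)) (fun j => chebNode p (m j)) *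
        ∏ j, chebLagrange p (m j) (s j)| ≤ d * Λ ^ (d - 1) * δ := fun n =>
    abs_sub_tensorInterp_le hΛ1 hδ hΛ d (fun s => G (fun j => chebNode p (n j)) s)
    (fun j s hs => hG₂ j _ s (fun i => abs_chebNode_le p _) hs) hs
  set Lt : (Fin d → Fin p) → ℝ := fun n => ∏ j, chebLagrange p (n j) (t j)
  set R : (Fin d → Fin p) → ℝ := fun n => ∑ m : Fin d → Fin p,
      G (fun j => chebNode p (n j)) (fun j => chebNode p (m j)) *
        ∏ j, chebLagrange p (m j) (s j)
  have hn : 0 ≤ d * Λ ^ (d - 1) * δ := by positivity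
  have h4 : |∑ n, (G (fun j => chebNode p (n j)) s - R n) * Lt n| ≤
      d * Λ ^ (d - 1) * δ * Λ ^ d := by
    calc _ ≤ ∑ n, |(G (fun j => chebNode p (n j)) s - R n) * Lt n| :=
          Finset.abs_sum_le_sum_abs _ _
      _ ≤ ∑ n, (d * Λ ^ (d - 1) * δ) * |Lt n| := by
          refine Finset.sum_le_sum fun m _ => ?_
          rw [abs_mul]
          exact mul_le_mul_of_nonneg_right (h2 m) (abs_nonneg _)
      _ = (d * Λ ^ (d - 1) * δ) * ∑ m, |Lt m| := by rw [Finset.mul_sum]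
      _ ≤ _ := mul_le_mul_of_nonneg_left (sum_prod_abs_chebLagrange_le hΛ ht) hn
  have h5 : G t s - ∑ n : Fin d → Fin p, ∑ m : Fin d → Fin p, Lt n *
      G (fun j => chebNode p (n j)) (fun j => chebNode p (m j)) *
        ∏ j, chebLagrange p (m j) (s j) =
      (G t s - ∑ n, G (fun j => chebNode p (n j)) s * Lt n) +
      ∑ n, (G (fun j => chebNode p (n j)) s - R n) * Lt n := by
    simp only [sub_mul, Finset.sum_sub_distrib, R, Finset.sum_mul]
    rw [sub_add_sub_cancel]
    congr 1
    refine Finset.sum_congr rfl fun n _ => Finset.sum_congr rfl fun m _ => by ring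
  rw [h5]
  refine (abs_add_le _ _).trans ((add_le_add h1 h4).trans ?_)
  obtain ⟨e, rfl⟩ : ∃ e, d = e + 1 := ⟨d - 1, by omega⟩
  have e1 : 2 * (e + 1) - 1 = e + (e + 1) := by omega
  rw [e1, Nat.add_sub_cancel, pow_add Λ e (e + 1)]
  have h7 : 1 ≤ Λ ^ (e + 1) := one_le_pow₀ hΛ1
  have h8 : 0 ≤ ((e + 1 : ℕ) : ℝ) * Λ ^ e * δ := by positivity
  generalize Λ ^ (e + 1) = A at h7 ⊢
  nlinarith [mul_le_mul_of_nonneg_left h7 h8]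

/-! ### Derivatives along coordinate lines -/

section DirectionalDerivatives

variable {W : Type*} [NormedAddCommGroup W] [NormedSpace ℝ W]

theorem contDiffOn_dirDeriv {U : Set W} (hU : IsOpen U) {f : W → ℝ}
    (hf : ContDiffOn ℝ (⊤ : ℕ∞) f U) (v : W) : ContDiffOn ℝ (⊤ : ℕ∞) (dirDeriv v f) U :=
  (hf.fderiv_of_isOpen hU (by simp)).clm_apply contDiffOn_const

theorem contDiffOn_iterate_dirDeriv {U : Set W} (hU : IsOpen U) {f : W → ℝ}
    (hf : ContDiffOn ℝ (⊤ : ℕ∞) f U) (v : W) (k : ℕ) :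
    ContDiffOn ℝ (⊤ : ℕ∞) ((dirDeriv v)^[k] f) U := by
  induction k with
  | zero => exact hf
  | succ k ih => rw [Function.iterate_succ_apply']; exact contDiffOn_dirDeriv hU ih v

/-- The chain rule along a line: the scaled directional derivatives form the chain of successive
derivatives that `abs_sub_interp_le` asks for. -/
theorem hasDerivAt_iterate_dirDeriv_line {U : Set W} (hU : IsOpen U) {f : W → ℝ}
    (hf : ContDiffOn ℝ (⊤ : ℕ∞) f U) (v q : W) (h : ℝ) (k : ℕ) {t : ℝ}
    (ht : q + t • (h • v) ∈ U) :
    HasDerivAt (fun t => h ^ k * (dirDeriv v)^[k] f (q + t • (h • v)))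
      (h ^ (k + 1) * (dirDeriv v)^[k + 1] f (q + t • (h • v))) t := by
  have h1 : DifferentiableAt ℝ ((dirDeriv v)^[k] f) (q + t • (h • v)) :=
    ((contDiffOn_iterate_dirDeriv hU hf v k).differentiableOn (by simp)).differentiableAt
      (hU.mem_nhds ht)
  have h2 : HasDerivAt (fun t : ℝ => q + t • (h • v)) (h • v) t := by
    simpa using ((hasDerivAt_id t).smul_const (h • v)).const_add q
  have h3 := (h1.hasFDerivAt.comp_hasDerivAt t h2).const_mul (h ^ k)
  refine h3.congr_deriv ?_
  rw [Function.iterate_succ_apply', map_smul, smul_eq_mul, pow_succ, mul_assoc]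
  rfl

end DirectionalDerivatives

/-- Coordinatewise interpolation involves only pure derivatives; for such a multi-index all but one
step of the fold are zeroth iterates. -/
theorem foldr_iterate_single {ι A : Type*} [DecidableEq ι] (F : ι → A → A) (i : ι) (k : ℕ)
    (l : List ι) (hl : l.Nodup) (g : A) :
    l.foldr (fun j f => (F j)^[(Pi.single i k : ι → ℕ) j] f) g =
      if i ∈ l then (F i)^[k] g else g := by
  induction l with
  | nil => simp
  | cons a l ih =>
    rw [List.foldr_cons, ih (List.nodup_cons.1 hl).2]
    by_cases h : a = i
    · subst h
      simp [(List.nodup_cons.1 hl).1]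
    · have h' : i ≠ a := fun h' => h h'.symm
      simp [h, h']

theorem foldr_iterate_zero {ι A : Type*} (F : ι → A → A) (l : List ι) (g : A) :
    l.foldr (fun j f => (F j)^[(0 : ι → ℕ) j] f) g = g := by
  induction l with
  | nil => rfl
  | cons a l ih => rw [List.foldr_cons, ih]; rfl

theorem mixedPartial_single_left {d : ℕ} (i : Fin d) (k : ℕ) (ρ : Pt d → Pt d → ℝ) :
    mixedPartial (Pi.single i k) 0 ρ =
      (dirDeriv ((EuclideanSpace.single i (1 : ℝ), 0) : Pt d × Pt d))^[k]
        (fun q => ρ q.1 q.2) := by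
  unfold mixedPartial
  rw [foldr_iterate_zero (fun i => dirDeriv ((0, EuclideanSpace.single i (1 : ℝ)) : Pt d × Pt d)),
    foldr_iterate_single (fun i => dirDeriv ((EuclideanSpace.single i (1 : ℝ), 0) : Pt d × Pt d))
      i k _ (List.nodup_finRange d)]
  simp

theorem mixedPartial_single_right {d : ℕ} (i : Fin d) (k : ℕ) (ρ : Pt d → Pt d → ℝ) :
    mixedPartial 0 (Pi.single i k) ρ =
      (dirDeriv ((0, EuclideanSpace.single i (1 : ℝ)) : Pt d × Pt d))^[k]
        (fun q => ρ q.1 q.2) := by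
  unfold mixedPartial
  rw [foldr_iterate_single (fun i => dirDeriv ((0, EuclideanSpace.single i (1 : ℝ)) : Pt d × Pt d))
      i k _ (List.nodup_finRange d),
    foldr_iterate_zero (fun i => dirDeriv ((EuclideanSpace.single i (1 : ℝ), 0) : Pt d × Pt d))]
  simp

/-- The factorials of the derivative bound and of the interpolation error cancel, leaving
2c₁(h/(2c₂D))^p; the hypothesis 2h ≤ ηD is what admissibility provides. -/
theorem abs_sub_lineInterp_le {W : Type*} [NormedAddCommGroup W] [NormedSpace ℝ W] {U : Set W}
    (hU : IsOpen U) {f : W → ℝ} (hf : ContDiffOn ℝ (⊤ : ℕ∞) f U) (v q : W) {p : ℕ} (hp : 1 ≤ p)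
    {h D c₁ c₂ η : ℝ} (hh : 0 ≤ h) (hD : 0 < D) (hc₁ : 0 < c₁) (hc₂ : 0 < c₂)
    (hhD : 2 * h ≤ η * D) (hq : ∀ s : ℝ, |s| ≤ 1 → q + s • (h • v) ∈ U)
    (hb : ∀ s : ℝ, |s| ≤ 1 → |(dirDeriv v)^[p] f (q + s • (h • v))| ≤
      c₁ * ((c₂ * D) ^ p)⁻¹ * (Nat.factorial p : ℝ)) {t : ℝ} (ht : |t| ≤ 1) :
    |f (q + t • (h • v)) - ∑ m, f (q + chebNode p m • (h • v)) * chebLagrange p m t| ≤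
      2 * c₁ * (η / (4 * c₂)) ^ p := by
  have key := abs_sub_interp_le hp (fun k s => h ^ k * (dirDeriv v)^[k] f (q + s • (h • v)))
    (fun k _ s hs => hasDerivAt_iterate_dirDeriv_line hU hf v q h k (hq s (abs_le.2 hs)))
    (B := h ^ p * (c₁ * ((c₂ * D) ^ p)⁻¹ * (Nat.factorial p : ℝ)))
    (fun s hs => by
      rw [abs_mul, abs_of_nonneg (by positivity)]
      exact mul_le_mul_of_nonneg_left (hb s (abs_le.2 hs)) (by positivity)) ht
  simp only [pow_zero, one_mul, Function.iterate_zero, id] at key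
  refine key.trans ?_
  have hfac : (Nat.factorial p : ℝ) ≠ 0 := by positivity
  calc 2 * (1 / 2) ^ p * (h ^ p * (c₁ * ((c₂ * D) ^ p)⁻¹ * (Nat.factorial p : ℝ)) /
        (Nat.factorial p : ℝ)) = 2 * c₁ * (2 * h / (4 * (c₂ * D))) ^ p := by
        have : 2 * h / (4 * (c₂ * D)) = (1 / 2) * h * (c₂ * D)⁻¹ := by field_simp; ring
        have e : ∀ a b c f : ℝ, f ≠ 0 → 2 * a * (b * (c₁ * c * f) / f) = 2 * c₁ * (a * b * c) := by
          intro a b c f hf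
          field_simp
        rw [this, mul_pow (1 / 2 * h), mul_pow (1 / 2) h, inv_pow]
        exact e _ _ _ _ hfac
    _ ≤ 2 * c₁ * (η / (4 * c₂)) ^ p := by
        gcongr 2 * c₁ * ?_ ^ p
        rw [div_le_div_iff₀ (by positivity) (by positivity)]
        nlinarith

namespace H2Data

variable {d N : ℕ} (S : H2Data d N)

/-! ### Bounding boxes -/

theorem lo_le {X : Finset (Fin N)} {i : Fin N} (hi : i ∈ X) (j : Fin d) : S.lo X j ≤ S.x i j :=
  csInf_le (X.finite_toSet.image _).bddBelow (Set.mem_image_of_mem _ hi)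

theorem le_hi {X : Finset (Fin N)} {i : Fin N} (hi : i ∈ X) (j : Fin d) : S.x i j ≤ S.hi X j :=
  le_csSup (X.finite_toSet.image _).bddAbove (Set.mem_image_of_mem _ hi)

theorem exists_eq_lo {X : Finset (Fin N)} (hX : X.Nonempty) (j : Fin d) :
    ∃ i ∈ X, S.x i j = S.lo X j :=
  Set.Nonempty.csInf_mem (s := (fun i => S.x i j) '' (X : Set (Fin N)))
    (Set.Nonempty.image _ (Finset.coe_nonempty.2 hX)) (X.finite_toSet.image _)

theorem exists_eq_hi {X : Finset (Fin N)} (hX : X.Nonempty) (j : Fin d) :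
    ∃ i ∈ X, S.x i j = S.hi X j :=
  Set.Nonempty.csSup_mem (s := (fun i => S.x i j) '' (X : Set (Fin N)))
    (Set.Nonempty.image _ (Finset.coe_nonempty.2 hX)) (X.finite_toSet.image _)

theorem lo_mono {X X' : Finset (Fin N)} (h : X' ⊆ X) (hX : X'.Nonempty) (j : Fin d) :
    S.lo X j ≤ S.lo X' j := by
  obtain ⟨i, hi, e⟩ := S.exists_eq_lo hX j
  exact e ▸ S.lo_le (h hi) j

theorem hi_mono {X X' : Finset (Fin N)} (h : X' ⊆ X) (hX : X'.Nonempty) (j : Fin d) :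
    S.hi X' j ≤ S.hi X j := by
  obtain ⟨i, hi, e⟩ := S.exists_eq_hi hX j
  exact e ▸ S.le_hi (h hi) j

theorem lo_le_hi {X : Finset (Fin N)} (hX : X.Nonempty) (j : Fin d) : S.lo X j ≤ S.hi X j := by
  obtain ⟨i, hi⟩ := hX
  exact (S.lo_le hi j).trans (S.le_hi hi j)

theorem half_nonneg {X : Finset (Fin N)} (hX : X.Nonempty) (j : Fin d) : 0 ≤ S.half X j := by
  have := S.lo_le_hi hX j
  unfold half; linarith

theorem half_mono {X X' : Finset (Fin N)} (h : X' ⊆ X) (hX : X'.Nonempty) (j : Fin d) :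
    S.half X' j ≤ S.half X j := by
  have := S.lo_mono h hX j
  have := S.hi_mono h hX j
  unfold half; linarith

/-- The point of `B_X` with local coordinates `t ∈ [-1, 1]^d`. -/
def pt (X : Finset (Fin N)) (t : Fin d → ℝ) : Pt d :=
  WithLp.toLp 2 fun j => S.mid X j + S.half X j * t j

/-- Local coordinates with respect to `B_X`. -/
def coord (X : Finset (Fin N)) (y : Pt d) (j : Fin d) : ℝ := (y j - S.mid X j) / S.half X j

theorem pt_mem_box {X : Finset (Fin N)} (hX : X.Nonempty) {t : Fin d → ℝ} (ht : ∀ j, |t j| ≤ 1) :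
    S.pt X t ∈ S.box X := by
  intro j
  have h0 := S.half_nonneg hX j
  obtain ⟨h1, h2⟩ := abs_le.1 (ht j)
  have e1 : S.lo X j = S.mid X j - S.half X j := by unfold mid half; ring
  have e2 : S.hi X j = S.mid X j + S.half X j := by unfold mid half; ring
  simp only [pt]
  rw [e1, e2]
  constructor <;> nlinarith

theorem x_mem_box {X : Finset (Fin N)} {i : Fin N} (hi : i ∈ X) : S.x i ∈ S.box X :=
  fun j => ⟨S.lo_le hi j, S.le_hi hi j⟩

theorem abs_coord_le {X : Finset (Fin N)} {y : Pt d} (hy : y ∈ S.box X) (j : Fin d) :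
    |S.coord X y j| ≤ 1 := by
  have h1 := (hy j).1
  have h2 := (hy j).2
  have h0 : 0 ≤ S.half X j := by unfold half; linarith
  rw [coord, abs_div, abs_of_nonneg h0]
  refine div_le_one_of_le₀ ?_ h0
  rw [abs_le]; unfold mid half
  constructor <;> linarith

theorem pt_coord {X : Finset (Fin N)} {y : Pt d} (hy : y ∈ S.box X) :
    S.pt X (S.coord X y) = y := by
  ext j
  have h1 := (hy j).1
  have h2 := (hy j).2
  simp only [pt, coord]
  -- In a degenerate direction the local coordinate is 0/0 = 0 and every point of the box has the
  -- midpoint as its coordinate.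
  by_cases h0 : S.half X j = 0
  · rw [h0, zero_mul]
    unfold half at h0
    unfold mid
    linarith
  · rw [mul_div_cancel₀ _ h0]; ring

theorem pt_update (X : Finset (Fin N)) (t : Fin d → ℝ) (j : Fin d) (s : ℝ) :
    S.pt X (Function.update t j s) = S.pt X (Function.update t j 0) +
      s • (S.half X j • (EuclideanSpace.single j (1 : ℝ) : Pt d)) := by
  ext i
  by_cases h : i = j
  · subst h; simp [pt]; ring
  · simp [pt, h]

theorem dist_le_of_mem_box {X : Finset (Fin N)} {y y' : Pt d} (hy : y ∈ S.box X)
    (hy' : y' ∈ S.box X) : dist y y' ≤ Real.sqrt (∑ j, (2 * S.half X j) ^ 2) := by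
  rw [EuclideanSpace.dist_eq]
  refine Real.sqrt_le_sqrt (Finset.sum_le_sum fun j _ => ?_)
  have h1 := hy j
  have h2 := hy' j
  refine pow_le_pow_left₀ dist_nonneg ?_ 2
  rw [Real.dist_eq, abs_le]
  unfold half
  constructor <;> linarith [h1.1, h1.2, h2.1, h2.2]

theorem isBounded_box (X : Finset (Fin N)) : Bornology.IsBounded (S.box X) :=
  Metric.isBounded_iff.2 ⟨_, fun _ hy _ hy' => S.dist_le_of_mem_box hy hy'⟩

theorem two_mul_half_le_diam {X : Finset (Fin N)} (hX : X.Nonempty) (j : Fin d) :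
    2 * S.half X j ≤ Metric.diam (S.box X) := by
  have h1 : S.pt X 1 ∈ S.box X := S.pt_mem_box hX (by simp)
  have h2 : S.pt X (-1) ∈ S.box X := S.pt_mem_box hX (by simp)
  refine le_trans ?_ (Metric.dist_le_diam_of_mem (S.isBounded_box X) h1 h2)
  refine le_trans (le_trans (le_of_eq ?_) (le_abs_self ((S.pt X 1 - S.pt X (-1)) j))) ?_
  · simp [pt]; ring
  · rw [dist_eq_norm, ← Real.norm_eq_abs]
    exact PiLp.norm_apply_le _ j

theorem boxDist_le {X Y : Finset (Fin N)} {y z : Pt d} (hy : y ∈ S.box X) (hz : z ∈ S.box Y) :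
    S.boxDist X Y ≤ dist y z :=
  ciInf_le (f := fun q : S.box X × S.box Y => dist (q.1 : Pt d) (q.2 : Pt d))
    ⟨0, by rintro _ ⟨q, rfl⟩; exact dist_nonneg⟩ (⟨y, hy⟩, ⟨z, hz⟩)

theorem boxDist_comm (X Y : Finset (Fin N)) : S.boxDist X Y = S.boxDist Y X := by
  unfold boxDist
  rw [← (Equiv.prodComm (S.box Y) (S.box X)).iInf_comp]
  simp [dist_comm]

theorem admissible_comm {X Y : Finset (Fin N)} : S.Admissible X Y ↔ S.Admissible Y X := by
  unfold Admissible
  rw [boxDist_comm, max_comm]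

/-! ### The error of the interpolated kernel on a far-field block -/

/-- Two-sided tensor interpolation of the kernel in the local coordinates of both boxes, with Λ =
12(log p + 1) and univariate error δ = 2c₁(η/(4c₂))^p. -/
theorem abs_block_error_le {E : Set (Pt d)} {c₁ c₂ : ℝ} (hd : 1 ≤ d) (hE : IsOpen E)
    (hc₁ : 0 < c₁) (hc₂ : 0 < c₂) (hη : 0 < S.η) (hρ : IsAsymptoticallySmooth E S.ρ c₁ c₂)
    (hp : 1 ≤ S.p) {X Y : Finset (Fin N)} (hX : S.box X ⊆ E) (hY : S.box Y ⊆ E)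
    (hadm : S.Admissible X Y) {i j : Fin N} (hi : i ∈ X) (hj : j ∈ Y) :
    |S.ρ (S.x i) (S.x j) - ∑ n, ∑ m, S.V X i n * S.M X Y n m * S.V Y j m| ≤
      2 * d * (12 * (Real.log S.p + 1)) ^ (2 * d - 1) *
        (2 * c₁ * (S.η / (4 * c₂)) ^ S.p) := by
  have hXn : X.Nonempty := ⟨i, hi⟩
  have hYn : Y.Nonempty := ⟨j, hj⟩
  have hlog : 0 ≤ Real.log S.p := Real.log_nonneg (by exact_mod_cast hp)
  set U : Set (Pt d × Pt d) := {q | q.1 ∈ E ∧ q.2 ∈ E ∧ q.1 ≠ q.2} with hUdef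
  have hU : IsOpen U := by
    have h1 : IsOpen {q : Pt d × Pt d | q.1 ∈ E} := hE.preimage continuous_fst
    have h2 : IsOpen {q : Pt d × Pt d | q.2 ∈ E} := hE.preimage continuous_snd
    have h3 : IsOpen {q : Pt d × Pt d | q.1 ≠ q.2} := isOpen_ne_fun continuous_fst continuous_snd
    exact h1.inter (h2.inter h3)
  have hδ : 0 ≤ 2 * c₁ * (S.η / (4 * c₂)) ^ S.p := by positivity
  have hbound : ∀ y ∈ S.box X, ∀ z ∈ S.box Y, 0 < S.boxDist X Y → ∀ α β : Fin d → ℕ,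
      ∑ i, α i + ∑ i, β i = S.p → |mixedPartial α β S.ρ (y, z)| ≤
        c₁ * ((c₂ * S.boxDist X Y) ^ S.p)⁻¹ * (Nat.factorial S.p : ℝ) := by
    intro y hy z hz hD α β hs
    have hle := S.boxDist_le hy hz
    have := hρ.2 y (hX hy) z (hY hz) (dist_pos.1 (hD.trans_le hle)) α β (by omega)
    rw [hs] at this
    refine this.trans ?_
    gcongr
  have hmemU : ∀ y ∈ S.box X, ∀ z ∈ S.box Y, 0 < S.boxDist X Y → (y, z) ∈ U :=
    fun y hy z hz hD => ⟨hX hy, hY hz, dist_pos.1 (hD.trans_le (S.boxDist_le hy hz))⟩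
  have hupd : ∀ (t : Fin d → ℝ) (l : Fin d) (s : ℝ), (∀ i, |t i| ≤ 1) → |s| ≤ 1 →
      ∀ i, |Function.update t l s i| ≤ 1 := by
    intro t l s ht hs i
    by_cases h : i = l
    · subst h; simpa using hs
    · simpa [h] using ht i
  -- Admissible boxes need not be apart: a one-point cluster paired with itself is admissible.
  -- Positive distance follows once some edge has positive length, and only then is it needed.
  have hDpos : ∀ Z : Finset (Fin N), (Z = X ∨ Z = Y) → ∀ l, S.half Z l ≠ 0 →
      0 < S.boxDist X Y ∧ 2 * S.half Z l ≤ S.η * S.boxDist X Y ∧ 0 ≤ S.half Z l := by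
    intro Z hZ l hl
    have hZn : Z.Nonempty := by rcases hZ with rfl | rfl <;> assumption
    have h0 := S.half_nonneg hZn l
    have h1 : 2 * S.half Z l ≤ S.η * S.boxDist X Y := by
      refine (S.two_mul_half_le_diam hZn l).trans (le_trans ?_ hadm)
      rcases hZ with rfl | rfl
      · exact le_max_left _ _
      · exact le_max_right _ _
    have h2 : 0 < S.half Z l := lt_of_le_of_ne h0 hl.symm
    exact ⟨pos_of_mul_pos_right (by linarith : 0 < S.η * S.boxDist X Y) hη.le, h1, h0⟩
  have key := abs_sub_twoSidedInterp_le (p := S.p) (Λ := 12 * (Real.log S.p + 1)) (by linarith) hδ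
    (fun t ht => sum_abs_chebLagrange_le hp ht) hd (fun t s => S.ρ (S.pt X t) (S.pt Y s)) ?_ ?_
    (t := S.coord X (S.x i)) (s := S.coord Y (S.x j)) (S.abs_coord_le (S.x_mem_box hi))
    (S.abs_coord_le (S.x_mem_box hj))
  · rw [S.pt_coord (S.x_mem_box hi), S.pt_coord (S.x_mem_box hj)] at key
    exact key
  · intro l t s ht hs
    -- In a degenerate direction the kernel does not depend on the local coordinate, and the
    -- Lagrange functions sum to one.
    by_cases hl : S.half X l = 0
    · have : ∀ a, S.pt X (Function.update t l a) = S.pt X t := by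
        intro a
        rw [pt_update, hl]
        conv_rhs => rw [← Function.update_eq_self l t, pt_update, hl]
        simp
      simp only [this]
      rw [← Finset.mul_sum, sum_chebLagrange hp]
      simpa using hδ
    · obtain ⟨hD, h2, h3⟩ := hDpos X (Or.inl rfl) l hl
      have hline : ∀ a : ℝ, ((S.pt X (Function.update t l 0), S.pt Y s) : Pt d × Pt d) +
          a • (S.half X l • ((EuclideanSpace.single l (1 : ℝ), 0) : Pt d × Pt d)) =
          (S.pt X (Function.update t l a), S.pt Y s) := by
        intro a
        rw [S.pt_update X t l a]
        simp
      have hm : ∀ a : ℝ, |a| ≤ 1 → S.pt X (Function.update t l a) ∈ S.box X := fun a ha =>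
        S.pt_mem_box hXn (hupd t l a ht ha)
      have := abs_sub_lineInterp_le hU hρ.1
        ((EuclideanSpace.single l (1 : ℝ), 0) : Pt d × Pt d)
        (S.pt X (Function.update t l 0), S.pt Y s) hp h3 hD hc₁ hc₂ h2
        (fun a ha => by
          rw [hline]
          exact hmemU _ (hm a ha) _ (S.pt_mem_box hYn hs) hD)
        (fun a ha => by
          rw [hline, ← mixedPartial_single_left]
          exact hbound _ (hm a ha) _ (S.pt_mem_box hYn hs) hD _ _ (by simp)) (ht l)
      simpa only [hline, Function.update_eq_self] using this
  · intro l t s ht hs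
    by_cases hl : S.half Y l = 0
    · have : ∀ a, S.pt Y (Function.update s l a) = S.pt Y s := by
        intro a
        rw [pt_update, hl]
        conv_rhs => rw [← Function.update_eq_self l s, pt_update, hl]
        simp
      simp only [this]
      rw [← Finset.mul_sum, sum_chebLagrange hp]
      simpa using hδ
    · obtain ⟨hD, h2, h3⟩ := hDpos Y (Or.inr rfl) l hl
      have hline : ∀ a : ℝ, ((S.pt X t, S.pt Y (Function.update s l 0)) : Pt d × Pt d) +
          a • (S.half Y l • ((0, EuclideanSpace.single l (1 : ℝ)) : Pt d × Pt d)) =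
          (S.pt X t, S.pt Y (Function.update s l a)) := by
        intro a
        rw [S.pt_update Y s l a]
        simp
      have hm : ∀ a : ℝ, |a| ≤ 1 → S.pt Y (Function.update s l a) ∈ S.box Y := fun a ha =>
        S.pt_mem_box hYn (hupd s l a hs ha)
      have := abs_sub_lineInterp_le hU hρ.1
        ((0, EuclideanSpace.single l (1 : ℝ)) : Pt d × Pt d)
        (S.pt X t, S.pt Y (Function.update s l 0)) hp h3 hD hc₁ hc₂ h2
        (fun a ha => by
          rw [hline]
          exact hmemU _ (S.pt_mem_box hXn ht) _ (hm a ha) hD)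
        (fun a ha => by
          rw [hline, ← mixedPartial_single_right]
          exact hbound _ (S.pt_mem_box hXn ht) _ (hm a ha) hD _ _ (by simp)) (hs l)
      simpa only [hline, Function.update_eq_self] using this

end H2Data

/-! ### Sums over lists -/

theorem List.sum_map_flatMap' {α β M : Type*} [AddCommMonoid M] (l : List α) (g : α → List β)
    (f : β → M) : ((l.flatMap g).map f).sum = (l.map fun a => ((g a).map f).sum).sum := by
  induction l with
  | nil => simp
  | cons a l ih => simp [ih]

theorem List.sum_map_filter' {α M : Type*} [AddCommMonoid M] (l : List α) (P : α → Prop)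
    [DecidablePred P] (f : α → M) :
    ((l.filter fun a => decide (P a)).map f).sum = (l.map fun a => if P a then f a else 0).sum := by
  induction l with
  | nil => simp
  | cons a l ih => by_cases h : P a <;> simp [h, ih]

theorem List.sum_map_sum_map_comm {α β M : Type*} [AddCommMonoid M] (l : List α) (l' : List β)
    (f : α → β → M) : (l.map fun a => (l'.map fun b => f a b).sum).sum =
      (l'.map fun b => (l.map fun a => f a b).sum).sum := by
  induction l with
  | nil => simp
  | cons a l ih => simp [ih, List.sum_map_add]

theorem List.sum_map_eq_zero {α M : Type*} [AddCommMonoid M] (l : List α) (f : α → M)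
    (h : ∀ a ∈ l, f a = 0) : (l.map f).sum = 0 := by
  rw [List.map_congr_left h]; simp

theorem List.sum_map_mul_map {α β M : Type*} [NonUnitalNonAssocSemiring M]
    (l : List α) (l' : List β) (f : α → M) (g : β → M) :
    (l.map fun a => (l'.map fun b => f a * g b).sum).sum = (l.map f).sum * (l'.map g).sum := by
  simp only [List.sum_map_mul_left]
  rw [List.sum_map_mul_right]

/-- Extracts from the counting form of the partition property the single block that contains a given
index pair. -/
theorem List.exists_of_sum_indicator_eq_one {α : Type*} (l : List α) (P : α → Prop)
    [DecidablePred P] (h : (l.map fun a => if P a then 1 else 0).sum = 1) :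
    ∃ a ∈ l, P a ∧ ∀ f : α → ℝ, (l.map fun b => if P b then f b else 0).sum = f a := by
  induction l with
  | nil => simp at h
  | cons a l ih =>
    by_cases ha : P a
    · refine ⟨a, by simp, ha, fun f => ?_⟩
      have h0 : ∀ b ∈ l, ¬ P b := by
        intro b hb hPb
        simp only [List.map_cons, List.sum_cons, if_pos ha, Nat.add_eq_left,
          List.sum_eq_zero_iff_forall_eq_nat] at h
        have := h _ (List.mem_map_of_mem hb)
        simp [hPb] at this
      simp only [List.map_cons, List.sum_cons, if_pos ha]
      rw [List.sum_map_eq_zero l _ fun b hb => if_neg (h0 b hb), add_zero]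
    · simp only [List.map_cons, List.sum_cons, if_neg ha, zero_add] at h ⊢
      obtain ⟨b, hb, h1, h2⟩ := ih h
      exact ⟨b, by simp [hb], h1, h2⟩

/-! ### Cluster trees -/

namespace CTree

variable {N : ℕ}

/-- Clusters are nonempty and each inner cluster is the disjoint union of its two sons. -/
def WF : CTree N → Prop
  | .leaf X => X.Nonempty
  | .node X l r => X = l.pts ∪ r.pts ∧ Disjoint l.pts r.pts ∧ l.WF ∧ r.WF

/-- All clusters of the tree. -/
def nodes : CTree N → List (Finset (Fin N))
  | .leaf X => [X]
  | .node X l r => X :: (l.nodes ++ r.nodes)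

/-- The trees that replace a component of a block when the block is split. -/
def sons : CTree N → List (CTree N)
  | .leaf X => [.leaf X]
  | .node _ l r => [l, r]

/-- The tree consists of its root only. -/
def IsLeaf : CTree N → Prop
  | .leaf _ => True
  | .node _ _ _ => False

/-- Length of the longest branch. -/
def depth : CTree N → ℕ
  | .leaf _ => 0
  | .node _ l r => max l.depth r.depth + 1

@[simp]
theorem pts_leaf (X : Finset (Fin N)) : (CTree.leaf X).pts = X := rfl

@[simp]
theorem pts_node (X : Finset (Fin N)) (l r : CTree N) : (CTree.node X l r).pts = X := rfl

theorem WF.nonempty {T : CTree N} (h : T.WF) : T.pts.Nonempty := by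
  induction T with
  | leaf X => exact h
  | node X l r ihl ihr =>
    obtain ⟨h1, -, h3, -⟩ := h
    simp only [pts_node]
    rw [h1]
    exact (ihl h3).mono Finset.subset_union_left

theorem WF.sons {T : CTree N} (h : T.WF) {A : CTree N} (hA : A ∈ T.sons) : A.WF := by
  cases T with
  | leaf X => simp only [CTree.sons, List.mem_singleton] at hA; exact hA ▸ h
  | node X l r =>
    simp only [CTree.sons, List.mem_cons, List.not_mem_nil, or_false] at hA
    rcases hA with rfl | rfl
    exacts [h.2.2.1, h.2.2.2]

theorem sons_depth {T A : CTree N} (hA : A ∈ T.sons) : A.depth ≤ T.depth - 1 := by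
  cases T with
  | leaf X => simp only [CTree.sons, List.mem_singleton] at hA; subst hA; simp [depth]
  | node X l r =>
    simp only [CTree.sons, List.mem_cons, List.not_mem_nil, or_false] at hA
    rcases hA with rfl | rfl <;> simp [depth]

theorem isLeaf_iff_depth {T : CTree N} : T.IsLeaf ↔ T.depth = 0 := by
  cases T <;> simp [IsLeaf, depth]

theorem pts_mem_nodes (T : CTree N) : T.pts ∈ T.nodes := by
  cases T <;> simp [pts, nodes]

theorem sons_nodes_subset {T A : CTree N} (hA : A ∈ T.sons) : A.nodes ⊆ T.nodes := by
  cases T with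
  | leaf X => simp only [CTree.sons, List.mem_singleton] at hA; subst hA; exact fun _ h => h
  | node X l r =>
    simp only [CTree.sons, List.mem_cons, List.not_mem_nil, or_false] at hA
    intro Z hZ
    rcases hA with rfl | rfl <;> simp [nodes, hZ]

theorem WF.subset_pts {T : CTree N} (h : T.WF) {Z : Finset (Fin N)} (hZ : Z ∈ T.nodes) :
    Z ⊆ T.pts ∧ Z.Nonempty := by
  induction T with
  | leaf X =>
    simp only [nodes, List.mem_singleton] at hZ
    subst hZ
    exact ⟨fun _ h => h, h⟩
  | node X l r ihl ihr =>
    have hne := h.nonempty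
    obtain ⟨h1, -, h3, h4⟩ := h
    simp only [nodes, List.mem_cons, List.mem_append] at hZ
    simp only [pts_node] at hne ⊢
    rcases hZ with rfl | hZ | hZ
    · exact ⟨fun _ h => h, hne⟩
    · exact ⟨h1 ▸ (ihl h3 hZ).1.trans Finset.subset_union_left, (ihl h3 hZ).2⟩
    · exact ⟨h1 ▸ (ihr h4 hZ).1.trans Finset.subset_union_right, (ihr h4 hZ).2⟩

/-- The other son is nonempty and disjoint, so nothing below one son can be all of the father. -/
theorem WF.ssubset {X : Finset (Fin N)} {l r : CTree N} (h : (CTree.node X l r).WF)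
    {Z : Finset (Fin N)} (hZ : Z ∈ l.nodes ∨ Z ∈ r.nodes) : Z ≠ X := by
  obtain ⟨h1, h2, h3, h4⟩ := h
  rintro rfl
  rcases hZ with hZ | hZ
  · obtain ⟨i, hi⟩ := h4.nonempty
    have : i ∈ l.pts := (h3.subset_pts hZ).1 (h1 ▸ Finset.mem_union_right _ hi)
    exact Finset.disjoint_left.1 h2 this hi
  · obtain ⟨i, hi⟩ := h3.nonempty
    have : i ∈ r.pts := (h4.subset_pts hZ).1 (h1 ▸ Finset.mem_union_left _ hi)
    exact Finset.disjoint_left.1 h2 hi this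

theorem WF.nodes_disjoint {X : Finset (Fin N)} {l r : CTree N} (h : (CTree.node X l r).WF)
    {Z : Finset (Fin N)} (hl : Z ∈ l.nodes) (hr : Z ∈ r.nodes) : False := by
  obtain ⟨i, hi⟩ := (h.2.2.1.subset_pts hl).2
  exact Finset.disjoint_left.1 h.2.1 ((h.2.2.1.subset_pts hl).1 hi)
    ((h.2.2.2.subset_pts hr).1 hi)

/-- Different nodes carry different clusters, so a table of coefficients indexed by clusters has one
entry for each node. -/
theorem WF.nodup_nodes {T : CTree N} (h : T.WF) : T.nodes.Nodup := by
  induction T with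
  | leaf X => simp [nodes]
  | node X l r ihl ihr =>
    rw [nodes, List.nodup_cons, List.nodup_append]
    refine ⟨?_, ihl h.2.2.1, ihr h.2.2.2, ?_⟩
    · intro hX
      exact h.ssubset (List.mem_append.1 hX) rfl
    · rintro a ha b hb rfl
      exact h.nodes_disjoint ha hb

theorem WF.sum_sons {T : CTree N} (h : T.WF) (i : Fin N) :
    (T.sons.map fun A => if i ∈ A.pts then 1 else 0).sum = if i ∈ T.pts then 1 else 0 := by
  cases T with
  | leaf X => simp [CTree.sons, pts]
  | node X l r =>
    obtain ⟨h1, h2, -, -⟩ := h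
    simp only [CTree.sons, List.map_cons, List.map_nil, List.sum_cons, List.sum_nil, add_zero]
    simp only [pts_node, h1, Finset.mem_union]
    by_cases hl : i ∈ l.pts
    · have := Finset.disjoint_left.1 h2 hl
      simp [hl, this]
    · simp [hl]

end CTree

namespace H2Data

variable {d N : ℕ} (S : H2Data d N)

/-- The block consisting of the roots of the two trees is split in the block-cluster tree. -/
def Splits (T T' : CTree N) : Prop := ¬ S.Admissible T.pts T'.pts ∧ ¬ (T.IsLeaf ∧ T'.IsLeaf)

theorem blockLeaves_of_not_splits {T T' : CTree N} (h : ¬ S.Splits T T') :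
    S.blockLeaves T T' = [(T.pts, T'.pts)] := by
  cases T <;> cases T' <;> rw [blockLeaves] <;>
    simp_all [Splits, CTree.IsLeaf, CTree.pts]

/-- Because a leaf counts as its own only son, the three splitting cases in the definition become
one product. -/
theorem blockLeaves_of_splits {T T' : CTree N} (h : S.Splits T T') :
    S.blockLeaves T T' = T.sons.flatMap fun A => T'.sons.flatMap fun B => S.blockLeaves A B := by
  cases T <;> cases T' <;> rw [blockLeaves] <;>
    simp_all [Splits, CTree.IsLeaf, CTree.pts, CTree.sons]

/-- Induction along the block-cluster tree. -/
theorem block_induction {P : CTree N → CTree N → Prop}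
    (h₁ : ∀ T T', ¬ S.Splits T T' → P T T')
    (h₂ : ∀ T T', S.Splits T T' → (∀ A ∈ T.sons, ∀ B ∈ T'.sons, P A B) → P T T')
    (T T' : CTree N) : P T T' := by
  -- The sum of the depths drops at each split, as at least one component is not a leaf.
  obtain ⟨n, hn⟩ : ∃ n, T.depth + T'.depth ≤ n := ⟨_, le_rfl⟩
  induction n generalizing T T' with
  | zero =>
    refine h₁ _ _ fun h => h.2 ?_
    rw [CTree.isLeaf_iff_depth, CTree.isLeaf_iff_depth]
    omega
  | succ n ih =>
    by_cases h : S.Splits T T'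
    · refine h₂ _ _ h fun A hA B hB => ih A B ?_
      have h1 := CTree.sons_depth hA
      have h2 := CTree.sons_depth hB
      have h3 := h.2
      rw [CTree.isLeaf_iff_depth, CTree.isLeaf_iff_depth] at h3
      omega
    · exact h₁ _ _ h

theorem mem_nodes_of_mem_blockLeaves (T T' : CTree N) :
    ∀ b ∈ S.blockLeaves T T', b.1 ∈ T.nodes ∧ b.2 ∈ T'.nodes := by
  induction T, T' using S.block_induction with
  | h₁ T T' h =>
    rw [S.blockLeaves_of_not_splits h]
    simp [CTree.pts_mem_nodes]
  | h₂ T T' h ih =>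
    rw [S.blockLeaves_of_splits h]
    intro b hb
    simp only [List.mem_flatMap] at hb
    obtain ⟨A, hA, B, hB, hb⟩ := hb
    exact ⟨CTree.sons_nodes_subset hA (ih A hA B hB b hb).1,
      CTree.sons_nodes_subset hB (ih A hA B hB b hb).2⟩

/-- The blocks partition the product of the two root clusters, stated by counting since they form a
list. The indicator of a product factors, so one split is handled by `WF.sum_sons` in each
component. -/
theorem sum_blockLeaves_indicator (i j : Fin N) (T T' : CTree N) : T.WF → T'.WF →
    ((S.blockLeaves T T').map fun b => if i ∈ b.1 ∧ j ∈ b.2 then 1 else 0).sum =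
      if i ∈ T.pts ∧ j ∈ T'.pts then 1 else 0 := by
  have hmul : ∀ X Y : Finset (Fin N), (if i ∈ X ∧ j ∈ Y then 1 else 0) =
      (if i ∈ X then 1 else 0) * (if j ∈ Y then 1 else 0) := by
    intro X Y; by_cases h : i ∈ X <;> simp [h]
  induction T, T' using S.block_induction with
  | h₁ T T' h =>
    rw [S.blockLeaves_of_not_splits h]
    simp
  | h₂ T T' h ih =>
    intro hT hT'
    rw [S.blockLeaves_of_splits h, List.sum_map_flatMap']
    simp only [List.sum_map_flatMap']
    rw [hmul, ← hT.sum_sons i, ← hT'.sum_sons j, ← List.sum_map_mul_map]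
    refine congrArg _ (List.map_congr_left fun A hA => congrArg _ (List.map_congr_left fun B hB => ?_))
    rw [ih A hA B hB (hT.sons hA) (hT'.sons hB), hmul]

/-- The splitting rule is symmetric, so exchanging the trees transposes the blocks up to order; this
yields the symmetry of the `H²`-matrix. -/
theorem sum_blockLeaves_swap {M : Type*} [AddCommMonoid M] (T T' : CTree N) :
    ∀ f : Finset (Fin N) × Finset (Fin N) → M, ((S.blockLeaves T T').map f).sum =
      ((S.blockLeaves T' T).map fun b => f (b.2, b.1)).sum := by
  have hsymm : ∀ A B, S.Splits A B → S.Splits B A := fun A B h =>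
    ⟨fun h' => h.1 (S.admissible_comm.1 h'), fun h' => h.2 h'.symm⟩
  induction T, T' using S.block_induction with
  | h₁ T T' h =>
    intro f
    rw [S.blockLeaves_of_not_splits h, S.blockLeaves_of_not_splits fun h' => h (hsymm _ _ h')]
    simp
  | h₂ T T' h ih =>
    intro f
    rw [S.blockLeaves_of_splits h, S.blockLeaves_of_splits (hsymm _ _ h)]
    simp only [List.sum_map_flatMap']
    rw [List.sum_map_sum_map_comm]
    refine congrArg _ (List.map_congr_left fun B hB => congrArg _ (List.map_congr_left fun A hA => ?_))
    exact ih A hA B hB f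

/-! ### The cluster tree of a set of distinct points -/

/-- If the longest edge had length zero, all points of the cluster would coincide. -/
theorem half_dir_pos (hx : Function.Injective S.x) (hS : S.SplitsLongestEdge)
    {X : Finset (Fin N)} (hX : 1 < X.card) : 0 < S.half X (S.dir X) := by
  obtain ⟨i, hi, j, hj, hij⟩ := Finset.one_lt_card.1 hX
  have hne : X.Nonempty := ⟨i, hi⟩
  by_contra h
  refine hij (hx ?_)
  ext l
  have h1 := hS X hne l
  have h2 := S.lo_le hi l
  have h3 := S.lo_le hj l
  have h4 := S.le_hi hi l
  have h5 := S.le_hi hj l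
  unfold half at h h1
  push Not at h
  linarith

/-- The bounding box is the smallest one, so some point lies on its lower face; likewise the upper
son receives a point of the upper face. -/
theorem lowerSon_nonempty (hx : Function.Injective S.x) (hS : S.SplitsLongestEdge)
    {X : Finset (Fin N)} (hX : 1 < X.card) : (S.lowerSon X).Nonempty := by
  have hne : X.Nonempty := Finset.card_pos.1 (by omega)
  obtain ⟨i, hi, e⟩ := S.exists_eq_lo hne (S.dir X)
  have := S.half_dir_pos hx hS hX
  refine ⟨i, Finset.mem_filter.2 ⟨hi, ?_⟩⟩
  rw [e]; unfold mid; unfold half at this; linarith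

theorem upperSon_nonempty (hx : Function.Injective S.x) (hS : S.SplitsLongestEdge)
    {X : Finset (Fin N)} (hX : 1 < X.card) : (S.upperSon X).Nonempty := by
  have hne : X.Nonempty := Finset.card_pos.1 (by omega)
  obtain ⟨i, hi, e⟩ := S.exists_eq_hi hne (S.dir X)
  have := S.half_dir_pos hx hS hX
  refine ⟨i, Finset.mem_sdiff.2 ⟨hi, fun h => ?_⟩⟩
  have h2 := (Finset.mem_filter.1 h).2
  rw [e] at h2; unfold mid at h2; unfold half at this; linarith

theorem lowerSon_subset (X : Finset (Fin N)) : S.lowerSon X ⊆ X := Finset.filter_subset _ _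

theorem upperSon_subset (X : Finset (Fin N)) : S.upperSon X ⊆ X := Finset.sdiff_subset

theorem pts_build (n : ℕ) (X : Finset (Fin N)) : (S.build n X).pts = X := by
  cases n with
  | zero => rfl
  | succ n => rw [build]; split_ifs <;> rfl

theorem wf_build (hx : Function.Injective S.x) (hS : S.SplitsLongestEdge)
    (hC : 1 ≤ S.Cleaf) (n : ℕ) {X : Finset (Fin N)} (hX : X.Nonempty) :
    (S.build n X).WF := by
  induction n generalizing X with
  | zero => exact hX
  | succ n ih =>
    rw [build]
    split_ifs with h
    · exact hX
    · refine ⟨?_, ?_, ih (S.lowerSon_nonempty hx hS (by omega)),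
        ih (S.upperSon_nonempty hx hS (by omega))⟩
      · rw [pts_build, pts_build]
        exact (Finset.union_sdiff_of_subset (S.lowerSon_subset X)).symm
      · rw [pts_build, pts_build]
        exact Finset.disjoint_sdiff

end H2Data

/-! ### Values and costs of elementary computations -/

namespace Counted

@[simp] theorem val_bind {α β : Type} (m : Counted α) (f : α → Counted β) :
    (m >>= f).val = (f m.val).val := rfl

@[simp] theorem ops_bind {α β : Type} (m : Counted α) (f : α → Counted β) :
    (m >>= f).ops = m.ops + (f m.val).ops := rfl

@[simp] theorem val_pure {α : Type} (a : α) : (pure a : Counted α).val = a := rfl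

@[simp] theorem ops_pure {α : Type} (a : α) : (pure a : Counted α).ops = 0 := rfl

@[simp] theorem val_each {ι : Type} [Fintype ι] (f : ι → Counted ℝ) (i : ι) :
    (each f).val i = (f i).val := rfl

@[simp] theorem ops_each {ι : Type} [Fintype ι] (f : ι → Counted ℝ) :
    (each f).ops = ∑ i, (f i).ops := rfl

@[simp] theorem val_mul (a b : ℝ) : (mul a b).val = a * b := rfl

@[simp] theorem ops_mul (a b : ℝ) : (mul a b).ops = 1 := rfl

theorem foldlM_add {ι : Type} (l : List ι) (f : ι → Counted ℝ) (a : ℝ) :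
    (l.foldlM (fun acc i => do let t ← f i; add acc t) a).val = a + (l.map fun i => (f i).val).sum ∧
    (l.foldlM (fun acc i => do let t ← f i; add acc t) a).ops =
      (l.map fun i => (f i).ops + 1).sum := by
  induction l generalizing a with
  | nil => simp
  | cons i l ih =>
    rw [List.foldlM_cons, val_bind, ops_bind]
    obtain ⟨h1, h2⟩ := ih (f i >>= fun t => add a t).val
    rw [h1, h2]
    simp [add, add_assoc]

@[simp] theorem val_sumFrom {ι : Type} (a : ℝ) (s : Finset ι) (f : ι → Counted ℝ) :
    (sumFrom a s f).val = a + ∑ i ∈ s, (f i).val := by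
  rw [sumFrom, (foldlM_add _ _ _).1, Finset.sum_map_toList]

@[simp] theorem ops_sumFrom {ι : Type} (a : ℝ) (s : Finset ι) (f : ι → Counted ℝ) :
    (sumFrom a s f).ops = ∑ i ∈ s, ((f i).ops + 1) := by
  rw [sumFrom, (foldlM_add _ _ _).2, Finset.sum_map_toList]

end Counted

theorem List.finsetSum_sum_map {ι α M : Type*} [AddCommMonoid M] (s : Finset ι) (l : List α)
    (f : ι → α → M) : ∑ i ∈ s, (l.map (f i)).sum = (l.map fun a => ∑ i ∈ s, f i a).sum := by
  induction l with
  | nil => simp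
  | cons a l ih => simp [Finset.sum_add_distrib, ih]

theorem List.sum_map_ite_eq_of_nodup {α M : Type*} [DecidableEq α] [AddCommMonoid M] {l : List α}
    (hl : l.Nodup) {a : α} (ha : a ∈ l) (f : α → M) :
    (l.map fun b => if a = b then f b else 0).sum = f a := by
  induction l with
  | nil => simp at ha
  | cons b l ih =>
    obtain ⟨h1, h2⟩ := List.nodup_cons.1 hl
    rcases List.mem_cons.1 ha with rfl | h
    · rw [List.map_cons, List.sum_cons, if_pos rfl, List.sum_map_eq_zero, add_zero]
      rintro c hc
      rw [if_neg]
      rintro rfl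
      exact h1 hc
    · have : a ≠ b := fun e => h1 (e ▸ h)
      rw [List.map_cons, List.sum_cons, if_neg this, ih h2 h, zero_add]

namespace H2Data

variable {d N : ℕ} (S : H2Data d N)

theorem card_idx : Fintype.card S.Idx = S.p ^ d := by simp [Idx]

/-! ### Correctness of the fast multiplication -/

/-- Nestedness of the Lagrange bases, `V^X = V^{X'} T^{X'X}` on the points of `X'`. -/
theorem V_eq_sum_transfer (X X' : Finset (Fin N)) {i : Fin N} (hi : i ∈ X') (n : S.Idx) :
    S.V X i n = ∑ m, S.T X' X m n * S.V X' i m := by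
  have h1 : ∀ j, chebLagrange S.p (n j) ((S.x i j - S.mid X j) / S.half X j) =
      ∑ l, chebLagrange S.p (n j)
        ((S.mid X' j + S.half X' j * chebNode S.p l - S.mid X j) / S.half X j) *
          chebLagrange S.p l (S.coord X' (S.x i) j) := by
    intro j
    have hx : S.x i j = S.mid X' j + S.half X' j * S.coord X' (S.x i) j := by
      conv_lhs => rw [← S.pt_coord (S.x_mem_box hi)]
      simp [pt]
    have h := chebLagrange_affine (n j) ((S.mid X' j - S.mid X j) / S.half X j)
      (S.half X' j / S.half X j) (S.coord X' (S.x i) j)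
    -- The local coordinate for `X` is an affine function of that for `X'`. The identity survives a
    -- degenerate box, where every quotient is zero.
    have e : ∀ t, (S.mid X' j - S.mid X j) / S.half X j + S.half X' j / S.half X j * t =
        (S.mid X' j + S.half X' j * t - S.mid X j) / S.half X j := by intro t; ring
    simp only [e] at h
    rw [← hx] at h
    exact h
  unfold V T lagrange
  simp only [h1]
  rw [Finset.prod_univ_sum, Fintype.piFinset_univ]
  refine Finset.sum_congr rfl fun m _ => ?_
  rw [Finset.prod_mul_distrib]
  simp [chebPt, coord]

/-- The coefficients `(V^X)ᵀ v`. -/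
def moment (v : Fin N → ℝ) (X : Finset (Fin N)) (n : S.Idx) : ℝ := ∑ i ∈ X, S.V X i n * v i

theorem moment_node (v : Fin N → ℝ) {X Y Z : Finset (Fin N)} (hX : X = Y ∪ Z)
    (hd : Disjoint Y Z) (n : S.Idx) :
    ∑ m, S.T Y X m n * S.moment v Y m + ∑ m, S.T Z X m n * S.moment v Z m = S.moment v X n := by
  have h : ∀ W, ∑ m, S.T W X m n * S.moment v W m = ∑ i ∈ W, S.V X i n * v i := by
    intro W
    simp only [moment, Finset.mul_sum]
    rw [Finset.sum_comm]
    refine Finset.sum_congr rfl fun i hi => ?_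
    rw [S.V_eq_sum_transfer X W hi n, Finset.sum_mul]
    exact Finset.sum_congr rfl fun m _ => by ring
  rw [h, h, ← Finset.sum_union hd, ← hX]
  rfl

/-- The disjunction is the induction invariant: entries of the subtree become correct, and entries
that were already correct remain so. -/
theorem val_forward (v : Fin N → ℝ) {T : CTree N} (hT : T.WF) (c : S.Coeffs)
    (Z : Finset (Fin N)) (hZ : Z ∈ T.nodes ∨ c Z = S.moment v Z) :
    (S.forward v T c).val Z = S.moment v Z := by
  induction T generalizing c Z with
  | leaf X =>
    simp only [forward, Counted.val_bind, Counted.val_pure]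
    by_cases h : Z = X
    · subst h
      funext n
      simp [moment]
    · rw [Function.update_of_ne h]
      simpa [CTree.nodes, h] using hZ
  | node X l r ihl ihr =>
    obtain ⟨h1, h2, h3, h4⟩ := hT
    simp only [forward, Counted.val_bind, Counted.val_pure]
    by_cases h : Z = X
    · subst h
      have hl : (S.forward v r (S.forward v l c).val).val l.pts = S.moment v l.pts :=
        ihr h4 _ _ (Or.inr (ihl h3 _ _ (Or.inl l.pts_mem_nodes)))
      have hr : (S.forward v r (S.forward v l c).val).val r.pts = S.moment v r.pts :=
        ihr h4 _ _ (Or.inl r.pts_mem_nodes)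
      funext n
      simp only [Function.update_self, Counted.val_each, Counted.val_bind, Counted.val_sumFrom,
        Counted.val_mul, hl, hr, zero_add]
      exact S.moment_node v h1 h2 n
    · rw [Function.update_of_ne h]
      simp only [CTree.nodes, List.mem_cons, h, List.mem_append, false_or] at hZ
      refine ihr h4 _ _ ?_
      rcases hZ with (hZ | hZ) | hZ
      · exact Or.inr (ihl h3 _ _ (Or.inl hZ))
      · exact Or.inl hZ
      · exact Or.inr (ihl h3 _ _ (Or.inr hZ))

theorem val_couple (a : S.Coeffs) (L : List (Finset (Fin N) × Finset (Fin N))) (b : S.Coeffs)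
    (X : Finset (Fin N)) (n : S.Idx) : (S.couple a L b).val X n = b X n +
      (L.map fun B => if B.1 = X then ∑ m, S.M B.1 B.2 n m * a B.2 m else 0).sum := by
  induction L generalizing b with
  | nil => simp [couple]
  | cons B L ih =>
    obtain ⟨Y, Z⟩ := B
    simp only [couple, Counted.val_bind, ih, List.map_cons, List.sum_cons]
    by_cases h : Y = X
    · subst h
      simp [add_assoc]
    · rw [Function.update_of_ne (Ne.symm h)]
      simp [h]

/-- Handing b^X down to a son X' adds V^(X') T^(X'X) b^X at the points of X', which is V^X b^X by
nestedness. The contribution of X is thus moved, not changed. -/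
theorem val_backward {T : CTree N} (hT : T.WF) (b : S.Coeffs) (y : Fin N → ℝ) (i : Fin N) :
    (S.backward T b y).val i = y i +
      (T.nodes.map fun Z => if i ∈ Z then ∑ n, S.V Z i n * b Z n else 0).sum := by
  induction T generalizing b y with
  | leaf X =>
    by_cases h : i ∈ X <;> simp [backward, CTree.nodes, h]
  | node X l r ihl ihr =>
    have hT' := hT
    obtain ⟨h1, h2, h3, h4⟩ := hT
    have hlr : l.pts ≠ r.pts := by
      intro e
      exact hT'.nodes_disjoint l.pts_mem_nodes (e ▸ r.pts_mem_nodes)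
    simp only [backward, Counted.val_bind]
    rw [ihr h4, ihl h3]
    set tl : S.Idx → ℝ := (Counted.each fun m =>
      Counted.sumFrom (b l.pts m) Finset.univ fun n => Counted.mul (S.T l.pts X m n) (b X n)).val
      with htl
    set tr : S.Idx → ℝ := (Counted.each fun m =>
      Counted.sumFrom (b r.pts m) Finset.univ fun n => Counted.mul (S.T r.pts X m n) (b X n)).val
      with htr
    set b' := Function.update (Function.update b l.pts tl) r.pts tr with hb'
    -- In the tree `W` of a son only the root coefficient is updated, and its cluster occurs there
    -- exactly once.
    have key : ∀ W : CTree N, W.WF → b' W.pts = (fun m => b W.pts m + ∑ n, S.T W.pts X m n * b X n) →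
        (∀ Z ∈ W.nodes, Z ≠ W.pts → b' Z = b Z) →
        (W.nodes.map fun Z => if i ∈ Z then ∑ n, S.V Z i n * b' Z n else 0).sum =
        (W.nodes.map fun Z => if i ∈ Z then ∑ n, S.V Z i n * b Z n else 0).sum +
          if i ∈ W.pts then ∑ n, S.V X i n * b X n else 0 := by
      intro W hW hbW hbZ
      have hone : (W.nodes.map fun Z => if W.pts = Z then
          (if i ∈ Z then ∑ n, S.V X i n * b X n else 0) else 0).sum =
          if i ∈ W.pts then ∑ n, S.V X i n * b X n else 0 :=
        List.sum_map_ite_eq_of_nodup hW.nodup_nodes W.pts_mem_nodes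
          fun Z => if i ∈ Z then ∑ n, S.V X i n * b X n else 0
      rw [← hone, ← List.sum_map_add]
      refine congrArg _ (List.map_congr_left fun Z hZ => ?_)
      by_cases hi : i ∈ Z
      swap
      · simp [hi]
      by_cases h : Z = W.pts
      · subst h
        simp only [if_pos hi, if_true, hbW]
        simp only [mul_add, Finset.sum_add_distrib]
        congr 1
        simp only [Finset.mul_sum]
        rw [Finset.sum_comm]
        refine Finset.sum_congr rfl fun n _ => ?_
        rw [S.V_eq_sum_transfer X _ hi n, Finset.sum_mul]
        exact Finset.sum_congr rfl fun m _ => by ring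
      · rw [hbZ Z hZ h, if_neg (fun e : W.pts = Z => h e.symm), add_zero]
    have hkl := key l h3 (by
        rw [hb', Function.update_of_ne hlr, Function.update_self, htl]
        funext m; simp) (by
        intro Z hZ hZl
        have : Z ≠ r.pts := fun e => hT'.nodes_disjoint hZ (e ▸ r.pts_mem_nodes)
        rw [hb', Function.update_of_ne this, Function.update_of_ne hZl])
    have hkr := key r h4 (by
        rw [hb', Function.update_self, htr]
        funext m; simp) (by
        intro Z hZ hZr
        have : Z ≠ l.pts := fun e => hT'.nodes_disjoint (e ▸ l.pts_mem_nodes) hZ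
        rw [hb', Function.update_of_ne hZr, Function.update_of_ne this])
    rw [hkl, hkr]
    simp only [CTree.nodes, List.map_cons, List.map_append, List.sum_cons, List.sum_append]
    have hX : (if i ∈ X then ∑ n, S.V X i n * b X n else 0) =
        (if i ∈ l.pts then ∑ n, S.V X i n * b X n else 0) +
        (if i ∈ r.pts then ∑ n, S.V X i n * b X n else 0) := by
      by_cases hl : i ∈ l.pts
      · have hr := Finset.disjoint_left.1 h2 hl
        have hiX : i ∈ X := h1 ▸ Finset.mem_union_left _ hl
        simp [hl, hr, hiX]
      · by_cases hr : i ∈ r.pts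
        · have hiX : i ∈ X := h1 ▸ Finset.mem_union_right _ hr
          simp [hl, hr, hiX]
        · have hiX : i ∉ X := by rw [h1, Finset.mem_union]; tauto
          simp [hl, hr, hiX]
    rw [hX]
    ring

theorem val_nearMul (v : Fin N → ℝ) (L : List (Finset (Fin N) × Finset (Fin N)))
    (y : Fin N → ℝ) (i : Fin N) : (S.nearMul v L y).val i = y i +
      (L.map fun B => if i ∈ B.1 then ∑ j ∈ B.2, S.covMatrix i j * v j else 0).sum := by
  induction L generalizing y with
  | nil => simp [nearMul]
  | cons B L ih =>
    obtain ⟨Y, Z⟩ := B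
    simp only [nearMul, Counted.val_bind, ih, List.map_cons, List.sum_cons]
    by_cases h : i ∈ Y <;> simp [h, add_assoc]

/-- The fast multiplication computes the product with the `H²`-matrix. -/
theorem val_matVec (hT : S.clusterTree.WF) (v : Fin N → ℝ) :
    (S.matVec v).val = S.h2Matrix.mulVec v := by
  have hfar : ∀ B ∈ S.far, B.1 ∈ S.clusterTree.nodes ∧ B.2 ∈ S.clusterTree.nodes := fun B hB =>
    S.mem_nodes_of_mem_blockLeaves _ _ B (List.mem_of_mem_filter hB)
  funext i
  simp only [matVec, Counted.val_bind, val_nearMul, S.val_backward hT, val_couple, Pi.zero_apply,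
    zero_add]
  have hsum : (S.clusterTree.nodes.map fun Z => if i ∈ Z then ∑ n, S.V Z i n *
        (S.far.map fun B => if B.1 = Z then ∑ m, S.M B.1 B.2 n m *
          (S.forward v S.clusterTree 0).val B.2 m else 0).sum else 0).sum =
      (S.far.map fun B => if i ∈ B.1 then ∑ n, S.V B.1 i n *
        ∑ m, S.M B.1 B.2 n m * S.moment v B.2 m else 0).sum := by
    have h1 : ∀ Z, (if i ∈ Z then ∑ n, S.V Z i n *
        (S.far.map fun B => if B.1 = Z then ∑ m, S.M B.1 B.2 n m *
          (S.forward v S.clusterTree 0).val B.2 m else 0).sum else 0) =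
        (S.far.map fun B => if B.1 = Z then (if i ∈ Z then ∑ n, S.V Z i n *
          ∑ m, S.M B.1 B.2 n m * S.moment v B.2 m else 0) else 0).sum := by
      intro Z
      by_cases hi : i ∈ Z
      · simp only [if_pos hi, ← List.sum_map_mul_left]
        rw [List.finsetSum_sum_map]
        refine congrArg _ (List.map_congr_left fun B hB => ?_)
        rw [S.val_forward v hT 0 B.2 (Or.inl (hfar B hB).2)]
        by_cases h : B.1 = Z <;> simp [h]
      · simp [hi]
    simp only [h1]
    rw [List.sum_map_sum_map_comm]
    refine congrArg _ (List.map_congr_left fun B hB => ?_)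
    exact List.sum_map_ite_eq_of_nodup hT.nodup_nodes (hfar B hB).1
      fun Z => if i ∈ Z then ∑ n, S.V Z i n * ∑ m, S.M B.1 B.2 n m * S.moment v B.2 m else 0
  rw [hsum]
  simp only [Matrix.mulVec, dotProduct, h2Matrix, Matrix.of_apply, add_mul,
    Finset.sum_add_distrib, ← List.sum_map_mul_right]
  rw [List.finsetSum_sum_map, List.finsetSum_sum_map]
  congr 1
  · refine congrArg _ (List.map_congr_left fun B _ => ?_)
    by_cases hi : i ∈ B.1
    · simp only [hi, if_true, true_and, ite_mul, zero_mul]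
      rw [← Finset.sum_filter, Finset.filter_mem_eq_inter, Finset.univ_inter]
      simp only [moment, Finset.mul_sum, Finset.sum_mul]
      rw [Finset.sum_comm' (t' := Finset.univ) (s' := fun _ => B.2) (by simp)]
      refine Finset.sum_congr rfl fun n _ => ?_
      rw [Finset.sum_comm]
      refine Finset.sum_congr rfl fun m _ => Finset.sum_congr rfl fun j _ => by ring
    · simp [hi]
  · refine congrArg _ (List.map_congr_left fun B _ => ?_)
    by_cases hi : i ∈ B.1
    · simp only [hi, if_true, true_and, ite_mul, zero_mul]
      rw [← Finset.sum_filter, Finset.filter_mem_eq_inter, Finset.univ_inter]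
    · simp [hi]

/-! ### Cost of the fast multiplication in terms of the number of blocks -/

/-- The term 4P² on the left, P = p^d, is a potential: an inner node costs 4P² and joins two
subtrees, each carrying this amount in reserve. The leaves pay for it since they are nonempty. -/
theorem ops_forward_add_le (v : Fin N → ℝ) {T : CTree N} (hT : T.WF) (c : S.Coeffs) :
    (S.forward v T c).ops + 4 * (S.p ^ d) ^ 2 ≤
      (4 * (S.p ^ d) ^ 2 + 2 * S.p ^ d) * T.pts.card := by
  induction T generalizing c with
  | leaf X =>
    have : 1 ≤ X.card := Finset.card_pos.2 hT
    simp only [forward, Counted.ops_bind, Counted.ops_pure, Counted.ops_each, Counted.ops_sumFrom,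
      Counted.ops_mul, Finset.sum_const, Finset.card_univ, card_idx, CTree.pts_leaf, smul_eq_mul]
    nlinarith [Nat.zero_le ((S.p ^ d) ^ 2)]
  | node X l r ihl ihr =>
    obtain ⟨h1, h2, h3, h4⟩ := hT
    have hl := ihl h3 c
    have hr := ihr h4 (S.forward v l c).val
    have hc : X.card = l.pts.card + r.pts.card := by rw [h1, Finset.card_union_of_disjoint h2]
    simp only [forward, Counted.ops_bind, Counted.ops_pure, Counted.ops_each, Counted.ops_sumFrom,
      Counted.ops_mul, Finset.sum_const, Finset.card_univ, card_idx, CTree.pts_node, smul_eq_mul]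
    rw [hc]
    nlinarith

theorem ops_backward_add_le {T : CTree N} (hT : T.WF) (b : S.Coeffs) (y : Fin N → ℝ) :
    (S.backward T b y).ops + 4 * (S.p ^ d) ^ 2 ≤
      (4 * (S.p ^ d) ^ 2 + 2 * S.p ^ d) * T.pts.card := by
  induction T generalizing b y with
  | leaf X =>
    have : 1 ≤ X.card := Finset.card_pos.2 hT
    have hi : ∀ i, (if i ∈ X then Counted.sumFrom (y i) Finset.univ fun n =>
        Counted.mul (S.V X i n) (b X n) else pure (y i)).ops =
        if i ∈ X then S.p ^ d * 2 else 0 := by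
      intro i
      by_cases h : i ∈ X <;> simp [h, Finset.card_univ]
    simp only [backward, Counted.ops_each, hi, CTree.pts_leaf]
    rw [← Finset.sum_filter, Finset.filter_mem_eq_inter, Finset.univ_inter, Finset.sum_const,
      smul_eq_mul]
    nlinarith [Nat.zero_le ((S.p ^ d) ^ 2)]
  | node X l r ihl ihr =>
    obtain ⟨h1, h2, h3, h4⟩ := hT
    have hc : X.card = l.pts.card + r.pts.card := by rw [h1, Finset.card_union_of_disjoint h2]
    simp only [backward, Counted.ops_bind, Counted.ops_each, Counted.ops_sumFrom,
      Counted.ops_mul, Finset.sum_const, Finset.card_univ, card_idx, CTree.pts_node, smul_eq_mul]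
    rw [hc]
    generalize hb : Function.update (Function.update b l.pts _) r.pts _ = b'
    have hl := ihl h3 b' y
    have hr := ihr h4 b' (S.backward l b' y).val
    nlinarith

theorem ops_couple (a : S.Coeffs) (L : List (Finset (Fin N) × Finset (Fin N))) (b : S.Coeffs) :
    (S.couple a L b).ops = 2 * (S.p ^ d) ^ 2 * L.length := by
  induction L generalizing b with
  | nil => simp [couple]
  | cons B L ih =>
    obtain ⟨Y, Z⟩ := B
    simp only [couple, Counted.ops_bind, ih, Counted.ops_each, Counted.ops_sumFrom,
      Counted.ops_mul, Finset.sum_const, Finset.card_univ, card_idx, smul_eq_mul, List.length_cons]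
    ring

theorem ops_nearMul_le (v : Fin N → ℝ) {C : ℕ} (L : List (Finset (Fin N) × Finset (Fin N)))
    (hL : ∀ B ∈ L, B.1.card ≤ C ∧ B.2.card ≤ C) (y : Fin N → ℝ) :
    (S.nearMul v L y).ops ≤ 2 * C ^ 2 * L.length := by
  induction L generalizing y with
  | nil => simp [nearMul]
  | cons B L ih =>
    obtain ⟨Y, Z⟩ := B
    obtain ⟨hY, hZ⟩ := hL (Y, Z) (by simp)
    simp only at hY hZ
    simp only [nearMul, Counted.ops_bind, Counted.ops_each, List.length_cons]
    have hi : ∀ i, (if i ∈ Y then Counted.sumFrom (y i) Z fun j =>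
        Counted.mul (S.covMatrix i j) (v j) else pure (y i)).ops =
        if i ∈ Y then Z.card * 2 else 0 := by
      intro i
      by_cases h : i ∈ Y <;> simp [h]
    simp only [hi]
    rw [← Finset.sum_filter, Finset.filter_mem_eq_inter, Finset.univ_inter, Finset.sum_const,
      smul_eq_mul]
    have := ih (fun B hB => hL B (by simp [hB]))
      (Counted.each fun i => if i ∈ Y then Counted.sumFrom (y i) Z fun j =>
        Counted.mul (S.covMatrix i j) (v j) else pure (y i)).val
    have h2 : Y.card * Z.card ≤ C * C := Nat.mul_le_mul hY hZ
    nlinarith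

end H2Data

namespace CTree

variable {N : ℕ}

/-! ### Levels of a cluster tree -/

/-- The subtrees at level `n`, where leaves of smaller level are kept. -/
def cut : ℕ → CTree N → List (CTree N)
  | 0, T => [T]
  | n + 1, T => T.sons.flatMap (cut n)

/-- The leaf clusters. -/
def leaves : CTree N → List (Finset (Fin N))
  | .leaf X => [X]
  | .node _ l r => l.leaves ++ r.leaves

/-- The clusters that are split. -/
def inner : CTree N → List (Finset (Fin N))
  | .leaf _ => []
  | .node X l r => X :: (l.inner ++ r.inner)

@[simp]
theorem cut_leaf (n : ℕ) (X : Finset (Fin N)) : (CTree.leaf X).cut n = [.leaf X] := by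
  induction n with
  | zero => rfl
  | succ n ih => simp [cut, CTree.sons, ih]

theorem cut_succ_node (n : ℕ) (X : Finset (Fin N)) (l r : CTree N) :
    (CTree.node X l r).cut (n + 1) = l.cut n ++ r.cut n := by
  simp [cut, CTree.sons]

theorem length_cut_le (n : ℕ) (T : CTree N) : (T.cut n).length ≤ 2 ^ n := by
  induction n generalizing T with
  | zero => simp [cut]
  | succ n ih =>
    cases T with
    | leaf X => simpa using Nat.one_le_two_pow
    | node X l r =>
      rw [cut_succ_node, List.length_append, pow_succ]
      have := ih l
      have := ih r
      omega

theorem WF.cut {T : CTree N} (h : T.WF) {n : ℕ} {A : CTree N} (hA : A ∈ T.cut n) : A.WF := by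
  induction n generalizing T with
  | zero => simp only [CTree.cut, List.mem_singleton] at hA; exact hA ▸ h
  | succ n ih =>
    simp only [CTree.cut, List.mem_flatMap] at hA
    obtain ⟨B, hB, hA⟩ := hA
    exact ih (h.sons hB) hA

/-- A binary tree has fewer inner nodes than leaves, and the leaves are disjoint and nonempty. -/
theorem inner_length_lt {T : CTree N} (h : T.WF) : T.inner.length < T.pts.card := by
  induction T with
  | leaf X =>
    have h' : X.Nonempty := h
    simpa [inner] using h'
  | node X l r ihl ihr =>
    obtain ⟨h1, h2, h3, h4⟩ := h
    have := ihl h3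
    have := ihr h4
    simp only [inner, List.length_cons, List.length_append, pts_node]
    rw [h1, Finset.card_union_of_disjoint h2]
    omega

theorem sum_ite_le_length {α : Type*} (l : List α) (P : α → Prop) [DecidablePred P] :
    (l.map fun a => if P a then (1 : ℝ) else 0).sum ≤ l.length := by
  induction l with
  | nil => simp
  | cons a l ih =>
    simp only [List.map_cons, List.sum_cons, List.length_cons]
    push_cast
    split_ifs <;> linarith

/-- Descend until a cluster lies in `s`, then apply `inner_length_lt`. This counts clusters of all
levels at once; `s` will be the set of points in a cube. -/
theorem sum_inner_subset_le {T : CTree N} (h : T.WF) (s : Finset (Fin N)) :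
    (T.inner.map fun Z => if Z ⊆ s then (1 : ℝ) else 0).sum ≤ (s ∩ T.pts).card := by
  induction T with
  | leaf X => simp [inner]
  | node X l r ihl ihr =>
    by_cases hX : X ⊆ s
    · refine (sum_ite_le_length _ _).trans ?_
      have := (inner_length_lt h).le
      rw [pts_node, Finset.inter_eq_right.2 hX]
      exact_mod_cast this
    · obtain ⟨h1, h2, h3, h4⟩ := h
      simp only [inner, List.map_cons, List.map_append, List.sum_cons, List.sum_append, if_neg hX,
        zero_add, pts_node]
      have hd : Disjoint (s ∩ l.pts) (s ∩ r.pts) :=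
        h2.mono Finset.inter_subset_right Finset.inter_subset_right
      rw [h1, Finset.inter_union_distrib_left, Finset.card_union_of_disjoint hd]
      push_cast
      exact add_le_add (ihl h3) (ihr h4)

theorem sum_cut_subset_le {T : CTree N} (h : T.WF) (s : Finset (Fin N)) (n : ℕ) :
    ((T.cut n).map fun A => if A.pts ⊆ s then (1 : ℝ) else 0).sum ≤ (s ∩ T.pts).card := by
  have hone : ∀ T : CTree N, T.WF → (if T.pts ⊆ s then (1 : ℝ) else 0) ≤ (s ∩ T.pts).card := by
    intro T hT
    split_ifs with h'
    · rw [Finset.inter_eq_right.2 h']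
      exact_mod_cast Finset.card_pos.2 hT.nonempty
    · positivity
  induction n generalizing T with
  | zero => simpa [cut] using hone T h
  | succ n ih =>
    cases T with
    | leaf X => simpa using hone _ h
    | node X l r =>
      obtain ⟨h1, h2, h3, h4⟩ := h
      have hd : Disjoint (s ∩ l.pts) (s ∩ r.pts) :=
        h2.mono Finset.inter_subset_right Finset.inter_subset_right
      rw [cut_succ_node, pts_node, h1, Finset.inter_union_distrib_left,
        Finset.card_union_of_disjoint hd, List.map_append, List.sum_append]
      push_cast
      exact add_le_add (ih h3) (ih h4)

theorem not_isLeaf_node (X : Finset (Fin N)) (l r : CTree N) : ¬ (CTree.node X l r).IsLeaf := id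

-- A leaf is repeated in all later cuts, so leaves can be bounded in a single cut only, in contrast
-- to the inner clusters below.
open Classical in
theorem sum_cut_leaf_le (T : CTree N) (n : ℕ) (f : Finset (Fin N) → ℝ) (hf : ∀ Z, 0 ≤ f Z) :
    ((T.cut n).map fun A => if A.IsLeaf then f A.pts else 0).sum ≤ (T.leaves.map f).sum := by
  induction n generalizing T with
  | zero =>
    cases T with
    | leaf X => simp [cut, IsLeaf, leaves]
    | node X l r =>
      simp only [cut, List.map_cons, List.map_nil, List.sum_cons, List.sum_nil, add_zero]
      rw [if_neg (not_isLeaf_node X l r)]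
      exact List.sum_nonneg fun x hx => by
        obtain ⟨a, -, rfl⟩ := List.mem_map.1 hx
        exact hf a
  | succ n ih =>
    cases T with
    | leaf X => simp [IsLeaf, leaves]
    | node X l r =>
      rw [cut_succ_node, leaves, List.map_append, List.sum_append, List.map_append,
        List.sum_append]
      exact add_le_add (ih l) (ih r)

-- An inner cluster belongs to the cut of one level only, so the sum over all levels counts it once.
open Classical in
theorem sum_cut_inner_le (T : CTree N) (n : ℕ) (f : Finset (Fin N) → ℝ) (hf : ∀ Z, 0 ≤ f Z) :
    ∑ k ∈ Finset.range n, ((T.cut k).map fun A => if A.IsLeaf then 0 else f A.pts).sum ≤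
      (T.inner.map f).sum := by
  induction T generalizing n with
  | leaf X => simp [inner, IsLeaf]
  | node X l r ihl ihr =>
    have hnn : ∀ L : List (Finset (Fin N)), 0 ≤ (L.map f).sum := fun L =>
      List.sum_nonneg fun x hx => by
        obtain ⟨a, -, rfl⟩ := List.mem_map.1 hx
        exact hf a
    cases n with
    | zero => simpa using hnn _
    | succ n =>
      rw [Finset.sum_range_succ']
      simp only [cut_succ_node, List.map_append, List.sum_append, Finset.sum_add_distrib, inner,
        List.map_cons, List.sum_cons]
      have h1 := ihl n
      have h2 := ihr n
      have h3 : ((CTree.node X l r).cut 0).map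
          (fun A => if A.IsLeaf then 0 else f A.pts) = [f X] := by
        simp [cut, IsLeaf]
      rw [h3, List.sum_singleton]
      linarith

end CTree

namespace H2Data

variable {d N : ℕ} (S : H2Data d N)

/-! ### The number of blocks -/

open Classical in
/-- The number of blocks of level `n` that are split. -/
def splitCount (n : ℕ) (T T' : CTree N) : ℝ :=
  ((T.cut n).map fun A => ((T'.cut n).map fun B => if S.Splits A B then (1 : ℝ) else 0).sum).sum

theorem splitCount_nonneg (n : ℕ) (T T' : CTree N) : 0 ≤ S.splitCount n T T' := by
  refine List.sum_nonneg fun x hx => ?_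
  obtain ⟨A, -, rfl⟩ := List.mem_map.1 hx
  refine List.sum_nonneg fun y hy => ?_
  obtain ⟨B, -, rfl⟩ := List.mem_map.1 hy
  split_ifs <;> norm_num

theorem splitCount_succ (n : ℕ) (T T' : CTree N) : S.splitCount (n + 1) T T' =
    (T.sons.map fun A => (T'.sons.map fun B => S.splitCount n A B).sum).sum := by
  unfold splitCount
  simp only [CTree.cut, List.sum_map_flatMap']
  refine congrArg _ (List.map_congr_left fun A _ => ?_)
  rw [List.sum_map_sum_map_comm]

theorem length_sons_le (T : CTree N) : T.sons.length ≤ 2 := by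
  cases T <;> simp [CTree.sons]

/-- A split replaces one block by at most four, which adds at most three leaves to the block tree.
-/
theorem length_blockLeaves_le (L : ℕ) (T T' : CTree N) (hT : T.depth ≤ L) (hT' : T'.depth ≤ L) :
    ((S.blockLeaves T T').length : ℝ) ≤ 1 + 3 * ∑ n ∈ Finset.range L, S.splitCount n T T' := by
  have hnn : ∀ T T', 0 ≤ ∑ n ∈ Finset.range L, S.splitCount n T T' := fun T T' =>
    Finset.sum_nonneg fun n _ => S.splitCount_nonneg n T T'
  induction L generalizing T T' with
  | zero =>
    have : ¬ S.Splits T T' := fun h => h.2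
      ⟨CTree.isLeaf_iff_depth.2 (by omega), CTree.isLeaf_iff_depth.2 (by omega)⟩
    simp [S.blockLeaves_of_not_splits this]
  | succ L ih =>
    by_cases h : S.Splits T T'
    swap
    · rw [S.blockLeaves_of_not_splits h]
      have := hnn T T'
      simp only [List.length_singleton, Nat.cast_one]
      linarith
    have h0 : S.splitCount 0 T T' = 1 := by simp [splitCount, CTree.cut, h]
    rw [S.blockLeaves_of_splits h, Finset.sum_range_succ', h0]
    have hlen : ((T.sons.flatMap fun A => T'.sons.flatMap fun B => S.blockLeaves A B).length : ℝ) =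
        (T.sons.map fun A => (T'.sons.map fun B => ((S.blockLeaves A B).length : ℝ)).sum).sum := by
      rw [List.length_flatMap]
      simp only [Nat.cast_list_sum, List.map_map]
      refine congrArg _ (List.map_congr_left fun A _ => ?_)
      simp only [Function.comp, List.length_flatMap, Nat.cast_list_sum, List.map_map]
      rfl
    rw [hlen]
    have hle : (T.sons.map fun A => (T'.sons.map fun B => ((S.blockLeaves A B).length : ℝ)).sum).sum
        ≤ (T.sons.map fun A => (T'.sons.map fun B =>
          (1 + 3 * ∑ n ∈ Finset.range L, S.splitCount n A B)).sum).sum := by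
      refine List.sum_le_sum fun A hA => List.sum_le_sum fun B hB => ?_
      have h1 := CTree.sons_depth hA
      have h2 := CTree.sons_depth hB
      exact ih A B (by omega) (by omega)
        (fun T T' => Finset.sum_nonneg fun n _ => S.splitCount_nonneg n T T')
    refine hle.trans ?_
    simp only [List.sum_map_add, List.sum_map_mul_left, List.map_const', List.sum_replicate,
      nsmul_eq_mul, mul_one]
    have h4 : (T.sons.map fun A => (T'.sons.map fun B =>
        ∑ n ∈ Finset.range L, S.splitCount n A B).sum).sum =
        ∑ n ∈ Finset.range L, S.splitCount (n + 1) T T' := by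
      simp only [splitCount_succ, ← List.finsetSum_sum_map]
    rw [h4]
    have h5 : (T.sons.length : ℝ) * T'.sons.length ≤ 4 := by
      have h1 : (T.sons.length : ℝ) ≤ 2 := by exact_mod_cast length_sons_le T
      have h2 : (T'.sons.length : ℝ) ≤ 2 := by exact_mod_cast length_sons_le T'
      nlinarith [(Nat.cast_nonneg T.sons.length : (0:ℝ) ≤ _),
        (Nat.cast_nonneg T'.sons.length : (0:ℝ) ≤ _)]
    linarith

theorem mem_blockLeaves_cases (T T' : CTree N) : ∀ b ∈ S.blockLeaves T T',
    S.Admissible b.1 b.2 ∨ (b.1 ∈ T.leaves ∧ b.2 ∈ T'.leaves) := by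
  have hsub : ∀ T A : CTree N, A ∈ T.sons → ∀ Z ∈ A.leaves, Z ∈ T.leaves := by
    intro T A hA Z hZ
    cases T with
    | leaf X => simp only [CTree.sons, List.mem_singleton] at hA; exact hA ▸ hZ
    | node X l r =>
      simp only [CTree.sons, List.mem_cons, List.not_mem_nil, or_false] at hA
      rcases hA with rfl | rfl <;> simp [CTree.leaves, hZ]
  have hleaf : ∀ T : CTree N, T.IsLeaf → T.pts ∈ T.leaves := by
    intro T hT
    cases T <;> simp_all [CTree.IsLeaf, CTree.leaves]
  induction T, T' using S.block_induction with
  | h₁ T T' h =>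
    rw [S.blockLeaves_of_not_splits h]
    intro b hb
    rw [List.mem_singleton] at hb
    subst hb
    unfold Splits at h
    by_cases ha : S.Admissible T.pts T'.pts
    · exact Or.inl ha
    · have : T.IsLeaf ∧ T'.IsLeaf := by tauto
      exact Or.inr ⟨hleaf _ this.1, hleaf _ this.2⟩
  | h₂ T T' h ih =>
    rw [S.blockLeaves_of_splits h]
    intro b hb
    simp only [List.mem_flatMap] at hb
    obtain ⟨A, hA, B, hB, hb⟩ := hb
    exact (ih A hA B hB b hb).imp id fun h => ⟨hsub _ _ hA _ h.1, hsub _ _ hB _ h.2⟩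

end H2Data

-- Overlaps of intervals and separated points

/-- When [a, b] is cut at m, the lengths of the overlaps with [c, e] add up to at most the old one;
the one-dimensional core of the volume argument in `sum_large_le`. -/
theorem overlap_add_overlap_le {a m b c e : ℝ} (h₁ : a ≤ m) (h₂ : m ≤ b) :
    max 0 (min m e - max a c) + max 0 (min b e - max m c) ≤ max 0 (min b e - max a c) := by
  rcases le_total m c with h | h
  · have h1 : max 0 (min m e - max a c) = 0 := by
      refine max_eq_left ?_
      have := min_le_left m e
      have := le_max_right a c
      linarith
    rw [h1, zero_add, max_eq_right h, max_eq_right (h₁.trans h)]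
  · rcases le_total e m with h' | h'
    · have h1 : max 0 (min b e - max m c) = 0 := by
        refine max_eq_left ?_
        have := min_le_right b e
        have := le_max_left m c
        linarith
      rw [h1, add_zero, min_eq_right h', min_eq_right (h'.trans h₂)]
    · rw [min_eq_left h', max_eq_left h]
      have h4 : m ≤ min b e := le_min h₂ h'
      have h5 : max a c ≤ m := max_le h₁ h
      rw [max_eq_right (by linarith : 0 ≤ m - max a c), max_eq_right (by linarith : 0 ≤ min b e - m)]
      exact le_max_of_le_right (by linarith)

theorem dist_le_of_forall_abs_sub_le {d : ℕ} {y z : Pt d} {b : ℝ} (hb : 0 ≤ b)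
    (h : ∀ j, |y j - z j| ≤ b) : dist y z ≤ d * b := by
  rw [EuclideanSpace.dist_eq]
  refine Real.sqrt_le_iff.2 ⟨by positivity, ?_⟩
  calc ∑ j, dist (y j) (z j) ^ 2 ≤ ∑ _j : Fin d, b ^ 2 :=
        Finset.sum_le_sum fun j _ => pow_le_pow_left₀ dist_nonneg (h j) 2
    _ = d * b ^ 2 := by simp
    _ ≤ (d * b) ^ 2 := by
        rw [mul_pow]
        refine mul_le_mul_of_nonneg_right ?_ (by positivity)
        rcases Nat.eq_zero_or_pos d with rfl | hd
        · simp
        · have : (1 : ℝ) ≤ d := by exact_mod_cast hd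
          nlinarith

theorem abs_sub_le_dist {d : ℕ} (y z : Pt d) (j : Fin d) : |y j - z j| ≤ dist y z := by
  rw [dist_eq_norm, ← Real.norm_eq_abs]
  exact PiLp.norm_apply_le (y - z) j

/-- Separated points in a cube: there are at most as many as there are cells of side `h`. -/
theorem card_le_of_separated {d N : ℕ} (x : Fin N → Pt d) {h : ℝ} (hh : 0 < h)
    (hsep : ∀ i i', i ≠ i' → d * h < dist (x i) (x i')) (w : Fin d → ℝ) {r : ℝ} (hr : 0 ≤ r)
    (s : Finset (Fin N)) (hs : ∀ i ∈ s, ∀ j, |x i j - w j| ≤ r) :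
    (s.card : ℝ) ≤ (2 * r / h + 1) ^ d := by
  set M := ⌊2 * r / h⌋₊ + 1 with hM
  have hcard : s.card ≤ (Fintype.piFinset fun _ : Fin d => Finset.range M).card := by
    refine Finset.card_le_card_of_injOn (fun i j => ⌊(x i j - w j + r) / h⌋₊) ?_ ?_
    · intro i hi
      rw [Finset.mem_coe, Fintype.mem_piFinset]
      intro j
      rw [Finset.mem_range, hM, Nat.lt_succ_iff]
      refine Nat.floor_le_floor ?_
      have := (abs_le.1 (hs i hi j)).2
      gcongr
      linarith
    · intro i hi i' hi' he
      -- Points in the same cell differ by at most h in each coordinate, hence have distance at most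
      -- dh.
      by_contra hne
      refine absurd (hsep i i' hne) (not_lt.2 (dist_le_of_forall_abs_sub_le hh.le fun j => ?_))
      have h1 := congrFun he j
      simp only at h1
      have p1 : 0 ≤ (x i j - w j + r) / h :=
        div_nonneg (by linarith [(abs_le.1 (hs i hi j)).1]) hh.le
      have p2 : 0 ≤ (x i' j - w j + r) / h :=
        div_nonneg (by linarith [(abs_le.1 (hs i' hi' j)).1]) hh.le
      have a1 := Nat.floor_le p1
      have a2 := Nat.lt_floor_add_one ((x i j - w j + r) / h)
      have b1 := Nat.floor_le p2
      have b2 := Nat.lt_floor_add_one ((x i' j - w j + r) / h)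
      rw [h1] at a1 a2
      rw [le_div_iff₀ hh] at a1 b1
      rw [div_lt_iff₀ hh] at a2 b2
      rw [abs_le]
      constructor <;> nlinarith
  have hc2 : (Fintype.piFinset fun _ : Fin d => Finset.range M).card = M ^ d := by simp
  rw [hc2] at hcard
  calc (s.card : ℝ) ≤ (M : ℝ) ^ d := by exact_mod_cast hcard
    _ ≤ _ := by
      gcongr
      rw [hM]; push_cast
      gcongr
      exact Nat.floor_le (by positivity)

namespace H2Data

variable {d N : ℕ} (S : H2Data d N)

/-! ### Sizes of clusters -/

/-- The longest edge of the bounding box. -/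
def edge (X : Finset (Fin N)) : ℝ := 2 * S.half X (S.dir X)

/-- The sons of the inner clusters are those obtained by halving the bounding boxes. -/
def Geometric : CTree N → Prop
  | .leaf _ => True
  | .node X l r => l.pts = S.lowerSon X ∧ r.pts = S.upperSon X ∧ 1 < X.card ∧
      Geometric l ∧ Geometric r

theorem geometric_build (hC : 1 ≤ S.Cleaf) (n : ℕ) (X : Finset (Fin N)) :
    S.Geometric (S.build n X) := by
  induction n generalizing X with
  | zero => trivial
  | succ n ih =>
    rw [build]
    split_ifs with h
    · trivial
    · exact ⟨S.pts_build _ _, S.pts_build _ _, by omega, ih _, ih _⟩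

theorem edge_nonneg {X : Finset (Fin N)} (hX : X.Nonempty) : 0 ≤ S.edge X :=
  mul_nonneg zero_le_two (S.half_nonneg hX _)

theorem hi_sub_lo_dir (X : Finset (Fin N)) : S.hi X (S.dir X) - S.lo X (S.dir X) = S.edge X := by
  unfold edge half; ring

theorem hi_sub_lo_le_edge (hS : S.SplitsLongestEdge) {X : Finset (Fin N)} (hX : X.Nonempty)
    (j : Fin d) : S.hi X j - S.lo X j ≤ S.edge X := by
  have := hS X hX j
  unfold edge; unfold half at *; linarith

theorem edge_mono (hS : S.SplitsLongestEdge) {X X' : Finset (Fin N)} (h : X' ⊆ X)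
    (hX' : X'.Nonempty) : S.edge X' ≤ S.edge X := by
  have h1 := hS X (hX'.mono h) (S.dir X')
  have h2 := S.half_mono h hX' (S.dir X')
  unfold edge; linarith

theorem abs_sub_le_edge (hS : S.SplitsLongestEdge) {X : Finset (Fin N)} {y z : Pt d}
    (hX : X.Nonempty) (hy : y ∈ S.box X) (hz : z ∈ S.box X) (j : Fin d) :
    |y j - z j| ≤ S.edge X := by
  have := S.hi_sub_lo_le_edge hS hX j
  rw [abs_le]
  constructor <;> linarith [(hy j).1, (hy j).2, (hz j).1, (hz j).2]

theorem diam_box_le_edge (hS : S.SplitsLongestEdge) {X : Finset (Fin N)} (hX : X.Nonempty) :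
    Metric.diam (S.box X) ≤ d * S.edge X :=
  Metric.diam_le_of_forall_dist_le (by have := S.edge_nonneg hX; positivity) fun _ hy _ hz =>
    dist_le_of_forall_abs_sub_le (S.edge_nonneg hX) (S.abs_sub_le_edge hS hX hy hz)

/-- A fattened volume of the bounding box. -/
def fatVol (X : Finset (Fin N)) : ℝ := ∏ j, max (S.hi X j - S.lo X j) (S.edge X / 2)

theorem fatVol_le (hS : S.SplitsLongestEdge) {X : Finset (Fin N)} (hX : X.Nonempty) :
    S.fatVol X ≤ S.edge X ^ d := by
  have h0 := S.edge_nonneg hX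
  calc S.fatVol X ≤ ∏ _j : Fin d, S.edge X :=
        Finset.prod_le_prod (fun _ _ => le_max_of_le_right (by linarith))
          fun j _ => max_le (S.hi_sub_lo_le_edge hS hX j) (by linarith)
    _ = _ := by simp

theorem edge_pow_le_fatVol {X : Finset (Fin N)} (hX : X.Nonempty) :
    (S.edge X / 2) ^ d ≤ S.fatVol X := by
  have h0 := S.edge_nonneg hX
  calc (S.edge X / 2) ^ d = ∏ _j : Fin d, S.edge X / 2 := by
        rw [Finset.prod_const, Finset.card_univ, Fintype.card_fin]
    _ ≤ _ := Finset.prod_le_prod (fun _ _ => by linarith) fun j _ => le_max_right _ _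

theorem fatVol_nonneg {X : Finset (Fin N)} (hX : X.Nonempty) : 0 ≤ S.fatVol X :=
  le_trans (by have := S.edge_nonneg hX; positivity) (S.edge_pow_le_fatVol hX)

/-- The true volume of a box may vanish. With all edges fattened to at least half the longest one,
the volume is comparable to the d-th power of that edge and still halves at each split: the split
direction loses half and the other factors do not grow. -/
theorem fatVol_le_half (hS : S.SplitsLongestEdge) {X X' : Finset (Fin N)} (h : X' ⊆ X)
    (hX' : X'.Nonempty) (hcut : S.hi X' (S.dir X) - S.lo X' (S.dir X) ≤ S.edge X / 2) :
    S.fatVol X' ≤ S.fatVol X / 2 := by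
  have h0 := S.edge_nonneg hX'
  have he := S.edge_mono hS h hX'
  have hf : ∀ j, 0 ≤ max (S.hi X j - S.lo X j) (S.edge X / 2) := fun j =>
    le_max_of_le_right (by linarith)
  unfold fatVol
  rw [← Finset.mul_prod_erase _ _ (Finset.mem_univ (S.dir X)),
    ← Finset.mul_prod_erase _ (fun j => max (S.hi X j - S.lo X j) (S.edge X / 2))
      (Finset.mem_univ (S.dir X)), S.hi_sub_lo_dir, max_eq_left (by linarith : S.edge X / 2 ≤ _),
    mul_div_right_comm]
  refine mul_le_mul (max_le hcut (by linarith)) ?_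
    (Finset.prod_nonneg fun _ _ => le_max_of_le_right (by linarith)) (by linarith)
  refine Finset.prod_le_prod (fun _ _ => le_max_of_le_right (by linarith)) fun j _ => ?_
  refine max_le_max ?_ (by linarith)
  linarith [S.lo_mono h hX' j, S.hi_mono h hX' j]

theorem hi_lowerSon_le {X : Finset (Fin N)} (h : (S.lowerSon X).Nonempty) :
    S.hi (S.lowerSon X) (S.dir X) ≤ S.mid X (S.dir X) := by
  obtain ⟨i, hi, e⟩ := S.exists_eq_hi h (S.dir X)
  rw [← e]
  exact (Finset.mem_filter.1 hi).2

theorem le_lo_upperSon {X : Finset (Fin N)} (h : (S.upperSon X).Nonempty) :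
    S.mid X (S.dir X) ≤ S.lo (S.upperSon X) (S.dir X) := by
  obtain ⟨i, hi, e⟩ := S.exists_eq_lo h (S.dir X)
  rw [← e]
  obtain ⟨h1, h2⟩ := Finset.mem_sdiff.1 hi
  by_contra hlt
  exact h2 (Finset.mem_filter.2 ⟨h1, (not_le.1 hlt).le⟩)

theorem mid_dir (X : Finset (Fin N)) : S.mid X (S.dir X) = S.lo X (S.dir X) + S.edge X / 2 ∧
    S.mid X (S.dir X) = S.hi X (S.dir X) - S.edge X / 2 := by
  unfold mid edge half
  constructor <;> ring

theorem fatVol_sons (hS : S.SplitsLongestEdge) {X : Finset (Fin N)} {l r : CTree N}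
    (hT : (CTree.node X l r).WF) (hG : S.Geometric (CTree.node X l r)) :
    S.fatVol l.pts ≤ S.fatVol X / 2 ∧ S.fatVol r.pts ≤ S.fatVol X / 2 := by
  obtain ⟨-, -, h3, h4⟩ := hT
  obtain ⟨g1, g2, -, -, -⟩ := hG
  have hl := h3.nonempty
  have hr := h4.nonempty
  rw [g1] at hl ⊢
  rw [g2] at hr ⊢
  have hm := S.mid_dir X
  constructor
  · refine S.fatVol_le_half hS (S.lowerSon_subset X) hl ?_
    linarith [S.hi_lowerSon_le hl, S.lo_mono (S.lowerSon_subset X) hl (S.dir X)]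
  · refine S.fatVol_le_half hS (S.upperSon_subset X) hr ?_
    linarith [S.le_lo_upperSon hr, S.hi_mono (S.upperSon_subset X) hr (S.dir X)]

theorem sum_leaves_fatVol_le (hS : S.SplitsLongestEdge) {T : CTree N} (hT : T.WF)
    (hG : S.Geometric T) : (T.leaves.map S.fatVol).sum ≤ S.fatVol T.pts := by
  induction T with
  | leaf X => simp [CTree.leaves]
  | node X l r ihl ihr =>
    obtain ⟨h1, h2⟩ := S.fatVol_sons hS hT hG
    have := ihl hT.2.2.1 hG.2.2.2.1
    have := ihr hT.2.2.2 hG.2.2.2.2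
    rw [CTree.leaves, List.map_append, List.sum_append, CTree.pts_node]
    linarith

/-- An inner cluster of the cut really lies n splits below the root, whereas a leaf may stem from an
earlier level. -/
theorem fatVol_cut_le (hS : S.SplitsLongestEdge) {T : CTree N} (hT : T.WF)
    (hG : S.Geometric T) {n : ℕ} {A : CTree N} (hA : A ∈ T.cut n) (hA' : ¬ A.IsLeaf) :
    S.fatVol A.pts * 2 ^ n ≤ S.fatVol T.pts := by
  induction n generalizing T with
  | zero => simp only [CTree.cut, List.mem_singleton] at hA; subst hA; simp
  | succ n ih =>
    cases T with
    | leaf X =>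
      rw [CTree.cut_leaf, List.mem_singleton] at hA
      subst hA
      exact absurd trivial hA'
    | node X l r =>
      obtain ⟨h1, h2⟩ := S.fatVol_sons hS hT hG
      rw [CTree.cut_succ_node, List.mem_append] at hA
      rw [pow_succ, ← mul_assoc, CTree.pts_node]
      rcases hA with hA | hA
      · have := ih hT.2.2.1 hG.2.2.2.1 hA; linarith
      · have := ih hT.2.2.2 hG.2.2.2.2 hA; linarith

/-! ### Large clusters of one level near a point -/

-- A volume argument. Bounding boxes may be flat, so each cluster gets a cell with sides [a j, b j],
-- cut at the same midplanes but not shrunk to the points; all its edges have at least half the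
-- length of the longest edge of the cluster. A cell of a large cluster near `w` shares with the
-- cube of half width s + r about `w` a box of volume at least (r/2)^d, and these overlaps are
-- superadditive under cutting.
open Classical in
theorem sum_large_le (hS : S.SplitsLongestEdge) (w : Fin d → ℝ) {r s : ℝ} (hr : 0 ≤ r)
    (hs : 0 ≤ s) (n : ℕ) {T : CTree N} (hT : T.WF) (hG : S.Geometric T) (a b : Fin d → ℝ)
    (ha : ∀ j, a j ≤ S.lo T.pts j) (hb : ∀ j, S.hi T.pts j ≤ b j)
    (hab : ∀ j, S.edge T.pts / 2 ≤ b j - a j) :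
    (r / 2) ^ d * ((T.cut n).map fun B => if r ≤ S.edge B.pts ∧
      (∃ z ∈ S.box B.pts, ∀ j, |z j - w j| ≤ s) then (1 : ℝ) else 0).sum ≤
      ∏ j, max 0 (min (b j) (w j + (s + r)) - max (a j) (w j - (s + r))) := by
  have hone : ∀ (T : CTree N) (a b : Fin d → ℝ), (∀ j, a j ≤ S.lo T.pts j) →
      (∀ j, S.hi T.pts j ≤ b j) → (∀ j, S.edge T.pts / 2 ≤ b j - a j) →
      (r / 2) ^ d * (if r ≤ S.edge T.pts ∧
        (∃ z ∈ S.box T.pts, ∀ j, |z j - w j| ≤ s) then (1 : ℝ) else 0) ≤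
      ∏ j, max 0 (min (b j) (w j + (s + r)) - max (a j) (w j - (s + r))) := by
    intro T a b ha hb hab
    split_ifs with h
    swap
    · rw [mul_zero]; exact Finset.prod_nonneg fun _ _ => le_max_left _ _
    obtain ⟨h1, z, hz, hzw⟩ := h
    rw [mul_one]
    calc (r / 2) ^ d = ∏ _j : Fin d, r / 2 := by
          rw [Finset.prod_const, Finset.card_univ, Fintype.card_fin]
      _ ≤ _ := Finset.prod_le_prod (fun _ _ => by linarith) fun j _ => ?_
    refine le_max_of_le_right ?_
    have q1 := (hz j).1
    have q2 := (hz j).2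
    obtain ⟨q3, q4⟩ := abs_le.1 (hzw j)
    have := ha j
    have := hb j
    have := hab j
    rw [le_sub_iff_add_le]
    refine le_min ?_ ?_
    · rw [← le_sub_iff_add_le']
      refine max_le ?_ ?_ <;> linarith
    · rw [← le_sub_iff_add_le']
      refine max_le ?_ ?_ <;> linarith
  induction n generalizing T a b with
  | zero => simpa [CTree.cut] using hone T a b ha hb hab
  | succ n ih =>
    cases T with
    | leaf X => simpa using hone _ a b ha hb hab
    | node X l r' =>
      obtain ⟨-, -, h3, h4⟩ := hT
      obtain ⟨g1, g2, -, g4, g5⟩ := hG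
      have hl := h3.nonempty
      have hr' := h4.nonempty
      rw [g1] at hl
      rw [g2] at hr'
      simp only [CTree.pts_node] at ha hb hab
      obtain ⟨m1, m2⟩ := S.mid_dir X
      set k := S.dir X with hk
      set m := S.mid X k with hm
      have hel : S.edge l.pts ≤ S.edge X := g1 ▸ S.edge_mono hS (S.lowerSon_subset X) hl
      have her : S.edge r'.pts ≤ S.edge X := g2 ▸ S.edge_mono hS (S.upperSon_subset X) hr'
      have hE : 0 ≤ S.edge X := (S.edge_nonneg h3.nonempty).trans hel
      have i1 := ih h3 g4 a (Function.update b k m)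
        (fun j => (ha j).trans (g1 ▸ S.lo_mono (S.lowerSon_subset X) hl j))
        (fun j => by
          by_cases h : j = k
          · subst h; rw [Function.update_self, g1]; exact S.hi_lowerSon_le hl
          · rw [Function.update_of_ne h, g1]
            exact (S.hi_mono (S.lowerSon_subset X) hl j).trans (hb j))
        (fun j => by
          by_cases h : j = k
          · subst h; rw [Function.update_self]; linarith [ha (S.dir X)]
          · rw [Function.update_of_ne h]; linarith [hab j])
      have i2 := ih h4 g5 (Function.update a k m) b
        (fun j => by
          by_cases h : j = k
          · subst h; rw [Function.update_self, g2]; exact S.le_lo_upperSon hr'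
          · rw [Function.update_of_ne h, g2]
            exact (ha j).trans (S.lo_mono (S.upperSon_subset X) hr' j))
        (fun j => (g2 ▸ S.hi_mono (S.upperSon_subset X) hr' j : S.hi r'.pts j ≤ _).trans (hb j))
        (fun j => by
          by_cases h : j = k
          · subst h; rw [Function.update_self]; linarith [hb (S.dir X)]
          · rw [Function.update_of_ne h]; linarith [hab j])
      rw [CTree.cut_succ_node, List.map_append, List.sum_append, mul_add]
      refine (add_le_add i1 i2).trans ?_
      rw [← Finset.mul_prod_erase _ _ (Finset.mem_univ k),
        ← Finset.mul_prod_erase _ (fun j => max 0 (min (b j) (w j + (s + r)) -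
          max (Function.update a k m j) (w j - (s + r)))) (Finset.mem_univ k),
        ← Finset.mul_prod_erase _ (fun j => max 0 (min (b j) (w j + (s + r)) -
          max (a j) (w j - (s + r)))) (Finset.mem_univ k)]
      have e1 : ∏ j ∈ Finset.univ.erase k, max 0 (min (Function.update b k m j) (w j + (s + r)) -
          max (a j) (w j - (s + r))) = ∏ j ∈ Finset.univ.erase k,
          max 0 (min (b j) (w j + (s + r)) - max (a j) (w j - (s + r))) :=
        Finset.prod_congr rfl fun j hj => by
          rw [Function.update_of_ne (Finset.ne_of_mem_erase hj)]
      have e2 : ∏ j ∈ Finset.univ.erase k, max 0 (min (b j) (w j + (s + r)) -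
          max (Function.update a k m j) (w j - (s + r))) = ∏ j ∈ Finset.univ.erase k,
          max 0 (min (b j) (w j + (s + r)) - max (a j) (w j - (s + r))) :=
        Finset.prod_congr rfl fun j hj => by
          rw [Function.update_of_ne (Finset.ne_of_mem_erase hj)]
      rw [e1, e2, ← add_mul, Function.update_self, Function.update_self]
      refine mul_le_mul_of_nonneg_right ?_ (Finset.prod_nonneg fun _ _ => le_max_left _ _)
      exact overlap_add_overlap_le (by linarith [ha k]) (by linarith [hb k])

open Classical in
/-- The number of clusters of one level with size at least `r` that come close to a point is
bounded independently of the level. -/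
theorem sum_large_le_pow (hS : S.SplitsLongestEdge) (w : Fin d → ℝ) {r s : ℝ} (hr : 0 < r)
    (hs : 0 ≤ s) (n : ℕ) {T : CTree N} (hT : T.WF) (hG : S.Geometric T) :
    ((T.cut n).map fun B => if r ≤ S.edge B.pts ∧
      (∃ z ∈ S.box B.pts, ∀ j, |z j - w j| ≤ s) then (1 : ℝ) else 0).sum ≤
      (4 * (s + r) / r) ^ d := by
  have he := S.edge_nonneg hT.nonempty
  -- The cell of the root is its box enlarged downwards by the longest edge, which makes it thick in
  -- every direction.
  have h := S.sum_large_le hS w hr.le hs n hT hG (fun j => S.lo T.pts j - S.edge T.pts)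
    (fun j => S.hi T.pts j) (fun j => by linarith) (fun j => le_rfl)
    (fun j => by linarith [S.lo_le_hi hT.nonempty j])
  have h2 : ∏ j, max 0 (min (S.hi T.pts j) (w j + (s + r)) -
      max (S.lo T.pts j - S.edge T.pts) (w j - (s + r))) ≤ (2 * (s + r)) ^ d := by
    calc _ ≤ ∏ _j : Fin d, 2 * (s + r) := by
          refine Finset.prod_le_prod (fun _ _ => le_max_left _ _) fun j _ => ?_
          refine max_le (by linarith) ?_
          linarith [min_le_right (S.hi T.pts j) (w j + (s + r)),
            le_max_right (S.lo T.pts j - S.edge T.pts) (w j - (s + r))]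
      _ = _ := by simp
  have h3 := h.trans h2
  rw [mul_comm, ← le_div_iff₀ (by positivity), ← div_pow] at h3
  refine h3.trans (le_of_eq ?_)
  congr 1
  field_simp
  ring

end H2Data

/-- A geometric sum with ratio √2 ≥ 7/5. The auxiliary bound by √(2^L) reproduces itself because 5/2
+ 1 = (5/2)(7/5), and gives the bound by √K at each index with 2^L ≤ K. -/
theorem sum_sqrt_two_pow_le {K : ℝ} (L : ℕ) :
    ∑ n ∈ Finset.range L, (if (2 : ℝ) ^ n ≤ K then Real.sqrt (2 ^ n) else 0) ≤
      7 / 2 * Real.sqrt K := by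
  have h2 : (7 / 5 : ℝ) ≤ Real.sqrt 2 := Real.le_sqrt_of_sq_le (by norm_num)
  suffices h : ∑ n ∈ Finset.range L, (if (2 : ℝ) ^ n ≤ K then Real.sqrt (2 ^ n) else 0) ≤
      5 / 2 * Real.sqrt (2 ^ L) ∧
      ∑ n ∈ Finset.range L, (if (2 : ℝ) ^ n ≤ K then Real.sqrt (2 ^ n) else 0) ≤
      7 / 2 * Real.sqrt K from h.2
  induction L with
  | zero => norm_num
  | succ L ih =>
    obtain ⟨h3, h4⟩ := ih
    rw [Finset.sum_range_succ, pow_succ, Real.sqrt_mul (by positivity)]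
    have h5 : 0 ≤ Real.sqrt ((2 : ℝ) ^ L) := Real.sqrt_nonneg _
    have h7 := mul_le_mul_of_nonneg_left h2 h5
    split_ifs with h
    · have h6 := Real.sqrt_le_sqrt h
      constructor <;> linarith
    · constructor <;> linarith

namespace H2Data

variable {d N : ℕ} (S : H2Data d N)

/-! ### The number of blocks is linear in the number of points -/

theorem le_edge_of_one_lt_card (hS : S.SplitsLongestEdge) {h : ℝ} (hd : 1 ≤ d)
    (hsep : ∀ i i', i ≠ i' → d * h < dist (S.x i) (S.x i')) {X : Finset (Fin N)}
    (hX : 1 < X.card) : h ≤ S.edge X := by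
  obtain ⟨i, hi, j, hj, hij⟩ := Finset.one_lt_card.1 hX
  have hne : X.Nonempty := ⟨i, hi⟩
  have h1 := (hsep i j hij).trans_le (dist_le_of_forall_abs_sub_le (S.edge_nonneg hne)
    (S.abs_sub_le_edge hS hne (S.x_mem_box hi) (S.x_mem_box hj)))
  have hd0 : (0 : ℝ) < d := by exact_mod_cast hd
  exact (lt_of_mul_lt_mul_left h1 hd0.le).le

theorem one_lt_card_of_edge_pos {X : Finset (Fin N)} (hX : X.Nonempty) (h : 0 < S.edge X) :
    1 < X.card := by
  obtain ⟨i, hi, e1⟩ := S.exists_eq_lo hX (S.dir X)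
  obtain ⟨j, hj, e2⟩ := S.exists_eq_hi hX (S.dir X)
  refine Finset.one_lt_card.2 ⟨i, hi, j, hj, ?_⟩
  rintro rfl
  have := S.hi_sub_lo_dir X
  linarith

theorem splits_comm {A B : CTree N} : S.Splits A B ↔ S.Splits B A := by
  unfold Splits
  rw [S.admissible_comm, and_comm (a := A.IsLeaf)]

/-- Both diameters are at most d times the larger edge, so failing admissibility puts the boxes at
distance below (d/η) times that edge. In particular the edge is positive, the cluster has two
points, and their separation gives the lower bound h. -/
theorem Splits.exists_near {S : H2Data d N} (hS : S.SplitsLongestEdge) (hη : 0 < S.η) {h : ℝ}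
    (hd : 1 ≤ d) (hsep : ∀ i i', i ≠ i' → d * h < dist (S.x i) (S.x i')) {A B : CTree N}
    (hA : A.WF) (hB : B.WF) (hAB : S.Splits A B) (hle : S.edge A.pts ≤ S.edge B.pts) :
    h ≤ S.edge B.pts ∧ ∃ y ∈ S.box A.pts, ∃ z ∈ S.box B.pts,
      ∀ j, |y j - z j| ≤ d / S.η * S.edge B.pts := by
  have hd0 : (0 : ℝ) < d := by exact_mod_cast hd
  have h1 : S.η * S.boxDist A.pts B.pts < d * S.edge B.pts := by
    refine (not_le.1 hAB.1).trans_le (max_le ?_ (S.diam_box_le_edge hS hB.nonempty))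
    exact (S.diam_box_le_edge hS hA.nonempty).trans (by gcongr)
  have h2 : S.boxDist A.pts B.pts < d / S.η * S.edge B.pts := by
    rw [div_mul_eq_mul_div, lt_div_iff₀ hη]; linarith
  obtain ⟨i, hi⟩ := hA.nonempty
  obtain ⟨i', hi'⟩ := hB.nonempty
  have : Nonempty (S.box A.pts × S.box B.pts) := ⟨⟨_, S.x_mem_box hi⟩, ⟨_, S.x_mem_box hi'⟩⟩
  have h0 : 0 ≤ S.boxDist A.pts B.pts := Real.iInf_nonneg fun _ => dist_nonneg
  obtain ⟨⟨y, z⟩, hyz⟩ := exists_lt_of_ciInf_lt h2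
  refine ⟨?_, y, y.2, z, z.2, fun j => (abs_sub_le_dist _ _ j).trans hyz.le⟩
  refine S.le_edge_of_one_lt_card hS hd hsep (S.one_lt_card_of_edge_pos hB.nonempty ?_)
  have : 0 < d / S.η * S.edge B.pts := h0.trans_lt h2
  exact pos_of_mul_pos_right this (by positivity)

open Classical in
/-- Indices of the points in a cube. -/
def inCube (w : Fin d → ℝ) (r : ℝ) : Finset (Fin N) :=
  Finset.univ.filter fun i => ∀ j, |S.x i j - w j| ≤ r

theorem mem_inCube {w : Fin d → ℝ} {r : ℝ} {i : Fin N} :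
    i ∈ S.inCube w r ↔ ∀ j, |S.x i j - w j| ≤ r := by simp [inCube]

theorem card_inCube_le {h : ℝ} (hh : 0 < h)
    (hsep : ∀ i i', i ≠ i' → d * h < dist (S.x i) (S.x i')) (w : Fin d → ℝ) {c r : ℝ} (hc : 0 ≤ c)
    (hr : h ≤ r) : ((S.inCube w ((c + 2) * r)).card : ℝ) ≤ ((2 * c + 5) * (r / h)) ^ d := by
  have hr0 : 0 < r := hh.trans_le hr
  refine (card_le_of_separated S.x hh hsep w (by positivity) _
    fun i hi => S.mem_inCube.1 hi).trans ?_
  refine pow_le_pow_left₀ (by positivity) ?_ d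
  have : 1 ≤ r / h := by rwa [le_div_iff₀ hh, one_mul]
  have e : 2 * ((c + 2) * r) / h = 2 * (c + 2) * (r / h) := by ring
  rw [e]
  linarith

open Classical in
/-- Blocks of an inner cluster and a leaf that is not smaller. -/
theorem sum_splits_leaf_le (hS : S.SplitsLongestEdge) (hη : 0 < S.η) {h : ℝ} (hh : 0 < h)
    (hd : 1 ≤ d) (hsep : ∀ i i', i ≠ i' → d * h < dist (S.x i) (S.x i')) {T : CTree N}
    (hT : T.WF) (hG : S.Geometric T) (L : ℕ) :
    ∑ n ∈ Finset.range L, ((T.cut n).map fun A => ((T.cut n).map fun B =>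
      if (S.Splits A B ∧ S.edge A.pts ≤ S.edge B.pts) ∧ B.IsLeaf then (1 : ℝ) else 0).sum).sum ≤
      (2 * (d / S.η) + 5) ^ d * (2 * S.edge T.pts / h) ^ d := by
  set c := d / S.η with hc
  have hc0 : 0 ≤ c := by positivity
  -- The condition is relaxed to one without reference to levels: `Y` lies in a cube of size
  -- comparable to `Z`. The sum over levels can then be replaced by a sum over all inner clusters
  -- `Y`.
  set F : Finset (Fin N) → Finset (Fin N) → ℝ := fun Y Z =>
    if h ≤ S.edge Z ∧ Y ⊆ S.inCube (S.lo Z) ((c + 2) * S.edge Z) then 1 else 0 with hF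
  have hF0 : ∀ Y Z, 0 ≤ F Y Z := fun Y Z => by simp only [hF]; split_ifs <;> norm_num
  have hpt : ∀ n, ∀ A ∈ T.cut n, ∀ B ∈ T.cut n,
      (if (S.Splits A B ∧ S.edge A.pts ≤ S.edge B.pts) ∧ B.IsLeaf then (1 : ℝ) else 0) ≤
      if B.IsLeaf then (fun Z => if A.IsLeaf then 0 else F A.pts Z) B.pts else 0 := by
    intro n A hA B hB
    by_cases hBl : B.IsLeaf
    swap
    · simp [hBl]
    rw [if_pos hBl]
    simp only
    by_cases hP : S.Splits A B ∧ S.edge A.pts ≤ S.edge B.pts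
    swap
    · rw [if_neg (by tauto)]
      split_ifs
      exacts [le_rfl, hF0 _ _]
    have hAl : ¬ A.IsLeaf := fun h' => hP.1.2 ⟨h', hBl⟩
    have hAw := hT.cut hA
    have hBw := hT.cut hB
    obtain ⟨h1, y, hy, z, hz, hyz⟩ := hP.1.exists_near hS hη hd hsep hAw hBw hP.2
    rw [if_pos ⟨hP, hBl⟩, if_neg hAl]
    simp only [hF]
    rw [if_pos]
    refine ⟨h1, fun i hi => S.mem_inCube.2 fun j => ?_⟩
    have b1 := S.abs_sub_le_edge hS hAw.nonempty (S.x_mem_box hi) hy j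
    have b2 := hyz j
    have b3 : |z j - S.lo B.pts j| ≤ S.edge B.pts := by
      rw [abs_of_nonneg (by linarith [(hz j).1])]
      linarith [(hz j).2, S.hi_sub_lo_le_edge hS hBw.nonempty j]
    calc |S.x i j - S.lo B.pts j| = |(S.x i j - y j) + (y j - z j) + (z j - S.lo B.pts j)| := by
          congr 1; ring
      _ ≤ |S.x i j - y j| + |y j - z j| + |z j - S.lo B.pts j| := abs_add_three _ _ _
      _ ≤ (c + 2) * S.edge B.pts := by linarith [hP.2]
  -- The inner clusters in the cube are at most as many as its points, a number proportional to the
  -- fattened volume of `Z`; these volumes add up over the leaves.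
  have hleaf : ∀ Z ∈ T.leaves, (T.inner.map fun Y => F Y Z).sum ≤
      ((2 * (2 * c + 5)) / h) ^ d * S.fatVol Z := by
    intro Z hZ
    have hZn : Z.Nonempty := by
      clear hpt hG
      induction T with
      | leaf X =>
        simp only [CTree.leaves, List.mem_singleton] at hZ
        exact hZ ▸ hT
      | node X l r ihl ihr =>
        rcases List.mem_append.1 hZ with h' | h'
        exacts [ihl hT.2.2.1 h', ihr hT.2.2.2 h']
    have hV := S.fatVol_nonneg hZn
    by_cases hZe : h ≤ S.edge Z
    swap
    · simp only [hF, hZe, false_and, if_false]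
      simp only [List.map_const', List.sum_replicate, smul_zero]
      positivity
    · simp only [hF, hZe, true_and]
      refine (CTree.sum_inner_subset_le hT _).trans ?_
      refine (Nat.cast_le.2 (Finset.card_le_card Finset.inter_subset_left)).trans ?_
      refine (S.card_inCube_le hh hsep (S.lo Z) hc0 hZe).trans ?_
      have e : (2 * c + 5) * (S.edge Z / h) = (2 * (2 * c + 5)) / h * (S.edge Z / 2) := by
        field_simp
      rw [e, mul_pow]
      exact mul_le_mul_of_nonneg_left (S.edge_pow_le_fatVol hZn) (by positivity)
  calc _ ≤ ∑ n ∈ Finset.range L, ((T.cut n).map fun A =>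
        (T.leaves.map fun Z => if A.IsLeaf then 0 else F A.pts Z).sum).sum := by
        refine Finset.sum_le_sum fun n _ => List.sum_le_sum fun A hA => ?_
        refine (List.sum_le_sum fun B hB => hpt n A hA B hB).trans ?_
        refine CTree.sum_cut_leaf_le T n (fun Z => if A.IsLeaf then 0 else F A.pts Z) fun Z => ?_
        split_ifs
        exacts [le_rfl, hF0 _ _]
    _ = (T.leaves.map fun Z => ∑ n ∈ Finset.range L, ((T.cut n).map fun A =>
        if A.IsLeaf then 0 else F A.pts Z).sum).sum := by
        rw [← List.finsetSum_sum_map]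
        exact Finset.sum_congr rfl fun n _ => List.sum_map_sum_map_comm _ _ _
    _ ≤ (T.leaves.map fun Z => (T.inner.map fun Y => F Y Z).sum).sum :=
        List.sum_le_sum fun Z _ => CTree.sum_cut_inner_le T L (fun Y => F Y Z) fun Y => hF0 Y Z
    _ ≤ (T.leaves.map fun Z => ((2 * (2 * c + 5)) / h) ^ d * S.fatVol Z).sum :=
        List.sum_le_sum hleaf
    _ = ((2 * (2 * c + 5)) / h) ^ d * (T.leaves.map S.fatVol).sum := List.sum_map_mul_left _ _ _
    _ ≤ ((2 * (2 * c + 5)) / h) ^ d * S.edge T.pts ^ d := by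
        gcongr
        exact (S.sum_leaves_fatVol_le hS hT hG).trans (S.fatVol_le hS hT.nonempty)
    _ = _ := by rw [← mul_pow, ← mul_pow]; congr 1; ring

open Classical in
/-- Blocks of one level in which the larger cluster is not a leaf. -/
theorem sum_splits_inner_le (hS : S.SplitsLongestEdge) (hη : 0 < S.η) {h : ℝ} (hh : 0 < h)
    (hd : 1 ≤ d) (hsep : ∀ i i', i ≠ i' → d * h < dist (S.x i) (S.x i')) {T : CTree N}
    (hT : T.WF) (hG : S.Geometric T) (n : ℕ) :
    ((T.cut n).map fun A => ((T.cut n).map fun B =>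
      if (S.Splits A B ∧ S.edge A.pts ≤ S.edge B.pts) ∧ ¬ B.IsLeaf then (1 : ℝ) else 0).sum).sum ≤
      2 * (4 * (d / S.η) + 8) ^ d * Real.sqrt ((2 * S.edge T.pts / h) ^ d) *
        (if (2 : ℝ) ^ n ≤ (2 * S.edge T.pts / h) ^ d then Real.sqrt (2 ^ n) else 0) := by
  set c := d / S.η with hc
  have hc0 : 0 ≤ c := by positivity
  have hd0 : d ≠ 0 := by omega
  have hE := S.edge_nonneg hT.nonempty
  set K := (2 * S.edge T.pts / h) ^ d with hK
  have hK0 : 0 ≤ K := by positivity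
  -- At level n the fattened volume of an inner cluster is at most 2^(-n) times that of the root.
  have hsize : ∀ B ∈ T.cut n, ¬ B.IsLeaf → S.edge B.pts ^ d ≤ h ^ d * (K / 2 ^ n) := by
    intro B hB hBl
    have h1 := S.fatVol_cut_le hS hT hG hB hBl
    have h2 := S.edge_pow_le_fatVol (hT.cut hB).nonempty
    have h3 := S.fatVol_le hS hT.nonempty
    have h4 : (S.edge B.pts / 2) ^ d * 2 ^ n ≤ S.edge T.pts ^ d :=
      (mul_le_mul_of_nonneg_right h2 (by positivity)).trans (h1.trans h3)
    rw [← mul_div_assoc, le_div_iff₀ (by positivity), hK, ← mul_pow,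
      show h * (2 * S.edge T.pts / h) = 2 * S.edge T.pts by field_simp, mul_pow]
    calc S.edge B.pts ^ d * 2 ^ n = 2 ^ d * ((S.edge B.pts / 2) ^ d * 2 ^ n) := by
          rw [div_pow]; field_simp
      _ ≤ _ := by gcongr
  -- On deeper levels there is nothing to count: the larger cluster of a split block has edge at
  -- least h, which contradicts `hsize`.
  by_cases hn : (2 : ℝ) ^ n ≤ K
  swap
  · rw [if_neg hn, mul_zero]
    refine le_of_eq (List.sum_map_eq_zero _ _ fun A hA => List.sum_map_eq_zero _ _ fun B hB => ?_)
    refine if_neg fun hP => hn ?_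
    have h1 := (hP.1.1.exists_near hS hη hd hsep (hT.cut hA) (hT.cut hB) hP.1.2).1
    have h2 := (pow_le_pow_left₀ hh.le h1 d).trans (hsize B hB hP.2)
    have h3 : 0 < h ^ d := by positivity
    have h4 : 1 ≤ K / 2 ^ n := by
      by_contra hlt
      nlinarith
    rwa [le_div_iff₀ (by positivity), one_mul] at h4
  rw [if_pos hn]
  have hKn : 1 ≤ K / 2 ^ n := by rwa [le_div_iff₀ (by positivity), one_mul]
  -- Relevant sizes range from h to h t², and the threshold ht is their geometric mean. Larger
  -- clusters are counted by volume, about (h t²/(h t))^d of them, and smaller ones by points, about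
  -- (h t/h)^d; both are of order t^d.
  obtain ⟨t, ht0, ht⟩ : ∃ t : ℝ, 0 ≤ t ∧ t ^ d = Real.sqrt (K / 2 ^ n) :=
    ⟨Real.sqrt (K / 2 ^ n) ^ ((d : ℝ)⁻¹), by positivity,
      Real.rpow_inv_natCast_pow (Real.sqrt_nonneg _) hd0⟩
  have ht1 : 1 ≤ t := by
    rw [← one_le_pow_iff_of_nonneg ht0 hd0, ht]
    exact Real.one_le_sqrt.2 hKn
  have hsize' : ∀ B ∈ T.cut n, ¬ B.IsLeaf → S.edge B.pts ≤ h * t ^ 2 := by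
    intro B hB hBl
    rw [← pow_le_pow_iff_left₀ (S.edge_nonneg (hT.cut hB).nonempty) (by positivity) hd0]
    refine (hsize B hB hBl).trans (le_of_eq ?_)
    rw [mul_pow, ← pow_mul, mul_comm 2 d, pow_mul, ht, Real.sq_sqrt (by positivity)]
  have hrow : ∀ A ∈ T.cut n, ((T.cut n).map fun B =>
      if (S.Splits A B ∧ S.edge A.pts ≤ S.edge B.pts) ∧ ¬ B.IsLeaf then (1 : ℝ) else 0).sum ≤
      2 * (4 * c + 8) ^ d * t ^ d := by
    intro A hA
    have hAw := hT.cut hA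
    set w : Fin d → ℝ := S.lo A.pts with hw
    have hht : 0 < h * t := by positivity
    have hbig := S.sum_large_le_pow hS w hht (s := (c + 1) * (h * t ^ 2)) (by positivity) n hT hG
    have hsmall := CTree.sum_cut_subset_le hT (S.inCube w ((c + 2) * (h * t))) n
    have hsmall' := (Nat.cast_le (α := ℝ)).2 (Finset.card_le_card
      (Finset.inter_subset_left (s₁ := S.inCube w ((c + 2) * (h * t))) (s₂ := T.pts)))
    have hcard := S.card_inCube_le hh hsep w hc0 (r := h * t) (by nlinarith)
    have e1 : (4 * ((c + 1) * (h * t ^ 2) + h * t) / (h * t)) ^ d ≤ (4 * c + 8) ^ d * t ^ d := by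
      rw [← mul_pow]
      refine pow_le_pow_left₀ (by positivity) ?_ d
      rw [div_le_iff₀ hht]
      nlinarith [mul_nonneg hht.le (sub_nonneg.2 ht1)]
    have e2 : ((2 * c + 5) * (h * t / h)) ^ d ≤ (4 * c + 8) ^ d * t ^ d := by
      rw [← mul_pow, mul_div_cancel_left₀ _ hh.ne']
      gcongr
      · linarith
      · norm_num
    refine le_trans ?_ (le_trans (add_le_add (hbig.trans e1)
      (hsmall.trans (hsmall'.trans (hcard.trans e2)))) (by linarith))
    rw [← List.sum_map_add]
    refine List.sum_le_sum fun B hB => ?_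
    have hnn : ∀ (p : Prop) [Decidable p], (0 : ℝ) ≤ if p then 1 else 0 := by
      intro p _; split_ifs <;> norm_num
    by_cases hP : (S.Splits A B ∧ S.edge A.pts ≤ S.edge B.pts) ∧ ¬ B.IsLeaf
    swap
    · rw [if_neg hP]
      exact add_nonneg (hnn _) (hnn _)
    rw [if_pos hP]
    have hBw := hT.cut hB
    obtain ⟨h1, y, hy, z, hz, hyz⟩ := hP.1.1.exists_near hS hη hd hsep hAw hBw hP.1.2
    have hzw : ∀ j, |z j - w j| ≤ (c + 1) * S.edge B.pts := by
      intro j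
      have b2 := hyz j
      rw [abs_sub_comm] at b2
      have b3 : |y j - S.lo A.pts j| ≤ S.edge A.pts := by
        rw [abs_of_nonneg (by linarith [(hy j).1])]
        linarith [(hy j).2, S.hi_sub_lo_le_edge hS hAw.nonempty j]
      calc |z j - w j| = |(z j - y j) + (y j - w j)| := by congr 1; ring
        _ ≤ |z j - y j| + |y j - w j| := abs_add_le _ _
        _ ≤ _ := by linarith [hP.1.2]
    by_cases hB' : h * t ≤ S.edge B.pts
    · rw [if_pos ⟨hB', z, hz, fun j => (hzw j).trans (by
        have := hsize' B hB hP.2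
        gcongr)⟩]
      linarith [hnn (B.pts ⊆ S.inCube w ((c + 2) * (h * t)))]
    · have hsub : B.pts ⊆ S.inCube w ((c + 2) * (h * t)) := by
        intro i hi
        refine S.mem_inCube.2 fun j => ?_
        have b1 := S.abs_sub_le_edge hS hBw.nonempty (S.x_mem_box hi) hz j
        calc |S.x i j - w j| = |(S.x i j - z j) + (z j - w j)| := by congr 1; ring
          _ ≤ |S.x i j - z j| + |z j - w j| := abs_add_le _ _
          _ ≤ (c + 2) * S.edge B.pts := by linarith [hzw j]
          _ ≤ _ := by gcongr; exact (not_le.1 hB').le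
      rw [if_pos hsub]
      linarith [hnn (h * t ≤ S.edge B.pts ∧
        ∃ z ∈ S.box B.pts, ∀ j, |z j - w j| ≤ (c + 1) * (h * t ^ 2))]
  have hlen : ((T.cut n).length : ℝ) ≤ 2 ^ n := by exact_mod_cast CTree.length_cut_le n T
  calc _ ≤ ((T.cut n).map fun _ => 2 * (4 * c + 8) ^ d * t ^ d).sum := List.sum_le_sum hrow
    _ = (T.cut n).length * (2 * (4 * c + 8) ^ d * t ^ d) := by simp
    _ ≤ 2 ^ n * (2 * (4 * c + 8) ^ d * t ^ d) := by gcongr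
    _ = _ := by
      rw [ht, Real.sqrt_div hK0]
      have h3 : Real.sqrt ((2 : ℝ) ^ n) ≠ 0 := by positivity
      field_simp
      rw [Real.sq_sqrt (by positivity)]
      ring

/-- By symmetry twice the pairs with edge(A) ≤ edge(B) suffice, and these are divided according to
whether B is a leaf. The two parts contribute 1 and 7, whence 16 = 2(1 + 7). -/
theorem sum_splitCount_le (hS : S.SplitsLongestEdge) (hη : 0 < S.η) {h : ℝ} (hh : 0 < h)
    (hd : 1 ≤ d) (hsep : ∀ i i', i ≠ i' → d * h < dist (S.x i) (S.x i')) {T : CTree N}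
    (hT : T.WF) (hG : S.Geometric T) (L : ℕ) :
    ∑ n ∈ Finset.range L, S.splitCount n T T ≤
      16 * (4 * (d / S.η) + 8) ^ d * (2 * S.edge T.pts / h) ^ d := by
  classical
  have hE := S.edge_nonneg hT.nonempty
  set K := (2 * S.edge T.pts / h) ^ d with hK
  have hK0 : 0 ≤ K := by positivity
  set P : CTree N → CTree N → Prop := fun A B => S.Splits A B ∧ S.edge A.pts ≤ S.edge B.pts
  have h1 : ∀ n, S.splitCount n T T ≤ 2 * ((T.cut n).map fun A => ((T.cut n).map fun B =>
      if P A B then (1 : ℝ) else 0).sum).sum := by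
    intro n
    have hsym : ((T.cut n).map fun A => ((T.cut n).map fun B =>
      if P A B then (1 : ℝ) else 0).sum).sum = ((T.cut n).map fun A => ((T.cut n).map fun B =>
      if P B A then (1 : ℝ) else 0).sum).sum := List.sum_map_sum_map_comm _ _ _
    rw [two_mul]
    conv_rhs => arg 2; rw [hsym]
    rw [← List.sum_map_add]
    simp only [← List.sum_map_add]
    refine List.sum_le_sum fun A _ => List.sum_le_sum fun B _ => ?_
    by_cases hs : S.Splits A B
    · rcases le_total (S.edge A.pts) (S.edge B.pts) with hle | hle
      · rw [if_pos hs, if_pos (⟨hs, hle⟩ : P A B)]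
        split_ifs <;> norm_num
      · rw [if_pos hs, if_pos (⟨S.splits_comm.1 hs, hle⟩ : P B A)]
        split_ifs <;> norm_num
    · rw [if_neg hs]
      split_ifs <;> norm_num
  have h2 : ∀ n, ((T.cut n).map fun A => ((T.cut n).map fun B =>
      if P A B then (1 : ℝ) else 0).sum).sum =
      ((T.cut n).map fun A => ((T.cut n).map fun B =>
        if P A B ∧ B.IsLeaf then (1 : ℝ) else 0).sum).sum +
      ((T.cut n).map fun A => ((T.cut n).map fun B =>
        if P A B ∧ ¬ B.IsLeaf then (1 : ℝ) else 0).sum).sum := by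
    intro n
    rw [← List.sum_map_add]
    simp only [← List.sum_map_add]
    refine congrArg _ (List.map_congr_left fun A _ => congrArg _ (List.map_congr_left fun B _ => ?_))
    by_cases hp : P A B <;> by_cases hl : B.IsLeaf <;> simp [hp, hl]
  have h3 := S.sum_splits_leaf_le hS hη hh hd hsep hT hG L
  have h4 := Finset.sum_le_sum fun n (_ : n ∈ Finset.range L) =>
    S.sum_splits_inner_le hS hη hh hd hsep hT hG n
  rw [← Finset.mul_sum] at h4
  have h5 := sum_sqrt_two_pow_le (K := K) L
  have hc : (0 : ℝ) ≤ d / S.η := by positivity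
  have h6 : (2 * (d / S.η) + 5) ^ d ≤ (4 * (d / S.η) + 8) ^ d := by
    gcongr <;> linarith
  set Q := (4 * (d / S.η) + 8) ^ d
  have hQ : 0 ≤ Q := by positivity
  have h7 : 2 * Q * Real.sqrt K * (7 / 2 * Real.sqrt K) = 7 * Q * K := by
    rw [show 2 * Q * Real.sqrt K * (7 / 2 * Real.sqrt K) =
      7 * Q * (Real.sqrt K * Real.sqrt K) by ring, Real.mul_self_sqrt hK0]
  calc _ ≤ ∑ n ∈ Finset.range L, 2 * ((T.cut n).map fun A => ((T.cut n).map fun B =>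
        if P A B then (1 : ℝ) else 0).sum).sum := Finset.sum_le_sum fun n _ => h1 n
    _ ≤ 2 * (Q * K + 2 * Q * Real.sqrt K * (7 / 2 * Real.sqrt K)) := by
        rw [← Finset.mul_sum]
        simp only [h2, Finset.sum_add_distrib]
        refine mul_le_mul_of_nonneg_left (add_le_add (h3.trans ?_) (h4.trans ?_)) zero_le_two
        · gcongr
        · gcongr
    _ = _ := by rw [h7]; ring

/-- The block-cluster tree has `O(N)` leaves. -/
theorem length_blockLeaves_clusterTree_le (hS : S.SplitsLongestEdge) (hη : 0 < S.η) {h : ℝ}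
    (hh : 0 < h) (hd : 1 ≤ d) (hsep : ∀ i i', i ≠ i' → d * h < dist (S.x i) (S.x i'))
    (hT : S.clusterTree.WF) (hG : S.Geometric S.clusterTree) :
    ((S.blockLeaves S.clusterTree S.clusterTree).length : ℝ) ≤
      1 + 48 * (4 * (d / S.η) + 8) ^ d * (2 * S.edge S.clusterTree.pts / h) ^ d := by
  have h1 := S.length_blockLeaves_le S.clusterTree.depth S.clusterTree S.clusterTree le_rfl le_rfl
  have h2 := S.sum_splitCount_le hS hη hh hd hsep hT hG S.clusterTree.depth
  linarith

end H2Data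

namespace H2Data

variable {d N : ℕ} (S : H2Data d N)

/-! ### Cost of the fast multiplication -/

/-- Each split leaves a point on either side, so the cardinality drops at least as fast as the
remaining depth; at depth zero at most one point is left. -/
theorem card_le_of_mem_leaves_build (hx : Function.Injective S.x) (hS : S.SplitsLongestEdge)
    (hC : 1 ≤ S.Cleaf) (n : ℕ) {X : Finset (Fin N)} (hX : X.card ≤ n + 1) :
    ∀ Z ∈ (S.build n X).leaves, Z.card ≤ S.Cleaf := by
  induction n generalizing X with
  | zero =>
    intro Z hZ
    simp only [build, CTree.leaves, List.mem_singleton] at hZ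
    subst hZ
    omega
  | succ n ih =>
    intro Z hZ
    rw [build] at hZ
    split_ifs at hZ with h
    · simp only [CTree.leaves, List.mem_singleton] at hZ
      exact hZ ▸ h
    · have h1 := (S.lowerSon_nonempty hx hS (X := X) (by omega)).card_pos
      have h2 := (S.upperSon_nonempty hx hS (X := X) (by omega)).card_pos
      have h3 : (S.upperSon X).card + (S.lowerSon X).card = X.card :=
        Finset.card_sdiff_add_card_eq_card (S.lowerSon_subset X)
      simp only [CTree.leaves, List.mem_append] at hZ
      rcases hZ with hZ | hZ
      · exact ih (by omega) Z hZ
      · exact ih (by omega) Z hZ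

theorem ops_matVec_le (hx : Function.Injective S.x) (hS : S.SplitsLongestEdge)
    (hC : 1 ≤ S.Cleaf) (hp : 1 ≤ S.p) (hT : S.clusterTree.WF) (v : Fin N → ℝ) :
    (S.matVec v).ops ≤ (S.p ^ d) ^ 2 *
      (12 * N + (2 + 2 * S.Cleaf ^ 2) * (S.blockLeaves S.clusterTree S.clusterTree).length) := by
  have hpts : S.clusterTree.pts.card = N := by
    rw [clusterTree, pts_build, Finset.card_univ, Fintype.card_fin]
  have hP : 1 ≤ S.p ^ d := Nat.one_le_pow _ _ hp
  have h1 := S.ops_forward_add_le v hT 0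
  simp only [matVec, Counted.ops_bind, ops_couple]
  generalize S.couple (S.forward v S.clusterTree 0).val S.far 0 = b
  have h2 := S.ops_backward_add_le hT b.val 0
  generalize (S.backward S.clusterTree b.val 0).val = y
  have h3 := S.ops_nearMul_le v S.near (C := S.Cleaf) (fun B hB => by
    obtain ⟨hB, hB'⟩ := List.mem_filter.1 hB
    have h := (S.mem_blockLeaves_cases _ _ B hB).resolve_left (by simpa using hB')
    have hc := S.card_le_of_mem_leaves_build hx hS hC N (X := Finset.univ) (by simp)
    exact ⟨hc _ h.1, hc _ h.2⟩) y
  have h4 : S.far.length ≤ (S.blockLeaves S.clusterTree S.clusterTree).length :=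
    List.length_filter_le _ _
  have h5 : S.near.length ≤ (S.blockLeaves S.clusterTree S.clusterTree).length :=
    List.length_filter_le _ _
  rw [hpts] at h1 h2
  generalize (S.blockLeaves S.clusterTree S.clusterTree).length = L at *
  generalize S.p ^ d = Q at *
  have e1 : 2 * Q ^ 2 * S.far.length ≤ 2 * Q ^ 2 * L := by gcongr
  have e2 : 2 * S.Cleaf ^ 2 * S.near.length ≤ Q ^ 2 * (2 * S.Cleaf ^ 2 * L) := by
    calc 2 * S.Cleaf ^ 2 * S.near.length ≤ 1 * (2 * S.Cleaf ^ 2 * L) := by rw [one_mul]; gcongr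
      _ ≤ _ := by gcongr; exact Nat.one_le_pow _ _ hP
  have e3 : (4 * Q ^ 2 + 2 * Q) * N ≤ 6 * Q ^ 2 * N := by
    gcongr
    nlinarith
  nlinarith

end H2Data

/-! ### The recursive algorithm -/

section Program

variable {N : ℕ} {mv : (Fin N → ℝ) → Counted (Fin N → ℝ)} {s : ℝ}

theorem runProg_append (L L' : List Instr) (z : ℕ → Fin N → ℝ) :
    (runProg mv s (L ++ L') z).val = (runProg mv s L' (runProg mv s L z).val).val ∧
    (runProg mv s (L ++ L') z).ops =
      (runProg mv s L z).ops + (runProg mv s L' (runProg mv s L z).val).ops := by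
  induction L generalizing z with
  | nil => simp [runProg]
  | cons i L ih =>
    simp only [List.cons_append, runProg, Counted.val_bind, Counted.ops_bind]
    exact ⟨(ih _).1, by rw [(ih _).2, add_assoc]⟩

theorem runProg_singleton (i : Instr) (z : ℕ → Fin N → ℝ) :
    (runProg mv s [i] z).val = (i.exec mv s z).val ∧
    (runProg mv s [i] z).ops = (i.exec mv s z).ops := by
  simp [runProg]

/-- A call of level k changes only its own register and the registers 1, …, k. Register 0 and those
above k are therefore safe places for an argument, which is what lets the nested calls share
temporaries. -/
theorem val_partA_partB {M : Matrix (Fin N) (Fin N) ℝ} (hM : ∀ v, (mv v).val = M.mulVec v)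
    (k r : ℕ) (hr : r = 0 ∨ k < r) (z : ℕ → Fin N → ℝ) :
    ((runProg mv s (partA k r) z).val r = (coupledSchulz (s • M) k).1.mulVec (z r) ∧
      ∀ q, q ≠ r → (q = 0 ∨ k < q) → (runProg mv s (partA k r) z).val q = z q) ∧
    ((runProg mv s (partB k r) z).val r = (coupledSchulz (s • M) k).2.mulVec (z r) ∧
      ∀ q, q ≠ r → (q = 0 ∨ k < q) → (runProg mv s (partB k r) z).val q = z q) := by
  induction k generalizing r z with
  | zero =>
    refine ⟨⟨?_, ?_⟩, ⟨?_, ?_⟩⟩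
    · simp only [partA, (runProg_singleton _ _).1, Instr.exec, Counted.val_bind, Counted.val_pure,
        Function.update_self, coupledSchulz, Matrix.smul_mulVec]
      funext i
      simp [hM]
    · intro q hq _
      simp [partA, (runProg_singleton _ _).1, Instr.exec, Function.update_of_ne hq]
    · simp [partB, runProg, coupledSchulz]
    · simp [partB, runProg]
  | succ k ih =>
    have hrk : r ≠ k + 1 := by omega
    have hr' : r = 0 ∨ k < r := by omega
    have hcopy : ∀ z : ℕ → Fin N → ℝ, (runProg mv s [.copy (k + 1) r] z).val =
        Function.update z (k + 1) (z r) := fun z => by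
      simp [(runProg_singleton _ _).1, Instr.exec]
    have hcomb : ∀ z : ℕ → Fin N → ℝ, (runProg mv s [.comb r (k + 1)] z).val =
        Function.update z r ((3 : ℝ) • z r - z (k + 1)) := fun z => by
      simp only [(runProg_singleton _ _).1, Instr.exec, Counted.val_bind, Counted.val_pure]
      congr 1
    have hhalve : ∀ z : ℕ → Fin N → ℝ, (runProg mv s [.halve r] z).val =
        Function.update z r ((1 / 2 : ℝ) • z r) := fun z => by
      simp only [(runProg_singleton _ _).1, Instr.exec, Counted.val_bind, Counted.val_pure]
      congr 1
    -- The two recursions differ only by exchanging the roles of the subprograms, so one abstract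
    -- statement serves both.
    have hmain : ∀ (P Q : ℕ → List Instr) (A B : Matrix (Fin N) (Fin N) ℝ),
        (∀ r, (r = 0 ∨ k < r) → ∀ z, (runProg mv s (P r) z).val r = A.mulVec (z r) ∧
          ∀ q, q ≠ r → (q = 0 ∨ k < q) → (runProg mv s (P r) z).val q = z q) →
        (∀ r, (r = 0 ∨ k < r) → ∀ z, (runProg mv s (Q r) z).val r = B.mulVec (z r) ∧
          ∀ q, q ≠ r → (q = 0 ∨ k < q) → (runProg mv s (Q r) z).val q = z q) →
        let w := (runProg mv s ([.copy (k + 1) r] ++ P (k + 1) ++ Q (k + 1) ++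
          [.comb r (k + 1)] ++ P r ++ [.halve r]) z).val
        w r = ((1 / 2 : ℝ) • (A * ((3 : ℝ) • 1 - B * A))).mulVec (z r) ∧
          ∀ q, q ≠ r → (q = 0 ∨ k + 1 < q) → w q = z q := by
      intro P Q A B hP hQ
      simp only [(runProg_append _ _ _).1, hhalve, hcopy, hcomb]
      set z1 := Function.update z (k + 1) (z r) with hz1
      obtain ⟨a1, a2⟩ := hP (k + 1) (by omega) z1
      set z2 := (runProg mv s (P (k + 1)) z1).val
      obtain ⟨b1, b2⟩ := hQ (k + 1) (by omega) z2
      set z3 := (runProg mv s (Q (k + 1)) z2).val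
      set z4 := Function.update z3 r ((3 : ℝ) • z3 r - z3 (k + 1)) with hz4
      obtain ⟨c1, c2⟩ := hP r hr' z4
      have e1 : z1 (k + 1) = z r := by rw [hz1, Function.update_self]
      constructor
      · rw [Function.update_self, c1, hz4, Function.update_self, b1, a1, e1, b2 r hrk hr',
          a2 r hrk hr', hz1, Function.update_of_ne hrk]
        simp only [Matrix.smul_mulVec, ← Matrix.mulVec_mulVec, Matrix.sub_mulVec,
          Matrix.one_mulVec]
      · intro q hq hqk
        have hqk' : q = 0 ∨ k < q := by omega
        have hq1 : q ≠ k + 1 := by omega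
        rw [Function.update_of_ne hq, c2 q hq hqk', hz4, Function.update_of_ne hq,
          b2 q hq1 hqk', a2 q hq1 hqk', hz1, Function.update_of_ne hq1]
    exact ⟨hmain (partA k) (partB k) _ _ (fun r hr z => (ih r hr z).1) (fun r hr z => (ih r hr z).2),
      hmain (partB k) (partA k) _ _ (fun r hr z => (ih r hr z).2) (fun r hr z => (ih r hr z).1)⟩

/-- The output of the algorithm. -/
theorem val_recursiveSqrt {M : Matrix (Fin N) (Fin N) ℝ} (hM : ∀ v, (mv v).val = M.mulVec v)
    (k : ℕ) (z : ℕ → Fin N → ℝ) : (runProg mv s (recursiveSqrt k) z).val 0 =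
      (Real.sqrt s)⁻¹ • (coupledSchulz (s • M) k).1.mulVec (z 0) := by
  rw [recursiveSqrt, (runProg_append _ _ _).1, (runProg_singleton _ _).1]
  simp only [Instr.exec, Counted.val_bind, Counted.val_pure, Function.update_self]
  rw [← (val_partA_partB hM k 0 (Or.inl rfl) z).1.1]
  funext i
  simp [Counted.div, Counted.sqrt, div_eq_inv_mul]

/-- The bounds obey a' = 2a + b + 3N and b' = a + 2b + 3N, so a + b + 3N is exactly tripled; it
starts at W + 4N. -/
theorem ops_partA_partB_le {W : ℕ} (hW : ∀ v, (mv v).ops ≤ W) (k : ℕ) :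
    ∃ a b : ℕ, (∀ r z, (runProg mv s (partA k r) z).ops ≤ a) ∧
      (∀ r z, (runProg mv s (partB k r) z).ops ≤ b) ∧ a + b + 3 * N ≤ 3 ^ k * (W + 4 * N) := by
  induction k with
  | zero =>
    refine ⟨W + N, 0, fun r z => ?_, fun r z => ?_, by omega⟩
    · simp only [partA, (runProg_singleton _ _).2, Instr.exec, Counted.ops_bind, Counted.ops_pure,
        Counted.ops_each, Counted.ops_mul, Finset.sum_const, Finset.card_univ, Fintype.card_fin,
        smul_eq_mul]
      have := hW (z r)
      omega
    · simp [partB, runProg]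
  | succ k ih =>
    obtain ⟨a, b, ha, hb, hab⟩ := ih
    have hcopy : ∀ r q (z : ℕ → Fin N → ℝ), (runProg mv s [.copy r q] z).ops = 0 := fun r q z => by
      simp [(runProg_singleton _ _).2, Instr.exec]
    have hcomb : ∀ r q (z : ℕ → Fin N → ℝ), (runProg mv s [.comb r q] z).ops = 2 * N :=
      fun r q z => by
      simp [(runProg_singleton _ _).2, Instr.exec, Counted.sub, mul_comm]
    have hhalve : ∀ r (z : ℕ → Fin N → ℝ), (runProg mv s [.halve r] z).ops = N := fun r z => by
      simp [(runProg_singleton _ _).2, Instr.exec]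
    refine ⟨2 * a + b + 3 * N, 2 * b + a + 3 * N, fun r z => ?_, fun r z => ?_, ?_⟩
    · simp only [partA, (runProg_append _ _ _).2, hcopy, hcomb, hhalve]
      have h1 := ha (k + 1) (runProg mv s [.copy (k + 1) r] z).val
      have h2 := hb (k + 1) (runProg mv s ([.copy (k + 1) r] ++ partA k (k + 1)) z).val
      have h3 := ha r (runProg mv s ([.copy (k + 1) r] ++ partA k (k + 1) ++ partB k (k + 1) ++
        [.comb r (k + 1)]) z).val
      omega
    · simp only [partB, (runProg_append _ _ _).2, hcopy, hcomb, hhalve]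
      have h1 := hb (k + 1) (runProg mv s [.copy (k + 1) r] z).val
      have h2 := ha (k + 1) (runProg mv s ([.copy (k + 1) r] ++ partB k (k + 1)) z).val
      have h3 := hb r (runProg mv s ([.copy (k + 1) r] ++ partB k (k + 1) ++ partA k (k + 1) ++
        [.comb r (k + 1)]) z).val
      omega
    · rw [pow_succ]
      nlinarith

/-- The number of operations of the algorithm. -/
theorem ops_recursiveSqrt_le {W : ℕ} (hN : 1 ≤ N) (hW : ∀ v, (mv v).ops ≤ W) (k : ℕ)
    (z : ℕ → Fin N → ℝ) : (runProg mv s (recursiveSqrt k) z).ops ≤ 3 ^ k * (W + 4 * N) := by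
  obtain ⟨a, b, ha, -, hab⟩ := ops_partA_partB_le (s := s) hW k
  rw [recursiveSqrt, (runProg_append _ _ _).2, (runProg_singleton _ _).2]
  have := ha 0 z
  simp only [Instr.exec, Counted.ops_bind, Counted.ops_pure, Counted.ops_each, Counted.sqrt,
    Counted.div, Finset.sum_const, Finset.card_univ, Fintype.card_fin, smul_eq_mul]
  omega

theorem progRegs_append (L L' : List Instr) :
    progRegs (L ++ L') = progRegs L ∪ progRegs L' := by
  induction L with
  | nil => simp [progRegs]
  | cons i L ih => simp [progRegs, ih, Finset.union_assoc]

theorem progRegs_partA_partB (k r : ℕ) :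
    progRegs (partA k r) ⊆ insert r (Finset.Icc 1 k) ∧
    progRegs (partB k r) ⊆ insert r (Finset.Icc 1 k) := by
  induction k generalizing r with
  | zero => simp [partA, partB, progRegs, Instr.regs]
  | succ k ih =>
    have h1 := ih (k + 1)
    have h2 := ih r
    constructor <;> intro q hq <;>
      simp only [partA, partB, progRegs_append, progRegs, Instr.regs, Finset.mem_union,
        Finset.mem_insert, Finset.mem_singleton, Finset.notMem_empty, or_false] at hq <;>
      simp only [Finset.subset_iff, Finset.mem_insert, Finset.mem_Icc] at h1 h2 ⊢ <;>
      have h1a := @h1.1 q <;> have h1b := @h1.2 q <;>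
      have h2a := @h2.1 q <;> have h2b := @h2.2 q <;>
      rcases hq with ((((hq | hq) | hq) | hq) | hq) | hq <;> grind

theorem card_progRegs_recursiveSqrt_le (k : ℕ) :
    ((progRegs (recursiveSqrt k)).erase 0).card ≤ k := by
  calc _ ≤ (Finset.Icc 1 k).card := Finset.card_le_card fun q hq => by
        obtain ⟨hq0, hq⟩ := Finset.mem_erase.1 hq
        rw [recursiveSqrt, progRegs_append, Finset.mem_union] at hq
        rcases hq with hq | hq
        · exact (Finset.mem_insert.1 ((progRegs_partA_partB k 0).1 hq)).resolve_left hq0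
        · simp [progRegs, Instr.regs] at hq
          exact absurd hq hq0
    _ = k := by simp

end Program

/-! ### Norms and quadratic forms -/

section Norms

variable {N : ℕ}

theorem eucNorm_nonneg (v : Fin N → ℝ) : 0 ≤ eucNorm v := norm_nonneg _

theorem eucNorm_sq (v : Fin N → ℝ) : eucNorm v ^ 2 = v ⬝ᵥ v := by
  rw [eucNorm, EuclideanSpace.norm_sq_eq]
  simp [dotProduct, sq]

theorem eucNorm_pos {v : Fin N → ℝ} (hv : v ≠ 0) : 0 < eucNorm v := by
  rw [eucNorm, norm_pos_iff]
  simpa using hv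

theorem eucNorm_zero : eucNorm (0 : Fin N → ℝ) = 0 := by simp [eucNorm]

theorem eucNorm_add_le (v w : Fin N → ℝ) : eucNorm (v + w) ≤ eucNorm v + eucNorm w := by
  simp only [eucNorm, WithLp.toLp_add]
  exact norm_add_le _ _

theorem eucNorm_smul (c : ℝ) (v : Fin N → ℝ) : eucNorm (c • v) = |c| * eucNorm v := by
  simp only [eucNorm, WithLp.toLp_smul, norm_smul, Real.norm_eq_abs]

theorem abs_dotProduct_le (v w : Fin N → ℝ) : |v ⬝ᵥ w| ≤ eucNorm v * eucNorm w := by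
  have h := abs_real_inner_le_norm (WithLp.toLp 2 v : Pt N) (WithLp.toLp 2 w : Pt N)
  have e : inner ℝ (WithLp.toLp 2 v : Pt N) (WithLp.toLp 2 w : Pt N) = v ⬝ᵥ w := by
    simp [PiLp.inner_apply, dotProduct, mul_comm]
  rwa [e] at h

theorem frobNorm_nonneg (M : Matrix (Fin N) (Fin N) ℝ) : 0 ≤ frobNorm M := Real.sqrt_nonneg _

theorem frobNorm_sq (M : Matrix (Fin N) (Fin N) ℝ) : frobNorm M ^ 2 = ∑ i, ∑ j, M i j ^ 2 :=
  Real.sq_sqrt (Finset.sum_nonneg fun i _ => Finset.sum_nonneg fun j _ => sq_nonneg (M i j))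

theorem eucNorm_mulVec_le_frobNorm (M : Matrix (Fin N) (Fin N) ℝ) (v : Fin N → ℝ) :
    eucNorm (M.mulVec v) ≤ frobNorm M * eucNorm v := by
  refine (sq_le_sq₀ (eucNorm_nonneg _) (mul_nonneg (frobNorm_nonneg M) (eucNorm_nonneg _))).1 ?_
  rw [mul_pow, frobNorm_sq, eucNorm_sq, eucNorm_sq, Finset.sum_mul]
  refine Finset.sum_le_sum fun i _ => ?_
  rw [← sq]
  refine (Finset.sum_mul_sq_le_sq_mul_sq Finset.univ (fun j => M i j) v).trans_eq ?_
  simp [dotProduct, sq]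

theorem eucNorm_mulVec_le_specNorm (M : Matrix (Fin N) (Fin N) ℝ) (v : Fin N → ℝ) :
    eucNorm (M.mulVec v) ≤ specNorm M * eucNorm v :=
  (Matrix.toEuclideanCLM (𝕜 := ℝ) M).le_opNorm (WithLp.toLp 2 v : Pt N)

theorem eucNorm_mulVec_le_lambdaMax (M : Matrix (Fin N) (Fin N) ℝ) (v : Fin N → ℝ) :
    eucNorm (M.mulVec v) ≤ lambdaMax M * eucNorm v := by
  by_cases hv : v = 0
  · simp [hv, eucNorm_zero]
  rw [← div_le_iff₀ (eucNorm_pos hv)]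
  refine le_ciSup (f := fun z : {z : Fin N → ℝ // z ≠ 0} => eucNorm (M.mulVec z.1) / eucNorm z.1)
    ⟨frobNorm M, ?_⟩ ⟨v, hv⟩
  rintro _ ⟨z, rfl⟩
  exact (div_le_iff₀ (eucNorm_pos z.2)).2 (eucNorm_mulVec_le_frobNorm M z)

theorem lambdaMax_le_specNorm (M : Matrix (Fin N) (Fin N) ℝ) : lambdaMax M ≤ specNorm M :=
  Real.iSup_le (fun z => (div_le_iff₀ (eucNorm_pos z.2)).2 (eucNorm_mulVec_le_specNorm M z))
    (norm_nonneg _)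

theorem lambdaMin_mul_le (M : Matrix (Fin N) (Fin N) ℝ) (v : Fin N → ℝ) :
    lambdaMin M * eucNorm v ^ 2 ≤ M.mulVec v ⬝ᵥ v := by
  by_cases hv : v = 0
  · simp [hv, eucNorm_zero]
  rw [← le_div_iff₀ (pow_pos (eucNorm_pos hv) 2)]
  refine ciInf_le (f := fun z : {z : Fin N → ℝ // z ≠ 0} =>
    (M.mulVec z.1 ⬝ᵥ z.1) / eucNorm z.1 ^ 2) ⟨-frobNorm M, ?_⟩ ⟨v, hv⟩
  rintro _ ⟨z, rfl⟩
  refine (le_div_iff₀ (pow_pos (eucNorm_pos z.2) 2)).2 ?_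
  have h1 := neg_le_of_abs_le (abs_dotProduct_le (M.mulVec z) z)
  have h2 := mul_le_mul_of_nonneg_right (eucNorm_mulVec_le_frobNorm M z) (eucNorm_nonneg z.1)
  nlinarith

/-- For N = 0 the infimum runs over the empty set and has the default value 0. -/
theorem le_lambdaMin (hN : 1 ≤ N) {M : Matrix (Fin N) (Fin N) ℝ} {c : ℝ}
    (h : ∀ v, c * eucNorm v ^ 2 ≤ M.mulVec v ⬝ᵥ v) : c ≤ lambdaMin M := by
  have : Nonempty {z : Fin N → ℝ // z ≠ 0} :=
    ⟨⟨fun _ => 1, fun e => one_ne_zero (congrFun e ⟨0, hN⟩)⟩⟩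
  exact le_ciInf fun z => (le_div_iff₀ (pow_pos (eucNorm_pos z.2) 2)).2 (h z)

/-! ### Matrices that are diagonal in an orthonormal basis -/

variable (b : OrthonormalBasis (Fin N) ℝ (Pt N)) {W : Matrix (Fin N) (Fin N) ℝ} {μ : Fin N → ℝ}

theorem repr_mulVec (hW : ∀ j, W.mulVec (b j) = μ j • ⇑(b j)) (v : Fin N → ℝ) (j : Fin N) :
    b.repr (WithLp.toLp 2 (W.mulVec v)) j = μ j * b.repr (WithLp.toLp 2 v) j := by
  have hL : ∀ i, Matrix.toEuclideanCLM (𝕜 := ℝ) W (b i) = μ i • b i := fun i => by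
    ext l
    exact congrFun (hW i) l
  have h1 : (WithLp.toLp 2 (W.mulVec v) : Pt N) =
      Matrix.toEuclideanCLM (𝕜 := ℝ) W (WithLp.toLp 2 v) := rfl
  rw [h1]
  conv_lhs => rw [← b.sum_repr (WithLp.toLp 2 v)]
  simp only [map_sum, map_smul, hL, b.repr_self, WithLp.ofLp_sum, WithLp.ofLp_smul,
    Finset.sum_apply, Pi.smul_apply, smul_eq_mul, PiLp.single_apply]
  simp [mul_comm]

theorem eucNorm_sq_eq_sum_repr (v : Fin N → ℝ) :
    eucNorm v ^ 2 = ∑ j, b.repr (WithLp.toLp 2 v) j ^ 2 := by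
  rw [eucNorm, ← b.repr.norm_map, EuclideanSpace.norm_sq_eq]
  simp

theorem mulVec_dotProduct_eq_sum_repr (hW : ∀ j, W.mulVec (b j) = μ j • ⇑(b j))
    (v : Fin N → ℝ) : W.mulVec v ⬝ᵥ v = ∑ j, μ j * b.repr (WithLp.toLp 2 v) j ^ 2 := by
  have e : W.mulVec v ⬝ᵥ v =
      inner ℝ (WithLp.toLp 2 (W.mulVec v) : Pt N) (WithLp.toLp 2 v : Pt N) := by
    simp [PiLp.inner_apply, dotProduct, mul_comm]
  rw [e, ← b.repr.inner_map_map, PiLp.inner_apply]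
  refine Finset.sum_congr rfl fun j _ => ?_
  rw [repr_mulVec b hW]
  simp only [RCLike.inner_apply, conj_trivial]
  ring

theorem eucNorm_mulVec_le_of_eigenbasis (hW : ∀ j, W.mulVec (b j) = μ j • ⇑(b j)) {c : ℝ}
    (hc : 0 ≤ c) (h : ∀ j, |μ j| ≤ c) (v : Fin N → ℝ) :
    eucNorm (W.mulVec v) ≤ c * eucNorm v := by
  refine (sq_le_sq₀ (eucNorm_nonneg _) (mul_nonneg hc (eucNorm_nonneg _))).1 ?_
  rw [mul_pow, eucNorm_sq_eq_sum_repr b, eucNorm_sq_eq_sum_repr b, Finset.mul_sum]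
  refine Finset.sum_le_sum fun j _ => ?_
  rw [repr_mulVec b hW, mul_pow]
  exact mul_le_mul_of_nonneg_right (sq_le_sq' (neg_le_of_abs_le (h j)) (le_of_abs_le (h j)))
    (sq_nonneg _)

theorem mul_eucNorm_sq_le_of_eigenbasis (hW : ∀ j, W.mulVec (b j) = μ j • ⇑(b j)) {c : ℝ}
    (h : ∀ j, c ≤ μ j) (v : Fin N → ℝ) : c * eucNorm v ^ 2 ≤ W.mulVec v ⬝ᵥ v := by
  rw [mulVec_dotProduct_eq_sum_repr b hW, eucNorm_sq_eq_sum_repr b, Finset.mul_sum]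
  exact Finset.sum_le_sum fun j _ => mul_le_mul_of_nonneg_right (h j) (sq_nonneg _)

theorem eucNorm_basis (j : Fin N) : eucNorm (b j) = 1 := b.orthonormal.1 j

theorem eigenvalue_mem_Icc (hW : ∀ j, W.mulVec (b j) = μ j • ⇑(b j)) (j : Fin N) :
    μ j ∈ Set.Icc (lambdaMin W) (lambdaMax W) := by
  constructor
  · have h := lambdaMin_mul_le W (b j)
    rwa [hW, smul_dotProduct, ← eucNorm_sq, eucNorm_basis, one_pow, mul_one, smul_eq_mul,
      mul_one] at h
  · have h := eucNorm_mulVec_le_lambdaMax W (b j)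
    rw [hW, eucNorm_smul, eucNorm_basis, mul_one, mul_one] at h
    exact (le_abs_self _).trans h

end Norms

/-! ### Definite matrices and their square roots -/

section SquareRoot

variable {N : ℕ} {M M' : Matrix (Fin N) (Fin N) ℝ}

theorem lambdaMin_pos (hN : 1 ≤ N) (hM : M.PosDef) : 0 < lambdaMin M := by
  have : Nonempty (Fin N) := ⟨⟨0, hN⟩⟩
  obtain ⟨j, hj⟩ := Finite.exists_min hM.1.eigenvalues
  exact (hM.eigenvalues_pos j).trans_le (le_lambdaMin hN
    (mul_eucNorm_sq_le_of_eigenbasis hM.1.eigenvectorBasis hM.1.mulVec_eigenvectorBasis hj))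

/-- The quadratic form of M' is at least (λ_min(M) - ‖M - M'‖_F) |v|². -/
theorem posDef_of_frobNorm_lt (hM' : M'.IsHermitian) (h : frobNorm (M - M') < lambdaMin M) :
    M'.PosDef := by
  refine Matrix.posDef_iff_dotProduct_mulVec.2 ⟨hM', fun v hv => ?_⟩
  rw [star_trivial]
  have h1 := lambdaMin_mul_le M v
  have h2 := le_of_abs_le (abs_dotProduct_le ((M - M').mulVec v) v)
  have h3 := mul_le_mul_of_nonneg_right (eucNorm_mulVec_le_frobNorm (M - M') v) (eucNorm_nonneg v)
  rw [Matrix.sub_mulVec, sub_dotProduct] at h2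
  have h4 := pow_pos (eucNorm_pos hv) 2
  rw [dotProduct_comm]
  rw [Matrix.sub_mulVec] at h3
  nlinarith

theorem sqrt_posSemidef (M : Matrix (Fin N) (Fin N) ℝ) : (CFC.sqrt M).PosSemidef :=
  Matrix.nonneg_iff_posSemidef.1 (CFC.sqrt_nonneg M)

theorem sqrt_mul_sqrt_of_posSemidef (hM : M.PosSemidef) : CFC.sqrt M * CFC.sqrt M = M :=
  CFC.sqrt_mul_sqrt_self M (Matrix.nonneg_iff_posSemidef.2 hM)

/-- The square root acts on an eigenvector by the square root of the eigenvalue. -/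
theorem sqrt_mulVec_of_eigenvector (hM : M.PosSemidef) {l : ℝ} (hl : 0 < l) {v : Fin N → ℝ}
    (hv : M.mulVec v = l • v) : (CFC.sqrt M).mulVec v = Real.sqrt l • v := by
  set R := CFC.sqrt M with hR
  -- Since R²v = lv, this vector satisfies Rw = -√l w, which forces w = 0 for positive semidefinite
  -- R.
  set w := R.mulVec v - Real.sqrt l • v with hw
  have h1 : R.mulVec w = -Real.sqrt l • w := by
    rw [hw, Matrix.mulVec_sub, Matrix.mulVec_mulVec, sqrt_mul_sqrt_of_posSemidef hM, hv,
      Matrix.mulVec_smul, smul_sub, smul_smul, neg_mul, Real.mul_self_sqrt hl.le]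
    module
  have h2 := (sqrt_posSemidef M).dotProduct_mulVec_nonneg w
  rw [← hR, h1, star_trivial, dotProduct_smul, ← eucNorm_sq, smul_eq_mul] at h2
  have h3 := Real.sqrt_pos.2 hl
  have h4 : w = 0 := by
    by_contra h
    have := mul_pos h3 (pow_pos (eucNorm_pos h) 2)
    linarith
  exact sub_eq_zero.1 h4

/-- Squares of eigenvalues of √M are eigenvalues of M with the same eigenvectors, hence at least
λ_min(M). -/
theorem sqrt_lambdaMin_mul_le (hM : M.PosSemidef) (v : Fin N → ℝ) :
    Real.sqrt (lambdaMin M) * eucNorm v ^ 2 ≤ (CFC.sqrt M).mulVec v ⬝ᵥ v := by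
  have hR := sqrt_posSemidef M
  refine mul_eucNorm_sq_le_of_eigenbasis hR.1.eigenvectorBasis hR.1.mulVec_eigenvectorBasis
    (fun j => Real.sqrt_le_iff.2 ⟨hR.eigenvalues_nonneg j, ?_⟩) v
  refine (eigenvalue_mem_Icc hR.1.eigenvectorBasis (W := M)
    (μ := fun j => hR.1.eigenvalues j ^ 2) (fun i => ?_) j).1
  have hMM := congrArg (fun A => A.mulVec (hR.1.eigenvectorBasis i)) (sqrt_mul_sqrt_of_posSemidef hM)
  simp only at hMM
  rw [← hMM, ← Matrix.mulVec_mulVec, hR.1.mulVec_eigenvectorBasis, Matrix.mulVec_smul,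
    hR.1.mulVec_eigenvectorBasis, smul_smul, sq]

/-- Perturbation of the square root of a positive semidefinite matrix. -/
theorem eucNorm_sqrt_sub_sqrt_mulVec_le (hM : M.PosSemidef) (hM' : M'.PosSemidef)
    (h : 0 < max (lambdaMin M) (lambdaMin M')) (v : Fin N → ℝ) :
    eucNorm ((CFC.sqrt M).mulVec v - (CFC.sqrt M').mulVec v) ≤
      frobNorm (M - M') / Real.sqrt (max (lambdaMin M) (lambdaMin M')) * eucNorm v := by
  set X := CFC.sqrt M with hX
  set Y := CFC.sqrt M' with hY
  have hXY : (X - Y).IsHermitian := (sqrt_posSemidef M).1.sub (sqrt_posSemidef M').1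
  rw [← Matrix.sub_mulVec]
  refine eucNorm_mulVec_le_of_eigenbasis hXY.eigenvectorBasis hXY.mulVec_eigenvectorBasis
    (div_nonneg (Real.sqrt_nonneg _) (Real.sqrt_nonneg _)) (fun j => ?_) v
  rw [le_div_iff₀ (Real.sqrt_pos.2 h)]
  set w : Fin N → ℝ := ⇑(hXY.eigenvectorBasis j) with hw
  set δ := hXY.eigenvalues j with hδ
  have hwn : eucNorm w = 1 := eucNorm_basis _ j
  have hDw : (X - Y).mulVec w = δ • w := hXY.mulVec_eigenvectorBasis j
  -- Tested with a unit eigenvector w of X - Y for the eigenvalue δ, this gives δ(⟨Xw, w⟩ + ⟨Yw,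
  -- w⟩). A lower bound for one of the two forms suffices, hence the maximum in the denominator.
  have h1 : M - M' = X * (X - Y) + (X - Y) * Y := by
    rw [mul_sub, sub_mul, hX, hY, sqrt_mul_sqrt_of_posSemidef hM, sqrt_mul_sqrt_of_posSemidef hM']
    abel
  have hT : (X - Y).transpose = X - Y := by
    rw [← Matrix.conjTranspose_eq_transpose_of_trivial]; exact hXY
  have h2 : (M - M').mulVec w ⬝ᵥ w = δ * (X.mulVec w ⬝ᵥ w + Y.mulVec w ⬝ᵥ w) := by
    rw [h1, Matrix.add_mulVec, ← Matrix.mulVec_mulVec, ← Matrix.mulVec_mulVec, hDw,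
      Matrix.mulVec_smul, add_dotProduct, smul_dotProduct, smul_eq_mul, mul_add]
    congr 1
    rw [dotProduct_comm, Matrix.dotProduct_mulVec, ← Matrix.mulVec_transpose, hT, hDw,
      smul_dotProduct, smul_eq_mul, dotProduct_comm]
  have h3 := abs_dotProduct_le ((M - M').mulVec w) w
  have h4 := eucNorm_mulVec_le_frobNorm (M - M') w
  have h5 := sqrt_lambdaMin_mul_le hM w
  have h6 := sqrt_lambdaMin_mul_le hM' w
  rw [hwn, one_pow, mul_one] at h5 h6
  rw [hwn, mul_one] at h3 h4
  have h7 : Real.sqrt (max (lambdaMin M) (lambdaMin M')) ≤ X.mulVec w ⬝ᵥ w + Y.mulVec w ⬝ᵥ w := by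
    have a1 := Real.sqrt_nonneg (lambdaMin M)
    have a2 := Real.sqrt_nonneg (lambdaMin M')
    rcases max_choice (lambdaMin M) (lambdaMin M') with e | e <;> rw [e] <;> linarith
  calc |δ| * Real.sqrt (max (lambdaMin M) (lambdaMin M'))
      ≤ |δ| * (X.mulVec w ⬝ᵥ w + Y.mulVec w ⬝ᵥ w) := by gcongr
    _ = |(M - M').mulVec w ⬝ᵥ w| := by
        rw [h2, abs_mul, abs_of_nonneg ((Real.sqrt_nonneg _).trans h7)]
    _ ≤ _ := h3.trans h4

end SquareRoot

/-! ### The Schulz iteration -/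

section Schulz

variable {N : ℕ}

/-- The square of an antidiagonal block matrix is block diagonal, with blocks AB and BA, so every
iterate stays antidiagonal. -/
theorem schulz_fromBlocks (M : Matrix (Fin N) (Fin N) ℝ) (k : ℕ) :
    schulz (Matrix.fromBlocks 0 M 1 0) k =
      Matrix.fromBlocks 0 (coupledSchulz M k).1 (coupledSchulz M k).2 0 := by
  induction k with
  | zero => rfl
  | succ k ih =>
    rw [schulz, ih, sq, Matrix.fromBlocks_multiply, ← Matrix.fromBlocks_one,
      Matrix.fromBlocks_smul, sub_eq_add_neg, Matrix.fromBlocks_neg, Matrix.fromBlocks_add,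
      Matrix.fromBlocks_multiply, Matrix.fromBlocks_smul]
    simp [coupledSchulz, sub_eq_add_neg]

/-- The coupled Schulz iteration for a number. -/
def scalarSchulz (μ : ℝ) : ℕ → ℝ × ℝ
  | 0 => (μ, 1)
  | k + 1 =>
    let a := (scalarSchulz μ k).1
    let b := (scalarSchulz μ k).2
    (1 / 2 * (a * (3 - b * a)), 1 / 2 * (b * (3 - a * b)))

theorem coupledSchulz_mulVec {M : Matrix (Fin N) (Fin N) ℝ} {μ : ℝ} {v : Fin N → ℝ}
    (h : M.mulVec v = μ • v) (k : ℕ) :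
    (coupledSchulz M k).1.mulVec v = (scalarSchulz μ k).1 • v ∧
    (coupledSchulz M k).2.mulVec v = (scalarSchulz μ k).2 • v := by
  induction k with
  | zero => simp [coupledSchulz, scalarSchulz, h]
  | succ k ih =>
    obtain ⟨h1, h2⟩ := ih
    simp only [coupledSchulz, scalarSchulz, Matrix.smul_mulVec, ← Matrix.mulVec_mulVec,
      Matrix.sub_mulVec, Matrix.one_mulVec, h1, h2, Matrix.mulVec_sub, Matrix.mulVec_smul]
    constructor <;> module

/-- The residual r = 1 - ab is mapped to r²(3 + r)/4, which lies between 0 and r² for |r| < 1; this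
is the quadratic convergence. The last clause keeps a away from zero for μ > 1 and is used in
`abs_sqrt_sub_scalarSchulz_le`. -/
theorem scalarSchulz_invariant {μ : ℝ} (h0 : 0 < μ) (h2 : μ < 2) (k : ℕ) :
    0 < (scalarSchulz μ k).1 ∧ (scalarSchulz μ k).1 = μ * (scalarSchulz μ k).2 ∧
      |1 - (scalarSchulz μ k).1 * (scalarSchulz μ k).2| ≤ |1 - μ| ^ 2 ^ k ∧
      |1 - (scalarSchulz μ k).1 * (scalarSchulz μ k).2| < 1 ∧
      (1 < μ → 1 / 4 ≤ (scalarSchulz μ k).1 * (scalarSchulz μ k).2) := by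
  induction k with
  | zero =>
    refine ⟨h0, by simp [scalarSchulz], by simp [scalarSchulz], ?_, ?_⟩
    · simp only [scalarSchulz, mul_one]
      rw [abs_lt]; constructor <;> linarith
    · simp only [scalarSchulz, mul_one]
      intro h; linarith
  | succ k ih =>
    obtain ⟨h3, h4, h5, h6, h7⟩ := ih
    rw [scalarSchulz]
    set a := (scalarSchulz μ k).1
    set b := (scalarSchulz μ k).2
    simp only
    set r := 1 - a * b with hr
    have hr1 := abs_lt.1 h6
    have hnew : 1 - 1 / 2 * (a * (3 - b * a)) * (1 / 2 * (b * (3 - a * b))) = r ^ 2 * ((3 + r) / 4) := by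
      rw [hr]; ring
    have hab : r ^ 2 * ((3 + r) / 4) ≤ r ^ 2 := by
      nlinarith [sq_nonneg r]
    have hnn : 0 ≤ r ^ 2 * ((3 + r) / 4) := mul_nonneg (sq_nonneg _) (by linarith)
    refine ⟨?_, ?_, ?_, ?_, ?_⟩
    · have : 0 < 3 - b * a := by rw [mul_comm b a]; linarith
      positivity
    · rw [h4]; ring
    · rw [hnew, abs_of_nonneg hnn, pow_succ 2 k, pow_mul]
      refine hab.trans ?_
      rw [← sq_abs r]
      gcongr
    · rw [hnew, abs_of_nonneg hnn]
      refine hab.trans_lt ?_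
      rw [← sq_abs r]
      exact pow_lt_one₀ (abs_nonneg _) h6 two_ne_zero
    · intro h
      have h8 : r ≤ 3 / 4 := by have := h7 h; linarith
      have : r ^ 2 * ((3 + r) / 4) ≤ 3 / 4 := by
        rcases le_total r 0 with h9 | h9
        · nlinarith [sq_nonneg r]
        · nlinarith [sq_nonneg r]
      linarith

/-- From a² = μab follows √μ - a = μ(1 - ab)/(√μ + a), so it remains to see μ ≤ √μ + a. This is
clear for μ ≤ 1; for 1 < μ < 2 the bound ab ≥ 1/4 gives a ≥ √μ/2, and √μ ≤ 3/2. -/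
theorem abs_sqrt_sub_scalarSchulz_le {μ : ℝ} (h0 : 0 < μ) (h2 : μ < 2) (k : ℕ) :
    |Real.sqrt μ - (scalarSchulz μ k).1| ≤ |1 - μ| ^ 2 ^ k := by
  obtain ⟨h3, h4, h5, -, h7⟩ := scalarSchulz_invariant h0 h2 k
  set a := (scalarSchulz μ k).1
  set b := (scalarSchulz μ k).2
  set t := Real.sqrt μ with ht
  have ht0 : 0 < t := Real.sqrt_pos.2 h0
  have htt : t * t = μ := Real.mul_self_sqrt h0.le
  have haa : a * a = μ * (a * b) := by
    nth_rewrite 1 [h4]; ring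
  have h8 : (t - a) * (t + a) = μ * (1 - a * b) := by
    have : (t - a) * (t + a) = t * t - a * a := by ring
    rw [this, htt, haa]; ring
  have h9 : μ ≤ t + a := by
    rcases le_or_gt μ 1 with h | h
    · have : t ≤ 1 := Real.sqrt_le_one.2 h
      nlinarith
    · have h10 := h7 h
      have h11 : t / 2 ≤ a := by
        by_contra hlt
        push Not at hlt
        nlinarith
      have h12 : t ≤ 3 / 2 := by nlinarith
      nlinarith
  have h10 : |t - a| * (t + a) = μ * |1 - a * b| := by
    rw [← abs_of_pos (add_pos ht0 h3), ← abs_mul, h8, abs_mul, abs_of_pos h0]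
  have h11 : |t - a| * μ ≤ |1 - a * b| * μ := by
    calc |t - a| * μ ≤ |t - a| * (t + a) := by gcongr
      _ = _ := by rw [h10, mul_comm]
  exact (le_of_mul_le_mul_right h11 h0).trans h5

variable {M : Matrix (Fin N) (Fin N) ℝ} {s : ℝ}

theorem scaled_eigenvalue_bounds (hN : 1 ≤ N) (hM : M.PosDef) (hs : 0 < s)
    (hs2 : s < 2 * (specNorm M)⁻¹) : 0 < s * lambdaMin M ∧ s * lambdaMin M ≤ s * lambdaMax M ∧
      s * lambdaMax M < 2 := by
  have h1 := lambdaMin_pos hN hM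
  have h2 := eigenvalue_mem_Icc hM.1.eigenvectorBasis hM.1.mulVec_eigenvectorBasis ⟨0, hN⟩
  have h3 := h2.1.trans h2.2
  have h4 := lambdaMax_le_specNorm M
  have h5 : 0 < specNorm M := by linarith
  refine ⟨mul_pos hs h1, by gcongr, ?_⟩
  rw [← div_eq_mul_inv, lt_div_iff₀ h5] at hs2
  nlinarith

theorem contraction_lt_one (hN : 1 ≤ N) (hM : M.PosDef) (hs : 0 < s)
    (hs2 : s < 2 * (specNorm M)⁻¹) : max |1 - s * lambdaMax M| |1 - s * lambdaMin M| < 1 := by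
  obtain ⟨h1, h2, h3⟩ := scaled_eigenvalue_bounds hN hM hs hs2
  refine max_lt ?_ ?_ <;> rw [abs_lt] <;> constructor <;> linarith

/-- Convergence of the coupled Schulz iteration to the square root. -/
theorem eucNorm_sqrt_sub_coupledSchulz_le (hN : 1 ≤ N) (hM : M.PosDef) (hs : 0 < s)
    (hs2 : s < 2 * (specNorm M)⁻¹) (k : ℕ) (v : Fin N → ℝ) :
    eucNorm ((CFC.sqrt M).mulVec v - (Real.sqrt s)⁻¹ • (coupledSchulz (s • M) k).1.mulVec v) ≤
      (Real.sqrt s)⁻¹ * max |1 - s * lambdaMax M| |1 - s * lambdaMin M| ^ 2 ^ k * eucNorm v := by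
  obtain ⟨h1, h2, h3⟩ := scaled_eigenvalue_bounds hN hM hs hs2
  rw [← Matrix.smul_mulVec, ← Matrix.sub_mulVec]
  -- The square root and the iterate are both diagonal in the eigenbasis of `M`, and √l = s^(-1/2)
  -- √(sl) matches the scaling.
  refine eucNorm_mulVec_le_of_eigenbasis hM.1.eigenvectorBasis
    (μ := fun j => Real.sqrt (hM.1.eigenvalues j) -
      (Real.sqrt s)⁻¹ * (scalarSchulz (s * hM.1.eigenvalues j) k).1) (fun j => ?_)
    (by positivity) (fun j => ?_) v
  · have hj := hM.1.mulVec_eigenvectorBasis j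
    have hj' : (s • M).mulVec (hM.1.eigenvectorBasis j) =
        (s * hM.1.eigenvalues j) • ⇑(hM.1.eigenvectorBasis j) := by
      rw [Matrix.smul_mulVec, hj, smul_smul]
    rw [Matrix.sub_mulVec, Matrix.smul_mulVec, (coupledSchulz_mulVec hj' k).1,
      sqrt_mulVec_of_eigenvector hM.posSemidef (hM.eigenvalues_pos j) hj]
    module
  · have hj := eigenvalue_mem_Icc hM.1.eigenvectorBasis hM.1.mulVec_eigenvectorBasis j
    have hpos := hM.eigenvalues_pos j
    set l := hM.1.eigenvalues j
    have h4 : s * lambdaMin M ≤ s * l := by gcongr; exact hj.1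
    have h5 : s * l ≤ s * lambdaMax M := by gcongr; exact hj.2
    have h6 := abs_sqrt_sub_scalarSchulz_le (h1.trans_le h4) (h5.trans_lt h3) k
    have hs' := Real.sqrt_pos.2 hs
    have h7 : Real.sqrt l - (Real.sqrt s)⁻¹ * (scalarSchulz (s * l) k).1 =
        (Real.sqrt s)⁻¹ * (Real.sqrt (s * l) - (scalarSchulz (s * l) k).1) := by
      rw [Real.sqrt_mul hs.le, mul_sub, inv_mul_cancel_left₀ hs'.ne']
    rw [h7, abs_mul, abs_of_pos (inv_pos.2 hs')]
    gcongr
    refine h6.trans ?_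
    gcongr
    refine abs_le.2 ⟨?_, ?_⟩
    · have := neg_abs_le (1 - s * lambdaMax M)
      have := le_max_left |1 - s * lambdaMax M| |1 - s * lambdaMin M|
      linarith
    · have := le_abs_self (1 - s * lambdaMin M)
      have := le_max_right |1 - s * lambdaMax M| |1 - s * lambdaMin M|
      linarith

end Schulz

/-! ### Covariance matrices of Gaussian fields -/

section Gaussian

variable {d N : ℕ} {Ω : Type*} [MeasurableSpace Ω] {P : MeasureTheory.Measure Ω} {E : Set (Pt d)}
  {Z : Pt d → Ω → ℝ} {ρ : Pt d → Pt d → ℝ}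

theorem IsGaussianFieldWithCov.cov_comm (h : IsGaussianFieldWithCov P E Z ρ) {y y' : Pt d}
    (hy : y ∈ E) (hy' : y' ∈ E) : ρ y y' = ρ y' y := by
  rw [← h.2.2 y hy y' hy', ← h.2.2 y' hy' y hy]
  simp only [mul_comm]

/-- The quadratic form is the second moment of ∑ v_i Z(x_i); Gaussianity provides the square
integrability for expanding it. -/
theorem IsGaussianFieldWithCov.posSemidef_covMatrix {S : H2Data d N}
    (h : IsGaussianFieldWithCov P E Z S.ρ) (hx : ∀ i, S.x i ∈ E) : S.covMatrix.PosSemidef := by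
  have hL : ∀ i, MeasureTheory.MemLp (Z (S.x i)) 2 P := fun i =>
    (h.1.hasGaussianLaw_eval ⟨S.x i, hx i⟩).memLp_two
  refine Matrix.PosSemidef.of_dotProduct_mulVec_nonneg ?_ fun v => ?_
  · ext i j
    simp [H2Data.covMatrix, h.cov_comm (hx j) (hx i)]
  · have hint : ∀ i j, MeasureTheory.Integrable
        (fun ω => v i * v j * (Z (S.x i) ω * Z (S.x j) ω)) P := fun i j =>
      ((hL i).integrable_mul (hL j)).const_mul _
    have e : star v ⬝ᵥ S.covMatrix.mulVec v = ∫ ω, (∑ i, v i * Z (S.x i) ω) ^ 2 ∂P := by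
      have e1 : ∀ ω, (∑ i, v i * Z (S.x i) ω) ^ 2 =
          ∑ i, ∑ j, v i * v j * (Z (S.x i) ω * Z (S.x j) ω) := fun ω => by
        rw [sq, Finset.sum_mul_sum]
        exact Finset.sum_congr rfl fun i _ => Finset.sum_congr rfl fun j _ => by ring
      simp only [e1]
      rw [MeasureTheory.integral_finsetSum _ fun i _ =>
        MeasureTheory.integrable_finsetSum _ fun j _ => hint i j]
      simp only [dotProduct, Matrix.mulVec, star_trivial, Finset.mul_sum]
      refine Finset.sum_congr rfl fun i _ => ?_
      rw [MeasureTheory.integral_finsetSum _ fun j _ => hint i j]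
      refine Finset.sum_congr rfl fun j _ => ?_
      rw [MeasureTheory.integral_const_mul, h.2.2 _ (hx i) _ (hx j), H2Data.covMatrix,
        Matrix.of_apply]
      ring
    rw [e]
    exact MeasureTheory.integral_nonneg fun ω => sq_nonneg _

end Gaussian

/-! ### The approximation error -/

theorem frobNorm_le_of_abs_le {N : ℕ} {M : Matrix (Fin N) (Fin N) ℝ} {e : ℝ} (he : 0 ≤ e)
    (h : ∀ i j, |M i j| ≤ e) : frobNorm M ≤ N * e := by
  refine (sq_le_sq₀ (frobNorm_nonneg M) (by positivity)).1 ?_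
  rw [frobNorm_sq]
  calc ∑ i, ∑ j, M i j ^ 2 ≤ ∑ _i : Fin N, ∑ _j : Fin N, e ^ 2 :=
        Finset.sum_le_sum fun i _ => Finset.sum_le_sum fun j _ =>
          sq_le_sq' (neg_le_of_abs_le (h i j)) (le_of_abs_le (h i j))
    _ = _ := by
        simp only [Finset.sum_const, Finset.card_univ, Fintype.card_fin, nsmul_eq_mul]
        ring

namespace H2Data

variable {d N : ℕ} (S : H2Data d N)

open Classical in
/-- The entry of the `H²`-matrix with index `(i, j)` in the block `b`. -/
def blockEntry (b : Finset (Fin N) × Finset (Fin N)) (i j : Fin N) : ℝ :=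
  if S.Admissible b.1 b.2 then ∑ n, ∑ m, S.V b.1 i n * S.M b.1 b.2 n m * S.V b.2 j m
  else S.covMatrix i j

theorem h2Matrix_apply (i j : Fin N) : S.h2Matrix i j =
    ((S.blockLeaves S.clusterTree S.clusterTree).map fun b =>
      if i ∈ b.1 ∧ j ∈ b.2 then S.blockEntry b i j else 0).sum := by
  classical
  rw [h2Matrix, Matrix.of_apply, far, near, List.sum_map_filter', List.sum_map_filter',
    ← List.sum_map_add]
  refine congrArg _ (List.map_congr_left fun b _ => ?_)
  unfold blockEntry
  by_cases h1 : S.Admissible b.1 b.2 <;> by_cases h2 : i ∈ b.1 ∧ j ∈ b.2 <;> simp [h1, h2]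

theorem exists_h2Matrix_eq_blockEntry (hT : S.clusterTree.WF) (i j : Fin N) :
    ∃ b ∈ S.blockLeaves S.clusterTree S.clusterTree, (i ∈ b.1 ∧ j ∈ b.2) ∧
      S.h2Matrix i j = S.blockEntry b i j := by
  have hpts : S.clusterTree.pts = Finset.univ := S.pts_build _ _
  have h := S.sum_blockLeaves_indicator i j S.clusterTree S.clusterTree hT hT
  rw [hpts, if_pos ⟨Finset.mem_univ _, Finset.mem_univ _⟩] at h
  obtain ⟨b, hb, h1, h2⟩ := List.exists_of_sum_indicator_eq_one _
    (fun b : Finset (Fin N) × Finset (Fin N) => i ∈ b.1 ∧ j ∈ b.2) h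
  exact ⟨b, hb, h1, (S.h2Matrix_apply i j).trans (h2 fun b => S.blockEntry b i j)⟩

theorem mem_far {b : Finset (Fin N) × Finset (Fin N)} :
    b ∈ S.far ↔ b ∈ S.blockLeaves S.clusterTree S.clusterTree ∧ S.Admissible b.1 b.2 := by
  simp [far]

theorem chebPt_mem_box {X : Finset (Fin N)} (hX : X.Nonempty) (n : S.Idx) :
    S.chebPt X n ∈ S.box X :=
  S.pt_mem_box hX fun j => abs_chebNode_le S.p (n j)

/-- The block partition is symmetric and so is the kernel on `E`, which contains the interpolation
points of the far-field boxes. -/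
theorem isHermitian_h2Matrix {E : Set (Pt d)} (hx : ∀ i, S.x i ∈ E)
    (hfar : ∀ b ∈ S.far, S.box b.1 ⊆ E ∧ S.box b.2 ⊆ E)
    (hρ : ∀ y ∈ E, ∀ y' ∈ E, S.ρ y y' = S.ρ y' y) : S.h2Matrix.IsHermitian := by
  refine Matrix.IsHermitian.ext fun i j => ?_
  rw [star_trivial, h2Matrix_apply, h2Matrix_apply, S.sum_blockLeaves_swap]
  refine congrArg _ (List.map_congr_left fun b hb => ?_)
  simp only [and_comm (a := j ∈ b.2)]
  by_cases h : i ∈ b.1 ∧ j ∈ b.2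
  swap
  · simp [h]
  rw [if_pos h, if_pos h, blockEntry, blockEntry]
  by_cases ha : S.Admissible b.1 b.2
  · obtain ⟨h1, h2⟩ := hfar b (S.mem_far.2 ⟨hb, ha⟩)
    rw [if_pos (S.admissible_comm.1 ha), if_pos ha, Finset.sum_comm]
    refine Finset.sum_congr rfl fun n _ => Finset.sum_congr rfl fun m _ => ?_
    rw [M, M, hρ _ (h2 (S.chebPt_mem_box ⟨j, h.2⟩ m)) _ (h1 (S.chebPt_mem_box ⟨i, h.1⟩ n))]
    ring
  · rw [if_neg fun h' => ha (S.admissible_comm.1 h'), if_neg ha]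
    exact hρ _ (hx j) _ (hx i)

theorem frobNorm_covMatrix_sub_h2Matrix_le {E : Set (Pt d)} {c₁ c₂ : ℝ} (hd : 1 ≤ d)
    (hE : IsOpen E) (hc₁ : 0 < c₁) (hc₂ : 0 < c₂) (hη : 0 < S.η)
    (hρ : IsAsymptoticallySmooth E S.ρ c₁ c₂) (hp : 1 ≤ S.p)
    (hfar : ∀ b ∈ S.far, S.box b.1 ⊆ E ∧ S.box b.2 ⊆ E) (hT : S.clusterTree.WF) :
    frobNorm (S.covMatrix - S.h2Matrix) ≤ 4 * d * c₁ * 12 ^ (2 * d - 1) * N *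
      (Real.log S.p + 1) ^ (2 * d - 1) * (S.η / (4 * c₂)) ^ S.p := by
  have hlog : 0 ≤ Real.log S.p := Real.log_nonneg (by exact_mod_cast hp)
  have he : (0 : ℝ) ≤ 2 * d * (12 * (Real.log S.p + 1)) ^ (2 * d - 1) *
      (2 * c₁ * (S.η / (4 * c₂)) ^ S.p) := by positivity
  refine (frobNorm_le_of_abs_le he fun i j => ?_).trans_eq (by rw [mul_pow]; ring)
  obtain ⟨b, hb, h1, h2⟩ := S.exists_h2Matrix_eq_blockEntry hT i j
  rw [Matrix.sub_apply, h2, blockEntry]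
  split_ifs with ha
  · obtain ⟨h3, h4⟩ := hfar b (S.mem_far.2 ⟨hb, ha⟩)
    exact S.abs_block_error_le hd hE hc₁ hc₂ hη hρ hp h3 h4 ha h1.1 h1.2
  · rwa [sub_self, abs_zero]

/-! ### Quasi-uniform points -/

theorem length_blockLeaves_le_of_isQuasiUniform {D : Set (Pt d)} {Cu R : ℝ} (hd : 1 ≤ d)
    (hN : 1 ≤ N) (hCu : 0 < Cu) (hR : ∀ y ∈ D, ∀ z ∈ D, dist y z ≤ R)
    (hx : IsQuasiUniform D S.x Cu) (hS : S.SplitsLongestEdge) (hη : 0 < S.η)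
    (hT : S.clusterTree.WF) (hG : S.Geometric S.clusterTree) :
    ((S.blockLeaves S.clusterTree S.clusterTree).length : ℝ) ≤
      (1 + 48 * (4 * (d / S.η) + 8) ^ d * (4 * d * R * Cu) ^ d) * N := by
  have hd0 : (0 : ℝ) < d := by exact_mod_cast hd
  have hN0 : (0 : ℝ) < N := by exact_mod_cast hN
  have hN1 : (1 : ℝ) ≤ N := by exact_mod_cast hN
  set t : ℝ := (N : ℝ) ^ (-(1 : ℝ) / (d : ℝ)) with ht
  have ht0 : 0 < t := Real.rpow_pos_of_pos hN0 _
  have htd : t⁻¹ ^ d = N := by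
    rw [ht, ← Real.rpow_neg hN0.le, ← Real.rpow_natCast, ← Real.rpow_mul hN0.le]
    have : -(-(1 : ℝ) / (d : ℝ)) * d = 1 := by field_simp
    rw [this, Real.rpow_one]
  -- The factor 2 makes the separation strictly larger than dh. With edge(root) ≤ R one gets (2
  -- edge/h)^d ≤ (4dRCu)^d N.
  set h : ℝ := Cu⁻¹ * t / (2 * d) with hh
  have hh0 : 0 < h := by positivity
  have hsep : ∀ i i', i ≠ i' → d * h < dist (S.x i) (S.x i') := by
    intro i i' hi
    refine lt_of_lt_of_le ?_ (hx.2.1 i i' hi)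
    have e : d * h = Cu⁻¹ * t / 2 := by rw [hh]; field_simp
    rw [e]
    exact half_lt_self (by positivity)
  have hn : S.clusterTree.pts.Nonempty := hT.nonempty
  have hedge : S.edge S.clusterTree.pts ≤ R := by
    obtain ⟨i, -, hi⟩ := S.exists_eq_hi hn (S.dir S.clusterTree.pts)
    obtain ⟨j, -, hj⟩ := S.exists_eq_lo hn (S.dir S.clusterTree.pts)
    rw [← S.hi_sub_lo_dir, ← hi, ← hj]
    exact ((le_abs_self _).trans (abs_sub_le_dist _ _ _)).trans (hR _ (hx.1 i) _ (hx.1 j))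
  have hedge0 := S.edge_nonneg hn
  refine (S.length_blockLeaves_clusterTree_le hS hη hh0 hd hsep hT hG).trans ?_
  have h1 : 2 * S.edge S.clusterTree.pts / h ≤ 4 * d * R * Cu * t⁻¹ := by
    calc 2 * S.edge S.clusterTree.pts / h ≤ 2 * R / h := by gcongr
      _ = _ := by rw [hh]; field_simp; ring
  have h2 : (2 * S.edge S.clusterTree.pts / h) ^ d ≤ (4 * d * R * Cu) ^ d * N := by
    rw [← htd, ← mul_pow]
    exact pow_le_pow_left₀ (by positivity) h1 d
  have h3 : 48 * (4 * (d / S.η) + 8) ^ d * (2 * S.edge S.clusterTree.pts / h) ^ d ≤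
      48 * (4 * (d / S.η) + 8) ^ d * ((4 * d * R * Cu) ^ d * N) := by gcongr
  linarith

theorem injective_of_isQuasiUniform {d N : ℕ} {D : Set (Pt d)} {x : Fin N → Pt d} {Cu : ℝ}
    (hCu : 0 < Cu) (hN : 1 ≤ N) (hx : IsQuasiUniform D x Cu) : Function.Injective x := by
  intro i j hij
  by_contra h
  have h1 := hx.2.1 i j h
  rw [hij, dist_self] at h1
  have h2 : (0 : ℝ) < (N : ℝ) ^ (-(1 : ℝ) / (d : ℝ)) :=
    Real.rpow_pos_of_pos (by exact_mod_cast hN) _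
  have := mul_pos (inv_pos.2 hCu) h2
  linarith

end H2Data

end

-- Assembly of the theorem

theorem theorem3p6 (d : ℕ) (hd : 1 ≤ d) (c₁ : ℝ) (hc₁ : 0 < c₁) :
    ∃ C_H : ℝ, 0 < C_H ∧
      ∀ (D : Set (Pt d)), IsLipschitzDomain D →
      ∀ (Cleaf : ℕ) (Cu η : ℝ), 2 ≤ Cleaf → 0 < Cu → 0 < η →
      ∃ C_op : ℝ, 0 < C_op ∧
        ∀ (c₂ : ℝ), 0 < c₂ → η < 4 * c₂ →
        ∀ (E : Set (Pt d)), IsOpen E → D ⊆ E →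
        ∀ (Ω : Type*) [MeasurableSpace Ω] (P : MeasureTheory.Measure Ω)
          [MeasureTheory.IsProbabilityMeasure P]
          (Z : Pt d → Ω → ℝ) (ρ : Pt d → Pt d → ℝ),
          IsGaussianFieldWithCov P E Z ρ → IsAsymptoticallySmooth E ρ c₁ c₂ →
        ∀ (N : ℕ), 1 ≤ N → ∀ (S : H2Data d N),
          S.ρ = ρ → S.Cleaf = Cleaf → S.η = η → 1 ≤ S.p →
          IsQuasiUniform D S.x Cu → S.SplitsLongestEdge →
          (∀ b ∈ S.far, S.box b.1 ⊆ E ∧ S.box b.2 ⊆ E) →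
          frobNorm (S.covMatrix - S.h2Matrix) ≤
            C_H * N * (Real.log S.p + 1) ^ (2 * d - 1) * (η / (4 * c₂)) ^ S.p ∧
          (C_H * N * (Real.log S.p + 1) ^ (2 * d - 1) * (η / (4 * c₂)) ^ S.p
              < lambdaMin S.covMatrix → S.h2Matrix.PosDef) ∧
          (S.h2Matrix.PosDef → ∀ s : ℝ, 0 < s → s < 2 * (specNorm S.h2Matrix)⁻¹ →
            max |1 - s * lambdaMax S.h2Matrix| |1 - s * lambdaMin S.h2Matrix| < 1 ∧
            ∀ (k : ℕ) (mem : ℕ → Fin N → ℝ),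
              let z : Fin N → ℝ := mem 0
              let κ : ℝ := max |1 - s * lambdaMax S.h2Matrix| |1 - s * lambdaMin S.h2Matrix|
              let run := runProg S.matVec s (recursiveSqrt k) mem
              let y : Fin N → ℝ := run.val 0
              let A := (coupledSchulz (s • S.h2Matrix) k).1
              let B := (coupledSchulz (s • S.h2Matrix) k).2
              schulz (Matrix.fromBlocks 0 (s • S.h2Matrix) 1 0) k = Matrix.fromBlocks 0 A B 0 ∧
              y = (Real.sqrt s)⁻¹ • A.mulVec z ∧
              eucNorm ((CFC.sqrt S.covMatrix).mulVec z - y) ≤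
                ((Real.sqrt s)⁻¹ * κ ^ (2 ^ k) +
                  2 * C_H * N * (Real.log S.p + 1) ^ (2 * d - 1) * (η / (4 * c₂)) ^ S.p /
                    Real.sqrt (max (lambdaMin S.covMatrix) (lambdaMin S.h2Matrix)))
                  * eucNorm z ∧
              (run.ops : ℝ) ≤ C_op * 3 ^ k * (S.p : ℝ) ^ (2 * d) * N ∧
              ((progRegs (recursiveSqrt k)).erase 0).card * N ≤ k * N) := by
  -- The product of 2d · 12^(2d-1), from two-sided interpolation, and 2c₁, from interpolation on a
  -- line.
  refine ⟨4 * d * c₁ * 12 ^ (2 * d - 1), by positivity,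
    fun D hD Cleaf Cu η hCleaf hCu hη => ?_⟩
  obtain ⟨R, hR0, hR⟩ : ∃ R : ℝ, 0 < R ∧ ∀ y ∈ D, ∀ z ∈ D, dist y z ≤ R := by
    obtain ⟨R, hR⟩ := Metric.isBounded_iff.1 hD.2.2.1
    exact ⟨max R 1, by positivity, fun y hy z hz => (hR hy hz).trans (le_max_left _ _)⟩
  -- The two transformations cost 12 per point, coupling and near field 2 + 2 Cleaf² per block, all
  -- times p^(2d); the long factor bounds the number of blocks per point, and 4 accounts for the
  -- vector operations.
  refine ⟨12 + (2 + 2 * Cleaf ^ 2) *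
    (1 + 48 * (4 * (d / η) + 8) ^ d * (4 * d * R * Cu) ^ d) + 4, by positivity, ?_⟩
  intro c₂ hc₂ _ E hE hDE Ω _ P _ Z ρ hZ hρ N hN S hSρ hSC hSη hp hx hdir hfar
  subst hSρ hSC hSη
  have hinj := H2Data.injective_of_isQuasiUniform hCu hN hx
  have hC1 : 1 ≤ S.Cleaf := by omega
  have hxE : ∀ i, S.x i ∈ E := fun i => hDE (hx.1 i)
  have hT : S.clusterTree.WF := S.wf_build hinj hdir hC1 N ⟨⟨0, hN⟩, Finset.mem_univ _⟩
  have hG : S.Geometric S.clusterTree := S.geometric_build hC1 N Finset.univ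
  have hpsd := hZ.posSemidef_covMatrix hxE
  have hfrob := S.frobNorm_covMatrix_sub_h2Matrix_le hd hE hc₁ hc₂ hη hρ hp hfar hT
  have hsymm := S.isHermitian_h2Matrix hxE hfar fun y hy y' hy' => hZ.cov_comm hy hy'
  refine ⟨hfrob, fun h => posDef_of_frobNorm_lt hsymm (hfrob.trans_lt h),
    fun hpd s hs hs2 => ⟨contraction_lt_one hN hpd hs hs2, fun k mem => ?_⟩⟩
  have hy := val_recursiveSqrt (s := s) (S.val_matVec hT) k mem
  refine ⟨schulz_fromBlocks _ k, hy, ?_, ?_, ?_⟩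
  · have hm : 0 < max (lambdaMin S.covMatrix) (lambdaMin S.h2Matrix) :=
      (lambdaMin_pos hN hpd).trans_le (le_max_right _ _)
    have h1 := eucNorm_sqrt_sub_sqrt_mulVec_le hpsd hpd.posSemidef hm (mem 0)
    have h2 := eucNorm_sqrt_sub_coupledSchulz_le hN hpd hs hs2 k (mem 0)
    -- The triangle inequality through √C_p separates the perturbation of the matrix from the error
    -- of the iteration.
    rw [hy, ← sub_add_sub_cancel _ ((CFC.sqrt S.h2Matrix).mulVec (mem 0)) _, add_mul]
    refine (eucNorm_add_le _ _).trans ?_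
    rw [add_comm]
    refine add_le_add h2 (h1.trans ?_)
    gcongr
    · exact eucNorm_nonneg _
    -- The perturbation bound holds with the factor 1, so the 2 in the claim is slack.
    · exact hfrob.trans (by
        have := (frobNorm_nonneg _).trans hfrob
        linarith)
  · have hL := S.length_blockLeaves_le_of_isQuasiUniform hd hN hCu hR hx hdir hη hT hG
    have hops := ops_recursiveSqrt_le (s := s) hN
      (fun v => S.ops_matVec_le hinj hdir hC1 hp hT v) k mem
    have hops' := (Nat.cast_le (α := ℝ)).2 hops
    push_cast at hops'
    set L : ℝ := ((S.blockLeaves S.clusterTree S.clusterTree).length : ℝ)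
    set K : ℝ := 1 + 48 * (4 * (d / S.η) + 8) ^ d * (4 * d * R * Cu) ^ d
    have hP : (1 : ℝ) ≤ (S.p : ℝ) ^ (2 * d) := one_le_pow₀ (by exact_mod_cast hp)
    have hPe : ((S.p : ℝ) ^ d) ^ 2 = (S.p : ℝ) ^ (2 * d) := by rw [← pow_mul, mul_comm]
    rw [hPe] at hops'
    refine hops'.trans ?_
    calc (3 : ℝ) ^ k * ((S.p : ℝ) ^ (2 * d) * (12 * N + (2 + 2 * (S.Cleaf : ℝ) ^ 2) * L) + 4 * N)
        ≤ 3 ^ k * ((S.p : ℝ) ^ (2 * d) * (12 * N + (2 + 2 * (S.Cleaf : ℝ) ^ 2) * (K * N)) +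
            (S.p : ℝ) ^ (2 * d) * (4 * N)) := by
          refine mul_le_mul_of_nonneg_left (add_le_add (by gcongr) ?_) (by positivity)
          exact le_mul_of_one_le_left (by positivity) hP
      _ = _ := by ring
  · exact Nat.mul_le_mul_right N (card_progRegs_recursiveSqrt_le k)
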